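/- Let $\Sigma$ be a compact connected Riemann surface of genus $g$ without boundary, and fix a canonical dissection of $\Sigma$: loops $\delta_1,\dots,\delta_g$ ($A$-cycles) and $\delta_{g+1},\dots,\delta_{2g}$ ($B$-cycles) issued from a point $p_0$, simple and pairwise meeting only at $p_0$, together with a smooth map $\pi:\Delta\to\Sigma$ from a closed disc $\Delta$, viewed as a $4g$-gon, onto $\Sigma$, which maps the interior of $\Delta$ diffeomorphically and preserving orientation onto the complement of the loops, and maps the sides of $\Delta$, read counter-clockwise, to $\delta_1,\delta_{g+1},\delta_1^{-1},\delta_{g+1}^{-1},\dots,\delta_g,\delta_{2g},\delta_g^{-1},\delta_{2g}^{-1}$. (For $g=0$ there are no loops, and $\pi$ collapses $\partial\Delta$ to $p_0$.) Let $D\subset\Sigma$ be a finite set not meeting $\pi(\partial\Delta)$; its points are also regarded as points of the interior of $\Delta$. For $0\le p,q\le 1$ let $\mathcal A^{p,q}(\Sigma,\star D)$ be the space of $(p,q)$-forms that are smooth on $\Sigma-D$ and, near each point of $D$, a smooth form divided by a power $z^n$ ($n\geq 0$) of a local holomorphic coordinate $z$ centred there; let $\mathcal A^{2}(\Sigma,\log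 D)$ be the space of $2$-forms that are smooth on $\Sigma - D$ and, near each point of $D$, of the form $\beta\wedge\frac{dz}{z}$ with $\beta$ a smooth $(0,1)$-form. The regularized integral of $\omega\in\mathcal A^{1,1}(\Sigma,\star D)$ is $$⨍_\Sigma\omega:=\int_\Sigma\eta\qquad\text{for any decomposition }\omega=\eta+\partial\beta,\quad \eta\in\mathcal A^2(\Sigma,\log D),\ \beta\in\mathcal A^{0,1}(\Sigma,\star D);$$ such decompositions exist, the integrals $\int_\Sigma\eta$ converge absolutely, and they do not depend on the decomposition. For a $1$-form $\theta$ which near $p\in D$ is a smooth form divided by a power of a local coordinate $z$ centred at $p$, put $\operatorname{Res}_p\theta:=\frac1{2\pi i}\lim_{\varepsilon\to0^+}\int_{|z|=\varepsilon}\theta$, with the circle oriented counter-clockwise; this limit exists and does not depend on $z$. **Proposition.** Let $\varphi$ be a meromorphic $(1,0)$-form on $\Sigma$ with poles contained in $D$, and let $\alpha$ be a smooth closed complex-valued $1$-form on $\Sigma$. Choose a point of $\Delta$ over $p_0$, again denoted $p_0$, and let $u$ be the function on $\Delta$ given by $$u(z)=\int_{p_0}^z\pi^*\alpha ,\qquad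 z\in\Delta,$$ where the integral is over an arbitrary $C^1$ curve inside $\Delta$ from $p_0$ to $z$ (it does not depend on the curve). Then $$⨍_\Sigma\varphi\wedge\alpha=\sum_{i=1}^g\left(\int_{\delta_i}\varphi\int_{\delta_{g+i}}\alpha-\int_{\delta_i}\alpha\int_{\delta_{g+i}}\varphi\right)+2\pi i\sum_{p\in D}\operatorname{Res}_p\big(\pi^*(\varphi)\,u\big).$$ -/

import Mathlib

open scoped Manifold ContDiff Topology
open MeasureTheory

/-- The Wirtinger derivative `∂f/∂z = (∂f/∂x - i ∂f/∂y) / 2`. -/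
noncomputable def wirtingerD (f : ℂ → ℂ) (z : ℂ) : ℂ :=
  (fderiv ℝ f z 1 - Complex.I * fderiv ℝ f z Complex.I) / 2

/-- The Wirtinger derivative `∂f/∂z̄ = (∂f/∂x + i ∂f/∂y) / 2`. -/
noncomputable def wirtingerDbar (f : ℂ → ℂ) (z : ℂ) : ℂ :=
  (fderiv ℝ f z 1 + Complex.I * fderiv ℝ f z Complex.I) / 2

namespace RiemannSurface

variable {X : Type*} [TopologicalSpace X] [ChartedSpace ℂ X]

variable (X) in
/-- A complex-valued smooth `1`-form on `X - D`: to every holomorphic coordinate `z = e` of the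
atlas it assigns an expression `a dz + b dz̄` with `a`, `b` smooth on the image of the chart (away
from `D`), and these expressions agree under changes of coordinates.  The values of the coefficients
outside `e.target` or at points of `D` carry no information. -/
structure OneForm (D : Set X) where
  /-- the coefficient of `dz` -/
  dz : OpenPartialHomeomorph X ℂ → ℂ → ℂ
  /-- the coefficient of `dz̄` -/
  dzbar : OpenPartialHomeomorph X ℂ → ℂ → ℂ
  smooth_dz : ∀ e ∈ atlas ℂ X, ContDiffOn ℝ ∞ (dz e) (e.target ∩ e.symm ⁻¹' Dᶜ)
  smooth_dzbar : ∀ e ∈ atlas ℂ X, ContDiffOn ℝ ∞ (dzbar e) (e.target ∩ e.symm ⁻¹' Dᶜ)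
  compat_dz : ∀ e ∈ atlas ℂ X, ∀ e' ∈ atlas ℂ X, ∀ x ∈ e.source ∩ e'.source, x ∉ D →
    dz e (e x) = dz e' (e' x) * deriv (e' ∘ e.symm) (e x)
  compat_dzbar : ∀ e ∈ atlas ℂ X, ∀ e' ∈ atlas ℂ X, ∀ x ∈ e.source ∩ e'.source, x ∉ D →
    dzbar e (e x) = dzbar e' (e' x) * starRingEnd ℂ (deriv (e' ∘ e.symm) (e x))

variable (X) in
/-- A complex-valued smooth `2`-form on `X - D`, given in every coordinate `z = e` of the atlas by
an expression `w dz ∧ dz̄`. -/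
structure TwoForm (D : Set X) where
  /-- the coefficient of `dz ∧ dz̄` -/
  coeff : OpenPartialHomeomorph X ℂ → ℂ → ℂ
  smooth : ∀ e ∈ atlas ℂ X, ContDiffOn ℝ ∞ (coeff e) (e.target ∩ e.symm ⁻¹' Dᶜ)
  compat : ∀ e ∈ atlas ℂ X, ∀ e' ∈ atlas ℂ X, ∀ x ∈ e.source ∩ e'.source, x ∉ D →
    coeff e (e x) = coeff e' (e' x) *
      (deriv (e' ∘ e.symm) (e x) * starRingEnd ℂ (deriv (e' ∘ e.symm) (e x)))

/-- `φ ∧ α` for a form `φ` on `X - D` and a form `α` on all of `X`: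
`(a dz + b dz̄) ∧ (a' dz + b' dz̄) = (a b' - b a') dz ∧ dz̄`. -/
noncomputable def OneForm.wedge {D : Set X} (φ : OneForm X D) (α : OneForm X (∅ : Set X)) :
    TwoForm X D where
  coeff e z := φ.dz e z * α.dzbar e z - φ.dzbar e z * α.dz e z
  smooth e he :=
    ((φ.smooth_dz e he).mul ((α.smooth_dzbar e he).mono (by intro z hz; simpa using hz.1))).sub
      ((φ.smooth_dzbar e he).mul ((α.smooth_dz e he).mono (by intro z hz; simpa using hz.1)))
  compat e he e' he' x hx hxD := by
    rw [φ.compat_dz e he e' he' x hx hxD, φ.compat_dzbar e he e' he' x hx hxD,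
      α.compat_dz e he e' he' x hx (Set.notMem_empty x),
      α.compat_dzbar e he e' he' x hx (Set.notMem_empty x)]
    ring

/-- `dα = 0`, where `d(a dz + b dz̄) = (∂b/∂z - ∂a/∂z̄) dz ∧ dz̄`. -/
def OneForm.IsClosed (α : OneForm X (∅ : Set X)) : Prop :=
  ∀ e ∈ atlas ℂ X, ∀ z ∈ e.target, wirtingerD (α.dzbar e) z - wirtingerDbar (α.dz e) z = 0

/-- The form is a meromorphic `(1,0)`-form, holomorphic on `X - D`. -/
def OneForm.IsMeromorphic {D : Set X} (φ : OneForm X D) : Prop :=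
  ∀ e ∈ atlas ℂ X,
    (∀ z ∈ e.target, e.symm z ∉ D → φ.dzbar e z = 0) ∧
    DifferentiableOn ℂ (φ.dz e) (e.target ∩ e.symm ⁻¹' Dᶜ) ∧
    ∀ p ∈ e.source, p ∈ D → MeromorphicAt (φ.dz e) (e p)

/-- The form belongs to `𝒜^{0,1}(X, ⋆D)`: it has type `(0,1)`, and near every point of `D` its
coefficient is a smooth function divided by a power of the local coordinate centred there. -/
def OneForm.IsZeroOneWithPoles {D : Set X} (β : OneForm X D) : Prop :=
  ∀ e ∈ atlas ℂ X,
    (∀ z ∈ e.target, e.symm z ∉ D → β.dz e z = 0) ∧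
    ∀ p ∈ e.source, p ∈ D → ∃ (n : ℕ) (f : ℂ → ℂ), ContDiffAt ℝ ∞ f (e p) ∧
      ∀ᶠ z in 𝓝[≠] (e p), β.dzbar e z = f z / (z - e p) ^ n

/-- The form belongs to `𝒜^2(X, log D)`: near every point of `D` it is a smooth `(0,1)`-form wedge
`dz / z`, for a local coordinate `z` centred there. -/
def TwoForm.IsLog {D : Set X} (η : TwoForm X D) : Prop :=
  ∀ e ∈ atlas ℂ X, ∀ p ∈ e.source, p ∈ D → ∃ f : ℂ → ℂ, ContDiffAt ℝ ∞ f (e p) ∧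
    ∀ᶠ z in 𝓝[≠] (e p), η.coeff e z = f z / (z - e p)

/-- The integral of `η` over `X` (with its complex orientation) converges absolutely and equals `I`.
It is computed by partitions of unity subordinate to the coordinate domains, with
`dz ∧ dz̄ = -2i dx ∧ dy`. -/
def TwoForm.HasIntegral {D : Set X} (η : TwoForm X D) (I : ℂ) : Prop :=
  ∀ ρ : PartitionOfUnity X X Set.univ, ρ.IsSubordinate (fun x => (chartAt ℂ x).source) →
    (∀ x, IntegrableOn
      (fun z : ℂ => (ρ x ((chartAt ℂ x).symm z) : ℂ) *
        (η.coeff (chartAt ℂ x) z * (-2 * Complex.I))) (chartAt ℂ x).target) ∧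
    ∑ᶠ x, ∫ z in (chartAt ℂ x).target,
      (ρ x ((chartAt ℂ x).symm z) : ℂ) * (η.coeff (chartAt ℂ x) z * (-2 * Complex.I)) = I

/-- `Ω = η + ∂β` on `X - D` with `η ∈ 𝒜^2(X, log D)` and `β ∈ 𝒜^{0,1}(X, ⋆D)`; in coordinates,
`∂(b dz̄) = (∂b/∂z) dz ∧ dz̄`. -/
def TwoForm.IsLogDecomposition {D : Set X} (Ω η : TwoForm X D) (β : OneForm X D) : Prop :=
  η.IsLog ∧ β.IsZeroOneWithPoles ∧
    ∀ e ∈ atlas ℂ X, ∀ z ∈ e.target, e.symm z ∉ D →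
      Ω.coeff e z = η.coeff e z + wirtingerD (β.dzbar e) z

/-- The regularized integral over `X` (a compact surface without boundary) of the `2`-form `Ω` with
poles along `D` is well defined and equals `I`: decompositions `Ω = η + ∂β` as above exist, and
`∫ η = I` for every one of them. -/
def TwoForm.HasRegularizedIntegral {D : Set X} (Ω : TwoForm X D) (I : ℂ) : Prop :=
  (∃ (η : TwoForm X D) (β : OneForm X D), Ω.IsLogDecomposition η β) ∧
    ∀ (η : TwoForm X D) (β : OneForm X D), Ω.IsLogDecomposition η β → η.HasIntegral I

/-- The integral of a `1`-form along a curve `γ : [0,1] → X`; the integrand is written in a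
coordinate around `γ t` and does not depend on that coordinate. -/
noncomputable def OneForm.curveIntegral {D : Set X} (η : OneForm X D) (γ : ℝ → X) : ℂ :=
  ∫ t in (0 : ℝ)..1,
    (η.dz (chartAt ℂ (γ t)) (chartAt ℂ (γ t) (γ t)) * deriv (chartAt ℂ (γ t) ∘ γ) t +
      η.dzbar (chartAt ℂ (γ t)) (chartAt ℂ (γ t) (γ t)) *
        starRingEnd ℂ (deriv (chartAt ℂ (γ t) ∘ γ) t))

/-- The `(1,0)`-form `v φ` (with `φ` of type `(1,0)` and `v` a function near `p`) has residue `r` at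
`p`: `(1 / 2πi) ∫_{|z| = ε} v φ → r` as `ε → 0+`, for the coordinates `z = e - e p` centred at
`p`. -/
def OneForm.HasResidueMul {D : Set X} (φ : OneForm X D) (v : X → ℂ) (p : X) (r : ℂ) : Prop :=
  ∀ e ∈ atlas ℂ X, p ∈ e.source →
    Filter.Tendsto (fun ε : ℝ => (2 * Real.pi * Complex.I)⁻¹ *
      ∮ z in C(e p, ε), φ.dz e z * v (e.symm z)) (𝓝[>] 0) (𝓝 r)

/-- The point at parameter `t ∈ [0,1]` of the `k`-th of the `4g` equal arcs, each traversed
counter-clockwise, into which the unit circle is divided. -/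
noncomputable def boundaryArc (g k : ℕ) (t : ℝ) : ℂ :=
  Complex.exp (2 * Real.pi * Complex.I * (((k : ℂ) + (t : ℂ)) / (4 * (g : ℂ))))

variable (X) in
/-- A canonical dissection of `X` of genus `g`: loops `δ (inl i)` (the `A`-cycles) and `δ (inr i)`
(the `B`-cycles) issued from a base point, which are simple and meet only there, and whose complement
is a simply connected region.  The cut surface `Δ` is the closed unit disc, seen as a `4g`-gon with
the arcs `boundaryArc g k` as its sides, and `proj : Δ → X` is the quotient map: it is smooth, maps
the interior of `Δ` diffeomorphically and with preserved orientation onto the complement of the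
loops, and glues the sides according to the word `∏ Aᵢ Bᵢ Aᵢ⁻¹ Bᵢ⁻¹`, read counter-clockwise.
For `g = 0` there are no loops and the boundary of the disc is collapsed to the base point. -/
structure CanonicalDissection (g : ℕ) where
  /-- the base point of the loops -/
  basePoint : X
  /-- the cycles -/
  δ : Fin g ⊕ Fin g → ℝ → X
  /-- the quotient map from the cut surface -/
  proj : ℂ → X
  smooth_proj : ContMDiffOn 𝓘(ℝ, ℂ) 𝓘(ℝ, ℂ) ∞ proj (Metric.closedBall 0 1)
  surj_proj : proj '' Metric.closedBall 0 1 = Set.univ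
  injOn_interior : Set.InjOn proj (Metric.ball 0 1)
  interior_boundary : ∀ z ∈ Metric.ball (0 : ℂ) 1, ∀ w ∈ Metric.sphere (0 : ℂ) 1, proj z ≠ proj w
  orientation : ∀ z ∈ Metric.ball (0 : ℂ) 1, ∀ e ∈ atlas ℂ X, proj z ∈ e.source →
    0 < (fderiv ℝ (e ∘ proj) z).det
  side_A : ∀ i : Fin g, ∀ t ∈ Set.Icc (0 : ℝ) 1,
    proj (boundaryArc g (4 * i) t) = δ (Sum.inl i) t
  side_B : ∀ i : Fin g, ∀ t ∈ Set.Icc (0 : ℝ) 1,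
    proj (boundaryArc g (4 * i + 1) t) = δ (Sum.inr i) t
  side_A_inv : ∀ i : Fin g, ∀ t ∈ Set.Icc (0 : ℝ) 1,
    proj (boundaryArc g (4 * i + 2) t) = δ (Sum.inl i) (1 - t)
  side_B_inv : ∀ i : Fin g, ∀ t ∈ Set.Icc (0 : ℝ) 1,
    proj (boundaryArc g (4 * i + 3) t) = δ (Sum.inr i) (1 - t)
  δ_zero : ∀ k, δ k 0 = basePoint
  δ_one : ∀ k, δ k 1 = basePoint
  δ_ne_basePoint : ∀ k, ∀ t ∈ Set.Ioo (0 : ℝ) 1, δ k t ≠ basePoint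
  δ_simple : ∀ k l, ∀ s ∈ Set.Ioo (0 : ℝ) 1, ∀ t ∈ Set.Ioo (0 : ℝ) 1,
    δ k s = δ l t → k = l ∧ s = t
  genus_zero : g = 0 → ∀ w ∈ Metric.sphere (0 : ℂ) 1, proj w = basePoint

/-- The cut locus, i.e. the union of the loops (and of the base point), as the image of the
boundary of the cut surface. -/
def CanonicalDissection.cutLocus {g : ℕ} (K : CanonicalDissection X g) : Set X :=
  K.proj '' Metric.sphere 0 1

/-- The point of the interior of the cut surface lying over a point of `X` outside of the cut
locus. -/
noncomputable def CanonicalDissection.lift {g : ℕ} (K : CanonicalDissection X g) : X → ℂ :=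
  Function.invFunOn K.proj (Metric.ball 0 1)

/-- `u z = ∫_{q₀}^z π^* α` for all points `z` of the cut surface, where the integral may be taken
over an arbitrary `C¹` curve inside the cut surface. -/
def CanonicalDissection.IsPathIntegral {g : ℕ} (K : CanonicalDissection X g)
    (α : OneForm X (∅ : Set X)) (q₀ : ℂ) (u : ℂ → ℂ) : Prop :=
  ∀ z ∈ Metric.closedBall (0 : ℂ) 1, ∀ γ : ℝ → ℂ, ContDiffOn ℝ 1 γ (Set.Icc 0 1) →
    Set.MapsTo γ (Set.Icc 0 1) (Metric.closedBall 0 1) → γ 0 = q₀ → γ 1 = z →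
      u z = α.curveIntegral (K.proj ∘ γ)

end RiemannSurface

/-! On the disc the closed form `π^*α` has a primitive `u`. Given a decomposition `φ ∧ α = η + ∂β`,
consider `Θ = u φ + β` on the disc (`cutForm`). Off the poles `φ` is closed and `∂β = dβ`, hence `dΘ
= α ∧ φ + ∂β = -η` (`extd_chartForm`). A logarithmic form is integrable and the loops have measure
zero, so `∫ η = -∫ dΘ` over the disc (`hasIntegral_neg_integral_extd`). Stokes' theorem then leaves
a contribution of the poles and one of the boundary.

At a pole the circle integrals of `β` tend to zero (`tendsto_circ_dbar`): on `|z - c| = ε` one has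
`dz̄ = -ε² dz / (z - c)²`, and integration by parts keeps the integrals of a smooth function over a
power of `z - c` bounded as `ε → 0`. The circle integrals of `Θ` converge because `dΘ` is
integrable. So the residue of `u φ` exists, and the pole contributes `2πi` times it. Cutoffs isolate
the poles from one another; what remains of `Θ` is continuous on the closed disc and obeys Stokes'
theorem without singularities (`integral_extd_cutForm`).

On two glued sides `φ` and `β` have opposite pull-backs, while the values of `u` differ by a
constant. Hence `β` cancels, and each pair of sides gives the jump of `u` times a period of `φ`. The
jump is minus the integral of `α` along the side between the two, which produces the bilinear
expression in the periods (`circ_cutForm`).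

Decompositions exist because `f / z^(n+1) = ∂(-f / (n z^n)) + (∂f / n) / z^n` for `n ≥ 1` lowers the
order of a pole down to one (`exists_pole_reduction`); the local solutions are multiplied by cutoffs
and added (`exists_logDecomposition`). -/

namespace RiemannSurface

open Complex Set Filter Metric

/-! ### Stokes' theorem on a plane annulus -/

/-- The exterior derivative of a complex-valued `1`-form on the plane, as the coefficient of
`dx ∧ dy`. -/
noncomputable def extd (σ : ℂ → ℂ →L[ℝ] ℂ) (z : ℂ) : ℂ :=
  fderiv ℝ σ z 1 I - fderiv ℝ σ z I 1

/-- The integral of a `1`-form on the plane over a circle. -/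
noncomputable def circ (σ : ℂ → ℂ →L[ℝ] ℂ) (c : ℂ) (r : ℝ) : ℂ :=
  ∫ θ in (0 : ℝ)..2 * Real.pi, σ (circleMap c r θ) (deriv (circleMap c r) θ)

/-- Alternating bilinear forms on the real plane form a line, so an antisymmetrization is determined
by its value on `(1, I)`. This is the source of every Jacobian factor relating values of `extd`. -/
theorem bilin_sub_swap (B : ℂ →L[ℝ] ℂ →L[ℝ] ℂ) (a b : ℂ) :
    B a b - B b a = ((a.re * b.im - a.im * b.re : ℝ) : ℂ) * (B 1 I - B I 1) := by
  have h : ∀ w : ℂ, w = w.re • (1 : ℂ) + w.im • I := fun w => by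
    simp [Complex.re_add_im]
  have e : ∀ a b : ℂ, B a b = a.re • b.re • B 1 1 + a.re • b.im • B 1 I + a.im • b.re • B I 1
      + a.im • b.im • B I I := fun a b => by
    conv_lhs => rw [h a, h b, map_add, map_smul, map_smul]
    simp only [add_apply, smul_apply, map_add, map_smul]
    simp only [Complex.real_smul]
    ring
  rw [e a b, e b a]
  simp only [Complex.real_smul]
  push_cast
  ring

theorem det_eq_re_im (L : ℂ →L[ℝ] ℂ) :
    L.det = (L 1).re * (L I).im - (L 1).im * (L I).re := by
  rw [ContinuousLinearMap.det, ← LinearMap.det_toMatrix Complex.basisOneI, Matrix.det_fin_two]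
  simp [LinearMap.toMatrix_apply, Complex.coe_basisOneI_repr]
  ring

theorem integrableOn_polarCoord {f : ℂ → ℂ} (hf : Integrable f) :
    IntegrableOn (fun p : ℝ × ℝ => p.1 • f (Complex.polarCoord.symm p)) polarCoord.target := by
  have h1 : Integrable (f ∘ measurableEquivRealProd.symm) :=
    (Complex.volume_preserving_equiv_real_prod.symm).integrable_comp_emb
      measurableEquivRealProd.symm.measurableEmbedding |>.2 hf
  have h2 := h1.integrableOn (s := polarCoord.symm '' polarCoord.target)
  rw [integrableOn_image_iff_integrableOn_abs_det_fderiv_smul volume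
    polarCoord.open_target.measurableSet
    (fun p _ => (hasFDerivAt_polarCoord_symm p).hasFDerivWithinAt) polarCoord.symm.injOn] at h2
  refine h2.congr_fun (fun p hp => ?_) polarCoord.open_target.measurableSet
  simp only [det_fderivPolarCoordSymm]
  rw [abs_of_pos hp.1]
  rfl

/-- Polar coordinates turn the annulus into a rectangle, where the divergence theorem applies. It
needs continuity up to the boundary but only differentiability inside and an integrable exterior
derivative. The case `ε = 0` is included and covers a full disc. -/
theorem integral_extd_annulus {σ : ℂ → ℂ →L[ℝ] ℂ} {c : ℂ} {ε R : ℝ} (h0 : 0 ≤ ε) (hεR : ε ≤ R)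
    (hc : ContinuousOn σ (closedBall c R \ ball c ε))
    (hd : ∀ z ∈ ball c R \ closedBall c ε, DifferentiableAt ℝ σ z)
    (hi : IntegrableOn (extd σ) (ball c R \ closedBall c ε)) :
    ∫ z in ball c R \ closedBall c ε, extd σ z = circ σ c R - circ σ c ε := by
  set A := ball c R \ closedBall c ε with hA
  have hAm : MeasurableSet A := measurableSet_ball.diff measurableSet_closedBall
  set f : ℂ → ℂ := fun w => A.indicator (extd σ) (c + w) with hf
  have hfi : Integrable f := ((integrable_indicator_iff hAm).2 hi).comp_add_left c
  have hE : ∀ p : ℝ × ℝ, c + Complex.polarCoord.symm p = circleMap c p.1 p.2 := fun p => by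
    rw [Complex.polarCoord_symm_apply, circleMap, Complex.exp_mul_I]; simp
  have hmem : ∀ p : ℝ × ℝ, 0 ≤ p.1 → (circleMap c p.1 p.2 ∈ A ↔ p.1 ∈ Ioo ε R) := fun p hp => by
    simp [hA, circleMap, abs_of_nonneg hp, and_comm]
  have h1 : ∫ z in A, extd σ z = ∫ p in polarCoord.target,
      p.1 • A.indicator (extd σ) (circleMap c p.1 p.2) := by
    rw [← integral_indicator hAm, ← integral_add_left_eq_self _ c,
      ← Complex.integral_comp_polarCoord_symm]
    simp only [hE]
  have h1' : IntegrableOn (fun p : ℝ × ℝ => p.1 • A.indicator (extd σ) (circleMap c p.1 p.2))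
      polarCoord.target := by
    have := integrableOn_polarCoord hfi
    simpa only [hf, hE] using this
  set S : Set (ℝ × ℝ) := Ioo ε R ×ˢ Ioo (-Real.pi) Real.pi with hS
  have hSm : MeasurableSet S := measurableSet_Ioo.prod measurableSet_Ioo
  have hST : S ⊆ polarCoord.target := fun p hp => ⟨h0.trans_lt hp.1.1, hp.2⟩
  have h2 : ∫ z in A, extd σ z = ∫ p in S, p.1 • extd σ (circleMap c p.1 p.2) := by
    rw [h1, setIntegral_eq_of_subset_of_forall_sdiff_eq_zero
      polarCoord.open_target.measurableSet hST]
    · refine setIntegral_congr_fun hSm fun p hp => ?_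
      rw [indicator_of_mem ((hmem p (h0.trans hp.1.1.le)).2 hp.1)]
    · intro p hp
      have hp1 : (0 : ℝ) < p.1 := hp.1.1
      rw [indicator_of_notMem, smul_zero]
      rw [hmem p hp1.le]
      exact fun h => hp.2 ⟨h, hp.1.2⟩
  have h2' : IntegrableOn (fun p : ℝ × ℝ => p.1 • extd σ (circleMap c p.1 p.2)) S := by
    refine (h1'.mono_set hST).congr_fun (fun p hp => ?_) hSm
    simp only
    rw [indicator_of_mem ((hmem p (h0.trans hp.1.1.le)).2 hp.1)]
  -- the rectangle
  set Φ : ℝ × ℝ → ℂ := fun p => circleMap c p.1 p.2 with hΦ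
  set e : ℝ × ℝ → ℂ := fun p => exp (p.2 * I) with he
  set E' : ℝ × ℝ → (ℝ × ℝ →L[ℝ] ℂ) := fun p =>
    (ContinuousLinearMap.snd ℝ ℝ ℝ).smulRight (e p * I) with hE'
  set Φ' : ℝ × ℝ → (ℝ × ℝ →L[ℝ] ℂ) := fun p =>
    (ContinuousLinearMap.fst ℝ ℝ ℝ).smulRight (e p) +
    (ContinuousLinearMap.snd ℝ ℝ ℝ).smulRight (p.1 * (e p * I)) with hΦ'
  have hed : ∀ p, HasFDerivAt e (E' p) p := fun p => by
    have a1 : HasDerivAt (fun t : ℝ => exp (t * I)) (exp (p.2 * I) * I) p.2 := by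
      have := ((hasDerivAt_id p.2).ofReal_comp.mul_const I).cexp
      simpa using this
    have a2 : HasFDerivAt (fun q : ℝ × ℝ => q.2) (ContinuousLinearMap.snd ℝ ℝ ℝ) p :=
      hasFDerivAt_snd
    have := a1.hasFDerivAt.comp p a2
    refine this.congr_fderiv ?_
    ext <;> simp [hE', he]
  have hΦd : ∀ p, HasFDerivAt Φ (Φ' p) p := fun p => by
    have a2 : HasFDerivAt (fun q : ℝ × ℝ => (q.1 : ℂ))
        (Complex.ofRealCLM.comp (ContinuousLinearMap.fst ℝ ℝ ℝ)) p :=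
      Complex.ofRealCLM.hasFDerivAt.comp p hasFDerivAt_fst
    have := (a2.mul (hed p)).const_add c
    refine (HasFDerivAt.congr_fderiv this ?_)
    ext <;> simp [hΦ', hE', he]
  -- In the pulled-back form, `Q` is the coefficient of `dθ` and `P` is minus that of `dr`, so the
  -- divergence of `(Q, P)` is the exterior derivative.
  set P : ℝ × ℝ → ℂ := fun p => -(σ (Φ p) (e p)) with hP
  set Q : ℝ × ℝ → ℂ := fun p => σ (Φ p) (p.1 • (e p * I)) with hQ
  have hΦc : Continuous Φ := continuous_iff_continuousAt.2 fun p => (hΦd p).continuousAt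
  have hec : Continuous e := continuous_iff_continuousAt.2 fun p => (hed p).continuousAt
  have hR0 : 0 ≤ R := h0.trans hεR
  have hσΦ : ContinuousOn (fun p => σ (Φ p)) (uIcc ε R ×ˢ uIcc (-Real.pi) Real.pi) := by
    refine hc.comp hΦc.continuousOn fun p hp => ?_
    rw [uIcc_of_le hεR] at hp
    have hp0 : 0 ≤ p.1 := h0.trans hp.1.1
    simpa [hΦ, circleMap, abs_of_nonneg hp0, and_comm] using hp.1
  have hσd : ∀ p ∈ S, HasFDerivAt (fun p => σ (Φ p)) ((fderiv ℝ σ (Φ p)).comp (Φ' p)) p := by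
    intro p hp
    have := (hd (Φ p) ((hmem p (h0.trans hp.1.1.le)).2 hp.1)).hasFDerivAt
    exact this.comp p (hΦd p)
  have hvd : ∀ p : ℝ × ℝ, HasFDerivAt (fun p : ℝ × ℝ => p.1 • (e p * I))
      ((ContinuousLinearMap.fst ℝ ℝ ℝ).smulRight (e p * I) +
        (ContinuousLinearMap.snd ℝ ℝ ℝ).smulRight (-(p.1 • e p))) p := fun p => by
    have := (hasFDerivAt_fst (𝕜 := ℝ) (p := p)).smul ((hed p).mul_const I)
    refine (HasFDerivAt.congr_fderiv this ?_)
    ext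
    · simp [hE']
    · simp [hE', mul_comm]
      ring_nf
      simp
  have hPd := fun p hp => ((hσd p hp).clm_apply (hed p)).neg
  have hQd := fun p hp => (hσd p hp).clm_apply (hvd p)
  -- The two terms `σ (Φ p) (e p * I)` come from the mixed second derivatives of the polar map and
  -- cancel. The frame `e`, `r e I` has determinant `r`.
  have key : ∀ p ∈ S, (((fderiv ℝ σ (Φ p)).comp (Φ' p)) (1, 0) (p.1 • (e p * I)) +
      σ (Φ p) (e p * I)) - (((fderiv ℝ σ (Φ p)).comp (Φ' p)) (0, 1) (e p) +
      σ (Φ p) (e p * I)) = p.1 • extd σ (Φ p) := by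
    intro p hp
    have := bilin_sub_swap (fderiv ℝ σ (Φ p)) (e p) (p.1 * (e p * I))
    simp only [hΦ', ContinuousLinearMap.comp_apply, add_apply,
      ContinuousLinearMap.smulRight_apply, ContinuousLinearMap.coe_fst',
      ContinuousLinearMap.coe_snd', one_smul, zero_smul, add_zero, zero_add, real_smul]
    rw [add_sub_add_right_eq_sub, this, extd]
    congr 1
    have : (e p).re * (e p).re + (e p).im * (e p).im = 1 := by
      have h := Complex.normSq_apply (e p)
      rw [← h, Complex.normSq_eq_norm_sq, he]
      simp [Complex.norm_exp]
    simp
    norm_cast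
    linear_combination p.1 * this
  have hf' : ∀ p ∈ S, (((fderiv ℝ σ (Φ p)).comp (Φ' p)).flip (p.1 • (e p * I)) +
      (σ (Φ p)).comp ((ContinuousLinearMap.fst ℝ ℝ ℝ).smulRight (e p * I) +
        (ContinuousLinearMap.snd ℝ ℝ ℝ).smulRight (-(p.1 • e p)))) (1, 0) +
      (-(((fderiv ℝ σ (Φ p)).comp (Φ' p)).flip (e p) + (σ (Φ p)).comp (E' p))) (0, 1) =
      p.1 • extd σ (Φ p) := by
    intro p hp
    rw [← key p hp]
    simp [hE']
    ring
  have hSae : (uIcc ε R ×ˢ uIcc (-Real.pi) Real.pi : Set (ℝ × ℝ)) =ᵐ[volume] S := by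
    rw [uIcc_of_le hεR, uIcc_of_le (by linarith [Real.pi_pos])]
    exact (Measure.set_prod_ae_eq Ioo_ae_eq_Icc Ioo_ae_eq_Icc).symm
  have hioc : (Ioc ε R ×ˢ Ioc (-Real.pi) Real.pi : Set (ℝ × ℝ)) =ᵐ[volume] S :=
    (Measure.set_prod_ae_eq Ioo_ae_eq_Ioc Ioo_ae_eq_Ioc).symm
  have hpi : -Real.pi ≤ Real.pi := by linarith [Real.pi_pos]
  have hSo : Ioo (min ε R) (max ε R) ×ˢ Ioo (min (-Real.pi) Real.pi) (max (-Real.pi) Real.pi) \ ∅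
      = S := by
    simp [hS, hεR, hpi]
  set F' : ℝ × ℝ → (ℝ × ℝ →L[ℝ] ℂ) := fun p => (((fderiv ℝ σ (Φ p)).comp (Φ' p)).flip (p.1 • (e p * I)) +
      (σ (Φ p)).comp ((ContinuousLinearMap.fst ℝ ℝ ℝ).smulRight (e p * I) +
        (ContinuousLinearMap.snd ℝ ℝ ℝ).smulRight (-(p.1 • e p)))) with hF'
  set G' : ℝ × ℝ → (ℝ × ℝ →L[ℝ] ℂ) := fun p =>
    (-(((fderiv ℝ σ (Φ p)).comp (Φ' p)).flip (e p) + (σ (Φ p)).comp (E' p))) with hG'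
  have hint0 : IntegrableOn (fun p => F' p (1, 0) + G' p (0, 1)) S :=
    h2'.congr_fun (fun p hp => (hf' p hp).symm) hSm
  have hint : IntegrableOn (fun p => F' p (1, 0) + G' p (0, 1))
      (uIcc ε R ×ˢ uIcc (-Real.pi) Real.pi) := by
    rwa [IntegrableOn, Measure.restrict_congr_set hSae]
  have main := integral2_divergence_prod_of_hasFDerivAt_off_countable Q P F' G' ε (-Real.pi) R
    Real.pi ∅ countable_empty
    (hσΦ.clm_apply (by fun_prop)) ((hσΦ.clm_apply (by fun_prop)).neg)
    (by rw [hSo]; intro p hp; exact (hQd p hp).congr_fderiv (by rw [hF']; simp only; rw [add_comm]))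
    (by rw [hSo]; intro p hp; exact (hPd p hp).congr_fderiv (by rw [hG']; simp only; rw [add_comm])) hint
  have hcirc : ∀ r : ℝ, ∫ y in (-Real.pi)..Real.pi, Q (r, y) = circ σ c r := by
    intro r
    have hper : Function.Periodic (fun y => Q (r, y)) (2 * Real.pi) := by
      intro y
      have a : e (r, y + 2 * Real.pi) = e (r, y) := by
        have := Complex.exp_periodic (y * I)
        simp only [he]
        rw [← this]
        congr 1
        push_cast
        ring
      have b : Φ (r, y + 2 * Real.pi) = Φ (r, y) := periodic_circleMap c r y
      simp only [hQ, a, b]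
    have := hper.intervalIntegral_add_eq (-Real.pi) 0
    rw [show -Real.pi + 2 * Real.pi = Real.pi by ring, zero_add] at this
    rw [this, circ]
    congr 1
    ext θ
    simp [hQ, hΦ, he, deriv_circleMap, circleMap, mul_assoc]
  -- The edges at angles `-π` and `π` have the same image, so their contributions cancel.
  have hPP : ∀ x : ℝ, P (x, Real.pi) = P (x, -Real.pi) := by
    intro x
    have a : e (x, Real.pi) = e (x, -Real.pi) := by
      have := Complex.exp_periodic (-Real.pi * I)
      simp only [he]
      rw [← ofReal_neg] at this
      rw [← this]
      congr 1
      push_cast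
      ring
    have b : Φ (x, Real.pi) = Φ (x, -Real.pi) := by
      have := periodic_circleMap c x (-Real.pi)
      rw [show -Real.pi + 2 * Real.pi = Real.pi by ring] at this
      exact this
    simp only [hP, a, b]
  rw [hcirc, hcirc] at main
  simp only [hPP, sub_self, zero_add] at main
  rw [h2, ← main]
  rw [intervalIntegral.integral_of_le hεR]
  simp only [intervalIntegral.integral_of_le hpi]
  rw [← setIntegral_prod (fun p => F' p (1, 0) + G' p (0, 1)), Measure.volume_eq_prod ℝ ℝ |>.symm,
    setIntegral_congr_set hioc]
  · exact setIntegral_congr_fun hSm fun p hp => (hf' p hp).symm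
  · rw [← Measure.volume_eq_prod, IntegrableOn, Measure.restrict_congr_set hioc]
    exact hint0

/-! ### Forms `a dz + b dz̄`, Wirtinger derivatives and pull-backs -/

/-- The `ℝ`-linear form `a dz + b dz̄`. -/
noncomputable def formL (a b : ℂ) : ℂ →L[ℝ] ℂ :=
  a • ContinuousLinearMap.id ℝ ℂ + b • (conjCLE : ℂ →L[ℝ] ℂ)

@[simp] theorem formL_apply (a b v : ℂ) : formL a b v = a * v + b * starRingEnd ℂ v := by
  simp [formL]

theorem continuousOn_formL {E : Type*} [TopologicalSpace E] {a b : E → ℂ} {s : Set E}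
    (ha : ContinuousOn a s) (hb : ContinuousOn b s) :
    ContinuousOn (fun z => formL (a z) (b z)) s := by
  unfold formL; fun_prop

theorem differentiableAt_formL {a b : ℂ → ℂ} {z : ℂ}
    (ha : DifferentiableAt ℝ a z) (hb : DifferentiableAt ℝ b z) :
    DifferentiableAt ℝ (fun z => formL (a z) (b z)) z := by
  unfold formL; fun_prop

theorem fderiv_apply_eq_wirtinger (f : ℂ → ℂ) (z v : ℂ) :
    fderiv ℝ f z v = wirtingerD f z * v + wirtingerDbar f z * starRingEnd ℂ v := by
  have h : fderiv ℝ f z v = v.re * fderiv ℝ f z 1 + v.im * fderiv ℝ f z I := by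
    conv_lhs => rw [show v = v.re • (1 : ℂ) + v.im • I by simp [Complex.re_add_im]]
    rw [map_add, map_smul, map_smul, Complex.real_smul, Complex.real_smul]
  rw [h, wirtingerD, wirtingerDbar]
  apply Complex.ext <;> simp <;> ring

/-- The factor `-2 * I` is the ratio of `dz ∧ dz̄` to `dx ∧ dy`: `extd` is the coefficient of the
latter, the Wirtinger expression that of the former. -/
theorem extd_formL {a b : ℂ → ℂ} {z : ℂ} (ha : DifferentiableAt ℝ a z)
    (hb : DifferentiableAt ℝ b z) :
    extd (fun z => formL (a z) (b z)) z =
      (wirtingerD b z - wirtingerDbar a z) * (-2 * I) := by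
  have h : HasFDerivAt (fun z => formL (a z) (b z))
      ((fderiv ℝ a z).smulRight (ContinuousLinearMap.id ℝ ℂ) +
        (fderiv ℝ b z).smulRight (conjCLE : ℂ →L[ℝ] ℂ)) z :=
    (ha.hasFDerivAt.smul_const (ContinuousLinearMap.id ℝ ℂ)).add
      (hb.hasFDerivAt.smul_const (conjCLE : ℂ →L[ℝ] ℂ))
  rw [extd, h.fderiv, wirtingerD, wirtingerDbar]
  simp
  ring_nf
  simp
  ring

theorem extd_congr {σ τ : ℂ → ℂ →L[ℝ] ℂ} {z : ℂ} (h : σ =ᶠ[𝓝 z] τ) : extd σ z = extd τ z := by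
  rw [extd, extd, h.fderiv_eq]

theorem extd_sub {σ τ : ℂ → ℂ →L[ℝ] ℂ} {z : ℂ} (h : DifferentiableAt ℝ σ z)
    (h' : DifferentiableAt ℝ τ z) : extd (fun w => σ w - τ w) z = extd σ z - extd τ z := by
  rw [extd, extd, extd, fderiv_fun_sub h h']
  simp
  ring

theorem extd_sum {ι : Type*} (t : Finset ι) {σ : ι → ℂ → ℂ →L[ℝ] ℂ} {z : ℂ}
    (h : ∀ i ∈ t, DifferentiableAt ℝ (σ i) z) :
    extd (fun w => ∑ i ∈ t, σ i w) z = ∑ i ∈ t, extd (σ i) z := by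
  simp only [extd]
  rw [fderiv_fun_sum h]
  simp

/-- Pullback of a `1`-form along a map which is `C²` within a set: the pullback is differentiable,
and its exterior derivative is the pullback of the exterior derivative. -/
theorem exists_hasFDerivWithinAt_pullback {s : Set ℂ} (hs : UniqueDiffOn ℝ s) {z : ℂ} (hz : z ∈ s)
    (hzi : z ∈ closure (interior s)) {F : ℂ → ℂ} (hF : ContDiffWithinAt ℝ 2 F s z)
    {σ : ℂ → ℂ →L[ℝ] ℂ} (hσ : DifferentiableAt ℝ σ (F z)) :
    ∃ B : ℂ →L[ℝ] ℂ →L[ℝ] ℂ,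
      HasFDerivWithinAt (fun w => (σ (F w)).comp (fderivWithin ℝ F s w)) B s z ∧
      ∀ v w, B v w - B w v = ((v.re * w.im - v.im * w.re : ℝ) : ℂ) *
        (((fderivWithin ℝ F s z).det : ℝ) * extd σ (F z)) := by
  -- The second derivative of `F` is symmetric even at a boundary point, as a limit of interior
  -- points. Its term therefore drops out of the antisymmetrization.
  have hsym : IsSymmSndFDerivWithinAt ℝ F s z :=
    hF.isSymmSndFDerivWithinAt (by simp) hs hzi hz
  have h1 : DifferentiableWithinAt ℝ F s z := hF.differentiableWithinAt (by norm_num)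
  have h2 : DifferentiableWithinAt ℝ (fderivWithin ℝ F s) s z :=
    (hF.fderivWithin_right hs (m := 1) (by norm_num) hz).differentiableWithinAt (by norm_num)
  have h3 : HasFDerivWithinAt (fun w => σ (F w))
      ((fderiv ℝ σ (F z)).comp (fderivWithin ℝ F s z)) s z :=
    hσ.hasFDerivAt.comp_hasFDerivWithinAt z h1.hasFDerivWithinAt
  refine ⟨_, h3.clm_comp h2.hasFDerivWithinAt, fun v w => ?_⟩
  rw [bilin_sub_swap]
  congr 1
  have := bilin_sub_swap (fderiv ℝ σ (F z)) (fderivWithin ℝ F s z 1) (fderivWithin ℝ F s z I)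
  rw [extd, det_eq_re_im, ← this]
  have h4 : fderivWithin ℝ (fderivWithin ℝ F s) s z 1 I =
    fderivWithin ℝ (fderivWithin ℝ F s) s z I 1 := hsym 1 I
  simp [h4]

theorem extd_pullback {s : Set ℂ} (hs : IsOpen s) {z : ℂ} (hz : z ∈ s) {F : ℂ → ℂ}
    (hF : ContDiffOn ℝ 2 F s) {σ τ : ℂ → ℂ →L[ℝ] ℂ} (hσ : DifferentiableAt ℝ σ (F z))
    (hτ : τ =ᶠ[𝓝 z] fun w => (σ (F w)).comp (fderiv ℝ F w)) :
    DifferentiableAt ℝ τ z ∧ extd τ z = ((fderiv ℝ F z).det : ℝ) * extd σ (F z) := by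
  obtain ⟨B, h1, h2⟩ := exists_hasFDerivWithinAt_pullback hs.uniqueDiffOn hz
    (subset_closure (by rwa [hs.interior_eq])) (hF z hz) hσ
  have h3 := h1.hasFDerivAt (hs.mem_nhds hz)
  have h4 : τ =ᶠ[𝓝 z] fun w => (σ (F w)).comp (fderivWithin ℝ F s w) := by
    filter_upwards [hτ, hs.mem_nhds hz] with w hw hws
    rw [hw, fderivWithin_of_isOpen hs hws]
  have h5 := h3.congr_of_eventuallyEq h4
  refine ⟨h5.differentiableAt, ?_⟩
  rw [extd, h5.fderiv, h2, fderivWithin_of_isOpen hs hz]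
  simp

theorem contDiffAt_wirtingerD {f : ℂ → ℂ} {z : ℂ} (hf : ContDiffAt ℝ ∞ f z) :
    ContDiffAt ℝ ∞ (wirtingerD f) z := by
  have : ContDiffAt ℝ ∞ (fderiv ℝ f) z := hf.fderiv_right (by simp)
  unfold wirtingerD
  exact (((this.clm_apply contDiffAt_const)).sub
    (contDiffAt_const.mul (this.clm_apply contDiffAt_const))).div_const _

theorem contDiffAt_wirtingerDbar {f : ℂ → ℂ} {z : ℂ} (hf : ContDiffAt ℝ ∞ f z) :
    ContDiffAt ℝ ∞ (wirtingerDbar f) z := by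
  have : ContDiffAt ℝ ∞ (fderiv ℝ f) z := hf.fderiv_right (by simp)
  unfold wirtingerDbar
  exact (((this.clm_apply contDiffAt_const)).add
    (contDiffAt_const.mul (this.clm_apply contDiffAt_const))).div_const _

theorem wirtingerD_congr {f g : ℂ → ℂ} {z : ℂ} (h : f =ᶠ[𝓝 z] g) :
    wirtingerD f z = wirtingerD g z := by
  rw [wirtingerD, wirtingerD, h.fderiv_eq]

theorem fderiv_real_of_holomorphic {h : ℂ → ℂ} {z : ℂ} (hh : DifferentiableAt ℂ h z) (v : ℂ) :
    fderiv ℝ h z v = deriv h z * v := by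
  rw [hh.fderiv_restrictScalars ℝ]
  simp [mul_comm]

theorem wirtingerD_mul_holomorphic {f h : ℂ → ℂ} {z : ℂ} (hf : DifferentiableAt ℝ f z)
    (hh : DifferentiableAt ℂ h z) :
    wirtingerD (fun w => f w * h w) z = wirtingerD f z * h z + f z * deriv h z := by
  rw [wirtingerD, wirtingerD, fderiv_fun_mul hf (hh.restrictScalars ℝ)]
  simp [fderiv_real_of_holomorphic hh]
  ring_nf
  simp
  ring

theorem wirtingerDbar_mul_holomorphic {f h : ℂ → ℂ} {z : ℂ} (hf : DifferentiableAt ℝ f z)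
    (hh : DifferentiableAt ℂ h z) :
    wirtingerDbar (fun w => f w * h w) z = wirtingerDbar f z * h z := by
  rw [wirtingerDbar, wirtingerDbar, fderiv_fun_mul hf (hh.restrictScalars ℝ)]
  simp [fderiv_real_of_holomorphic hh]
  ring_nf
  simp

/-! ### Circle integrals around a pole -/

theorem hasDerivAt_inv_pow_sub {c z : ℂ} (hz : z ≠ c) (n : ℕ) :
    HasDerivAt (fun w => ((w - c) ^ n)⁻¹) (-n / (z - c) ^ (n + 1)) z := by
  have h : z - c ≠ 0 := sub_ne_zero.2 hz
  have := (((hasDerivAt_id z).sub_const c).pow n).inv (pow_ne_zero n h)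
  refine this.congr_deriv ?_
  rcases n with _ | n
  · simp
  · simp
    field_simp
    ring

/-- Integration by parts along a circle. -/
theorem circleIntegral_by_parts {F : ℂ → ℂ} {c : ℂ} {r ε : ℝ} (hF : ContDiffOn ℝ 1 F (ball c r))
    (hε : 0 < ε) (hr : ε < r) (m : ℕ) :
    m * (∮ z in C(c, ε), F z / (z - c) ^ (m + 1)) =
      (∮ z in C(c, ε), wirtingerD F z / (z - c) ^ m) -
      ε ^ 2 * ∮ z in C(c, ε), wirtingerDbar F z / (z - c) ^ (m + 2) := by
  have hsub : sphere c ε ⊆ ball c r := fun z hz => by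
    rw [mem_sphere] at hz; rw [mem_ball, hz]; exact hr
  have hfd : ContinuousOn (fderiv ℝ F) (ball c r) :=
    hF.continuousOn_fderiv_of_isOpen isOpen_ball (by norm_num)
  have hne : ∀ z ∈ sphere c ε, z - c ≠ 0 := fun z hz h => by
    rw [mem_sphere, dist_eq, h] at hz; simp at hz; exact hε.ne hz
  have hpow : ∀ k : ℕ, ContinuousOn (fun z : ℂ => (z - c) ^ k) (sphere c ε) := fun k => by fun_prop
  have c1 : ContinuousOn (fun z => F z / (z - c) ^ (m + 1)) (sphere c ε) :=
    (hF.continuousOn.mono hsub).div (hpow _) fun z hz => pow_ne_zero _ (hne z hz)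
  have c2 : ContinuousOn (fun z => wirtingerD F z / (z - c) ^ m) (sphere c ε) := by
    refine ContinuousOn.div ?_ (hpow _) fun z hz => pow_ne_zero _ (hne z hz)
    have := hfd.mono hsub
    unfold wirtingerD; fun_prop
  have c3 : ContinuousOn (fun z => wirtingerDbar F z / (z - c) ^ (m + 2)) (sphere c ε) := by
    refine ContinuousOn.div ?_ (hpow _) fun z hz => pow_ne_zero _ (hne z hz)
    have := hfd.mono hsub
    unfold wirtingerDbar; fun_prop
  have i1 := c1.circleIntegrable hε.le
  have i2 := c2.circleIntegrable hε.le
  have i3 := c3.circleIntegrable hε.le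
  -- The integrand is the derivative in `θ` of `F / (z - c)^m` along the circle, a periodic
  -- function.
  have key : (∮ z in C(c, ε), (wirtingerD F z / (z - c) ^ m -
      (ε : ℂ) ^ 2 • (wirtingerDbar F z / (z - c) ^ (m + 2)) - (m : ℂ) • (F z / (z - c) ^ (m + 1)))) = 0 := by
    have hcont : ContinuousOn (fun z => wirtingerD F z / (z - c) ^ m -
      (ε : ℂ) ^ 2 • (wirtingerDbar F z / (z - c) ^ (m + 2)) - (m : ℂ) • (F z / (z - c) ^ (m + 1)))
        (sphere c ε) := by fun_prop
    rw [circleIntegral, intervalIntegral.integral_eq_sub_of_hasDerivAt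
      (f := fun θ => F (circleMap c ε θ) * ((circleMap c ε θ - c) ^ m)⁻¹) _
      (hcont.circleIntegrable hε.le).out]
    · simp [circleMap]
    · intro θ _
      have hz : circleMap c ε θ ∈ sphere c ε := circleMap_mem_sphere c hε.le θ
      have d1 : HasFDerivAt F (fderiv ℝ F (circleMap c ε θ)) (circleMap c ε θ) :=
        ((hF.differentiableOn (by norm_num)).differentiableAt
          (isOpen_ball.mem_nhds (hsub hz))).hasFDerivAt
      have d2 := d1.comp_hasDerivAt θ (hasDerivAt_circleMap c ε θ)
      have d3 := (hasDerivAt_inv_pow_sub (sub_ne_zero.1 (hne _ hz)) m).comp_of_eq θ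
        (hasDerivAt_circleMap c ε θ) rfl
      refine (d2.mul d3).congr_deriv ?_
      have hn := hne _ hz
      -- On the circle the conjugate of `z - c` is `ε² / (z - c)`, so `dz̄ = -ε² dz / (z - c)²`.
      have hconj : starRingEnd ℂ (circleMap 0 ε θ * I) =
          -((ε : ℂ) ^ 2 / (circleMap c ε θ - c) ^ 2) * (circleMap 0 ε θ * I) := by
        have e0 : circleMap c ε θ - c = circleMap 0 ε θ := by simp [circleMap]
        have e1 : starRingEnd ℂ (circleMap 0 ε θ) * circleMap 0 ε θ = (ε : ℂ) ^ 2 := by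
          rw [mul_comm, Complex.mul_conj, Complex.normSq_eq_norm_sq]
          simp [circleMap]
        rw [e0] at hn ⊢
        rw [← e1]
        field_simp
        simp [mul_comm]
      rw [fderiv_apply_eq_wirtinger, hconj, deriv_circleMap]
      simp only [smul_eq_mul, Function.comp]
      field_simp
      ring
  have i3' : CircleIntegrable
      (fun z => (ε : ℂ) ^ 2 • (wirtingerDbar F z / (z - c) ^ (m + 2))) c ε := i3.const_smul
  have i1' : CircleIntegrable (fun z => (m : ℂ) • (F z / (z - c) ^ (m + 1))) c ε := i1.const_smul
  have i2' : CircleIntegrable (fun z => wirtingerD F z / (z - c) ^ m -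
      (ε : ℂ) ^ 2 • (wirtingerDbar F z / (z - c) ^ (m + 2))) c ε := i2.sub i3'
  rw [circleIntegral.integral_sub i2' i1', circleIntegral.integral_sub i2 i3',
    circleIntegral.integral_smul, circleIntegral.integral_smul] at key
  simp only [smul_eq_mul] at key
  linear_combination -key

/-- For `j = 0` the length of the circle times the maximum of the integrand suffices. Integration by
parts lowers `j` by one; its `∂̄` term raises the order of the pole but carries a factor `ε²`, so it
is the case `k + 2`. This is why the statement has a weight `ε ^ k`, although only `k = 0` is wanted
in the end. -/
theorem circleIntegral_div_pow_bounded (c : ℂ) (j : ℕ) : ∀ F : ℂ → ℂ, ContDiffAt ℝ ∞ F c →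
    ∀ k : ℕ, ∃ C : ℝ, ∀ᶠ ε : ℝ in 𝓝[>] 0,
      ε ^ k * ‖∮ z in C(c, ε), F z / (z - c) ^ (j + 1 + k)‖ ≤ C := by
  induction j with
  | zero =>
    intro F hF k
    have hc := hF.continuousAt.norm
    have hev : ∀ᶠ z in 𝓝 c, ‖F z‖ ≤ ‖F c‖ + 1 :=
      (hc.eventually_lt_const (lt_add_one _)).mono fun _ h => h.le
    obtain ⟨r, hr, hb⟩ := Metric.eventually_nhds_iff.1 hev
    refine ⟨2 * Real.pi * (‖F c‖ + 1), ?_⟩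
    filter_upwards [Ioo_mem_nhdsGT hr] with ε hε
    have h1 : ‖∮ z in C(c, ε), F z / (z - c) ^ (0 + 1 + k)‖ ≤
        2 * Real.pi * ε * ((‖F c‖ + 1) / ε ^ (0 + 1 + k)) := by
      refine circleIntegral.norm_integral_le_of_norm_le_const hε.1.le fun z hz => ?_
      have hz' : ‖z - c‖ = ε := by rwa [mem_sphere, dist_eq] at hz
      rw [norm_div, norm_pow, hz']
      have := hε.1
      gcongr
      exact hb (by rw [dist_eq, hz']; exact hε.2)
    have h0 := hε.1
    calc ε ^ k * _ ≤ ε ^ k * (2 * Real.pi * ε * ((‖F c‖ + 1) / ε ^ (0 + 1 + k))) := by gcongr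
      _ = 2 * Real.pi * (‖F c‖ + 1) := by field_simp; ring
  | succ j ih =>
    intro F hF k
    obtain ⟨C₁, h₁⟩ := ih _ (contDiffAt_wirtingerD hF) k
    obtain ⟨C₂, h₂⟩ := ih _ (contDiffAt_wirtingerDbar hF) (k + 2)
    obtain ⟨r, hr, hFr⟩ : ∃ r > 0, ContDiffOn ℝ 1 F (ball c r) := by
      obtain ⟨u, hu, hFu⟩ := (hF.of_le (m := 1) (by norm_cast)).contDiffOn le_rfl (by simp)
      obtain ⟨r, hr, hb⟩ := Metric.mem_nhds_iff.1 hu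
      exact ⟨r, hr, hFu.mono hb⟩
    refine ⟨C₁ + C₂, ?_⟩
    filter_upwards [Ioo_mem_nhdsGT hr, h₁, h₂] with ε hε h₁ h₂
    have h0 := hε.1
    have hp := circleIntegral_by_parts hFr h0 hε.2 (j + 1 + k)
    have hn := congr_arg norm hp
    rw [norm_mul, Complex.norm_natCast] at hn
    have e1 : j + 1 + 1 + k = j + 1 + k + 1 := by ring
    have e2 : j + 1 + (k + 2) = j + 1 + k + 2 := by ring
    rw [e1]
    rw [e2] at h₂
    set J := ‖∮ z in C(c, ε), F z / (z - c) ^ (j + 1 + k + 1)‖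
    have h3 : J ≤ ((j + 1 + k : ℕ) : ℝ) * J := by
      have : (1 : ℝ) ≤ ((j + 1 + k : ℕ) : ℝ) := by norm_cast; omega
      nlinarith [norm_nonneg (∮ z in C(c, ε), F z / (z - c) ^ (j + 1 + k + 1))]
    have h4 := norm_sub_le (∮ z in C(c, ε), wirtingerD F z / (z - c) ^ (j + 1 + k))
      ((ε : ℂ) ^ 2 * ∮ z in C(c, ε), wirtingerDbar F z / (z - c) ^ (j + 1 + k + 2))
    rw [norm_mul, norm_pow, Complex.norm_real, Real.norm_of_nonneg h0.le] at h4
    calc ε ^ k * J ≤ ε ^ k * (‖∮ z in C(c, ε), wirtingerD F z / (z - c) ^ (j + 1 + k)‖ +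
          ε ^ 2 * ‖∮ z in C(c, ε), wirtingerDbar F z / (z - c) ^ (j + 1 + k + 2)‖) := by
          gcongr; linarith
      _ ≤ C₁ + C₂ := by rw [mul_add, ← mul_assoc, ← pow_add]; linarith

/-- After `dz̄` is rewritten as `-ε² dz / (z - c)²`, a bounded circle integral remains with the
factor `ε²` in front. Hence `β` does not contribute to residues, whatever the order of its pole. -/
theorem tendsto_circ_dbar {F : ℂ → ℂ} {c : ℂ} (hF : ContDiffAt ℝ ∞ F c) (n : ℕ) :
    Tendsto (fun ε => circ (fun z => formL 0 (F z / (z - c) ^ n)) c ε) (𝓝[>] 0) (𝓝 0) := by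
  obtain ⟨C, hC⟩ := circleIntegral_div_pow_bounded c (n + 1) F hF 0
  have h1 : ∀ ε : ℝ, 0 < ε → circ (fun z => formL 0 (F z / (z - c) ^ n)) c ε =
      -(ε : ℂ) ^ 2 * ∮ z in C(c, ε), F z / (z - c) ^ (n + 1 + 1 + 0) := by
    intro ε hε
    rw [circ, circleIntegral, ← intervalIntegral.integral_const_mul]
    congr 1
    ext θ
    have hn : circleMap c ε θ - c ≠ 0 := by simp [circleMap, hε.ne']
    have hconj : starRingEnd ℂ (circleMap 0 ε θ * I) =
        -((ε : ℂ) ^ 2 / (circleMap c ε θ - c) ^ 2) * (circleMap 0 ε θ * I) := by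
      have e0 : circleMap c ε θ - c = circleMap 0 ε θ := by simp [circleMap]
      have e1 : starRingEnd ℂ (circleMap 0 ε θ) * circleMap 0 ε θ = (ε : ℂ) ^ 2 := by
        rw [mul_comm, Complex.mul_conj, Complex.normSq_eq_norm_sq]
        simp [circleMap]
      rw [e0] at hn ⊢
      rw [← e1]
      field_simp
      simp [mul_comm]
    rw [formL_apply, deriv_circleMap, hconj, smul_eq_mul]
    field_simp
    ring
  have h2 : Tendsto (fun ε : ℝ => ε ^ 2 * C) (𝓝[>] 0) (𝓝 0) := by
    have : Tendsto (fun ε : ℝ => ε ^ 2 * C) (𝓝 0) (𝓝 (0 ^ 2 * C)) := by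
      exact Continuous.tendsto (by fun_prop) _
    simpa using this.mono_left nhdsWithin_le_nhds
  refine squeeze_zero_norm' ?_ h2
  filter_upwards [hC, self_mem_nhdsWithin] with ε hε h0
  rw [h1 ε h0, norm_mul, norm_neg, norm_pow, Complex.norm_real, Real.norm_of_nonneg (le_of_lt h0)]
  rw [pow_zero, one_mul] at hε
  gcongr

/-! ### Lowering the order of a pole; integrability of simple poles -/

/-- Reduction of the order of a pole by adding a `∂`-exact form. -/
theorem exists_pole_reduction (s : Set ℂ) (c : ℂ) (n : ℕ) : ∀ f : ℂ → ℂ,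
    (∀ z ∈ s, ContDiffAt ℝ ∞ f z) →
    ∃ F G : ℂ → ℂ, (∀ z ∈ s, ContDiffAt ℝ ∞ F z) ∧ (∀ z ∈ s, ContDiffAt ℝ ∞ G z) ∧
      ∀ z ∈ s, z ≠ c → f z / (z - c) ^ n =
        wirtingerD (fun w => F w / (w - c) ^ n) z + G z / (z - c) := by
  have hw0 : ∀ z, wirtingerD (fun _ => (0 : ℂ)) z = 0 := fun z => by simp [wirtingerD]
  have hlin : ∀ z, ContDiffAt ℝ ∞ (fun z : ℂ => z - c) z := fun z => by fun_prop
  induction n with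
  | zero =>
    intro f hf
    refine ⟨fun _ => 0, fun z => (z - c) * f z, fun z _ => contDiffAt_const,
      fun z hz => (hlin z).mul (hf z hz), fun z _ hz => ?_⟩
    have : z - c ≠ 0 := sub_ne_zero.2 hz
    simp only [zero_div, hw0]
    field_simp
    simp
  | succ n ih =>
    intro f hf
    rcases Nat.eq_zero_or_pos n with rfl | hn
    -- A simple pole is left alone; the recursion divides by `n`.
    · refine ⟨fun _ => 0, f, fun z _ => contDiffAt_const, hf, fun z _ _ => ?_⟩
      simp [hw0]
    have hn0 : (n : ℂ) ≠ 0 := by exact_mod_cast hn.ne'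
    -- Since `∂(-f / (n (z - c)^n)) = f / (z - c)^(n+1) - (∂f / n) / (z - c)^n`, it remains to treat
    -- `∂f / n` over the `n`-th power.
    obtain ⟨F, G, hF, hG, h⟩ := ih (fun z => wirtingerD f z / n)
      (fun z hz => (contDiffAt_wirtingerD (hf z hz)).div_const _)
    -- The factor `z - c` rewrites a quotient by the `n`-th power as one by the power `n + 1`.
    refine ⟨fun z => (F z - f z / n) * (z - c), G,
      fun z hz => ((hF z hz).sub ((hf z hz).div_const _)).mul (hlin z), hG, fun z hzs hz => ?_⟩
    have hFz := (hF z hzs).differentiableAt (by simp)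
    have hfz := (hf z hzs).differentiableAt (by simp)
    have h := h z hzs hz
    have hz0 : z - c ≠ 0 := sub_ne_zero.2 hz
    have hder := hasDerivAt_inv_pow_sub hz n
    have e1 : (fun w => (F w - f w / n) * (w - c) / (w - c) ^ (n + 1)) =ᶠ[𝓝 z]
        fun w => (F w - f w / n) * ((w - c) ^ n)⁻¹ := by
      filter_upwards [isOpen_ne.mem_nhds hz] with w hw
      have hw0 : w - c ≠ 0 := sub_ne_zero.2 hw
      field_simp
      ring
    have e2 : wirtingerD (fun w => F w / (w - c) ^ n) z =
        wirtingerD F z * ((z - c) ^ n)⁻¹ + F z * (-n / (z - c) ^ (n + 1)) := by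
      simp only [div_eq_mul_inv] at *
      rw [wirtingerD_mul_holomorphic hFz hder.differentiableAt, hder.deriv]
    have e3 : wirtingerD (fun w => F w - f w / n) z = wirtingerD F z - wirtingerD f z / n := by
      simp only [div_eq_mul_inv]
      simp only [wirtingerD]
      rw [fderiv_fun_sub hFz (hfz.mul_const _), fderiv_mul_const hfz]
      simp
      ring
    have hd : DifferentiableAt ℝ (fun w => F w - f w / n) z := by
      simp only [div_eq_mul_inv]
      exact hFz.sub (hfz.mul_const _)
    rw [wirtingerD_congr e1, wirtingerD_mul_holomorphic hd hder.differentiableAt, hder.deriv, e3]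
    rw [e2] at h
    have h' : G z / (z - c) = wirtingerD f z / n / (z - c) ^ n -
      (wirtingerD F z * ((z - c) ^ n)⁻¹ + F z * (-n / (z - c) ^ (n + 1))) := by
      rw [h]; ring
    rw [h']
    field_simp
    ring

theorem locallyIntegrable_inv_sub (c : ℂ) : LocallyIntegrable (fun z : ℂ => (z - c)⁻¹) := by
  have h0 : LocallyIntegrable (fun z : ℂ => z⁻¹) := by
    refine locallyIntegrable_of_norm_le_rpow (C := 1) (α := 1) (by simp) (by simp) ?_
      (by fun_prop)
    filter_upwards with z
    rw [norm_inv, Real.rpow_neg_one, one_mul]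
  rw [locallyIntegrable_iff] at h0 ⊢
  intro K hK
  have h1 := h0 _ (hK.image (f := fun z => id z - c) (by fun_prop))
  have h2 := (measurePreserving_sub_right volume c).integrableOn_comp_preimage
    (measurableEmbedding_subRight c) (f := fun z : ℂ => z⁻¹)
    (s := (fun z => id z - c) '' K) |>.2 h1
  exact h2.mono_set (subset_preimage_image _ _)

theorem integrableAtFilter_div_sub {f : ℂ → ℂ} {c : ℂ} (hf : ContDiffAt ℝ ∞ f c) :
    IntegrableAtFilter (fun z => f z / (z - c)) (𝓝 c) := by
  have h1 : ∀ᶠ z in 𝓝 c, ContinuousAt f z :=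
    ((hf.of_le (m := 1) (by norm_cast)).eventually (by simp)).mono fun z hz => hz.continuousAt
  obtain ⟨r, hr, hb⟩ := Metric.nhds_basis_closedBall.mem_iff.1 h1
  refine ⟨closedBall c r, closedBall_mem_nhds c hr, ?_⟩
  have h2 := (locallyIntegrable_inv_sub c).integrableOn_isCompact (isCompact_closedBall c r)
  exact h2.continuousOn_mul (fun z hz => (hb hz).continuousWithinAt) (isCompact_closedBall c r)

/-! ### Coordinate changes and forms in coordinates -/

variable {X : Type*} [TopologicalSpace X] [ChartedSpace ℂ X]

theorem contDiffAt_transition [IsManifold 𝓘(ℂ, ℂ) ω X] {e e' : OpenPartialHomeomorph X ℂ}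
    (he : e ∈ atlas ℂ X) (he' : e' ∈ atlas ℂ X) {y : ℂ} (hy : y ∈ e.target)
    (hy' : e.symm y ∈ e'.source) : ContDiffAt ℂ ω (e' ∘ e.symm) y := by
  have h := (contDiffGroupoid ω 𝓘(ℂ, ℂ)).compatible he he'
  rw [contDiffGroupoid, mem_groupoid_of_pregroupoid] at h
  have h1 : ContDiffOn ℂ ω (e' ∘ e.symm) (e.symm.trans e').source := by
    simpa [contDiffPregroupoid] using h.1
  exact h1.contDiffAt ((e.symm.trans e').open_source.mem_nhds (by simp [hy, hy']))

theorem contDiffAt_transition_real [IsManifold 𝓘(ℂ, ℂ) ω X] {e e' : OpenPartialHomeomorph X ℂ}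
    (he : e ∈ atlas ℂ X) (he' : e' ∈ atlas ℂ X) {y : ℂ} (hy : y ∈ e.target)
    (hy' : e.symm y ∈ e'.source) : ContDiffAt ℝ ∞ (e' ∘ e.symm) y :=
  ((contDiffAt_transition he he' hy hy').restrict_scalars ℝ).of_le le_top

theorem differentiableAt_transition [IsManifold 𝓘(ℂ, ℂ) ω X] {e e' : OpenPartialHomeomorph X ℂ}
    (he : e ∈ atlas ℂ X) (he' : e' ∈ atlas ℂ X) {y : ℂ} (hy : y ∈ e.target)
    (hy' : e.symm y ∈ e'.source) : DifferentiableAt ℂ (e' ∘ e.symm) y :=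
  (contDiffAt_transition he he' hy hy').differentiableAt (by simp)

/-- The part of the domain of a coordinate lying over an open set. -/
theorem isOpen_target_inter {X : Type*} [TopologicalSpace X] (e : OpenPartialHomeomorph X ℂ) {U : Set X} (hU : IsOpen U) :
    IsOpen (e.target ∩ e.symm ⁻¹' U) :=
  e.isOpen_inter_preimage_symm hU

/-- The expression of a `1`-form in a coordinate, as a form on the plane. -/
noncomputable def OneForm.form {D : Set X} (η : OneForm X D) (e : OpenPartialHomeomorph X ℂ)
    (y : ℂ) : ℂ →L[ℝ] ℂ :=
  formL (η.dz e y) (η.dzbar e y)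

theorem OneForm.form_compat [IsManifold 𝓘(ℂ, ℂ) ω X] {D : Set X} (η : OneForm X D)
    {e e' : OpenPartialHomeomorph X ℂ} (he : e ∈ atlas ℂ X) (he' : e' ∈ atlas ℂ X) {x : X}
    (hx : x ∈ e.source) (hx' : x ∈ e'.source) (hxD : x ∉ D) :
    η.form e (e x) = (η.form e' (e' x)).comp (fderiv ℝ (e' ∘ e.symm) (e x)) := by
  ext1 v
  have hd := differentiableAt_transition he he' (e.map_source hx) (by rwa [e.left_inv hx])
  rw [ContinuousLinearMap.comp_apply, fderiv_real_of_holomorphic hd, form, form, formL_apply,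
    formL_apply, η.compat_dz e he e' he' x ⟨hx, hx'⟩ hxD,
    η.compat_dzbar e he e' he' x ⟨hx, hx'⟩ hxD, map_mul]
  ring

theorem OneForm.contDiffAt_dz {D : Set X} (hD : _root_.IsClosed D) (η : OneForm X D)
    {e : OpenPartialHomeomorph X ℂ} (he : e ∈ atlas ℂ X) {y : ℂ} (hy : y ∈ e.target)
    (hyD : e.symm y ∉ D) : ContDiffAt ℝ ∞ (η.dz e) y :=
  (η.smooth_dz e he).contDiffAt ((isOpen_target_inter e hD.isOpen_compl).mem_nhds ⟨hy, hyD⟩)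

theorem OneForm.contDiffAt_dzbar {D : Set X} (hD : _root_.IsClosed D) (η : OneForm X D)
    {e : OpenPartialHomeomorph X ℂ} (he : e ∈ atlas ℂ X) {y : ℂ} (hy : y ∈ e.target)
    (hyD : e.symm y ∉ D) : ContDiffAt ℝ ∞ (η.dzbar e) y :=
  (η.smooth_dzbar e he).contDiffAt ((isOpen_target_inter e hD.isOpen_compl).mem_nhds ⟨hy, hyD⟩)

theorem OneForm.differentiableAt_form {D : Set X} (hD : _root_.IsClosed D) (η : OneForm X D)
    {e : OpenPartialHomeomorph X ℂ} (he : e ∈ atlas ℂ X) {y : ℂ} (hy : y ∈ e.target)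
    (hyD : e.symm y ∉ D) : DifferentiableAt ℝ (η.form e) y :=
  differentiableAt_formL ((η.contDiffAt_dz hD he hy hyD).differentiableAt (by simp))
    ((η.contDiffAt_dzbar hD he hy hyD).differentiableAt (by simp))

theorem OneForm.extd_form_of_isClosed (α : OneForm X (∅ : Set X)) (hα : α.IsClosed)
    {e : OpenPartialHomeomorph X ℂ} (he : e ∈ atlas ℂ X) {y : ℂ} (hy : y ∈ e.target) :
    extd (α.form e) y = 0 := by
  have h1 := α.contDiffAt_dz isClosed_empty he hy (by simp)
  have h2 := α.contDiffAt_dzbar isClosed_empty he hy (by simp)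
  have := extd_formL (h1.differentiableAt (by simp)) (h2.differentiableAt (by simp))
  rw [hα e he y hy, zero_mul] at this
  exact this

/-! ### Cutoff functions -/

/-- A smooth function supported in a compact subset of `U` and equal to `1` near `p`. -/
structure IsCutoff (χ : X → ℝ) (p : X) (U : Set X) : Prop where
  smooth : ∀ e ∈ atlas ℂ X, ContDiffOn ℝ ∞ (χ ∘ e.symm) e.target
  exists_compact : ∃ C : Set X, IsCompact C ∧ C ⊆ U ∧ ∀ x ∉ C, χ x = 0
  eventually_eq : ∀ᶠ x in 𝓝 p, χ x = 1

theorem IsCutoff.mono {χ : X → ℝ} {p : X} {U V : Set X} (h : IsCutoff χ p U) (hUV : U ⊆ V) :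
    IsCutoff χ p V := by
  obtain ⟨C, hC, hCU, h0⟩ := h.exists_compact
  exact ⟨h.smooth, ⟨C, hC, hCU.trans hUV, h0⟩, h.eventually_eq⟩

/-- A bump function in one coordinate is extended by zero. The extension is smooth because the
support is compact, hence closed in the Hausdorff space `X`, and lies inside the coordinate domain.
-/
theorem exists_isCutoff [T2Space X] [IsManifold 𝓘(ℂ, ℂ) ω X] {U : Set X} (hU : IsOpen U) {p : X}
    (hp : p ∈ U) : ∃ χ : X → ℝ, IsCutoff χ p U := by
  classical
  set e₀ := chartAt ℂ p with he₀
  have hps : p ∈ e₀.source := mem_chart_source ℂ p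
  obtain ⟨r, hr, hrV⟩ := Metric.nhds_basis_closedBall.mem_iff.1
    ((isOpen_target_inter e₀ hU).mem_nhds
      (show e₀ p ∈ _ from ⟨e₀.map_source hps, by simpa [e₀.left_inv hps] using hp⟩))
  let f : ContDiffBump (e₀ p) := ⟨r / 2, r, by positivity, by linarith⟩
  set C := e₀.symm '' closedBall (e₀ p) r with hC
  have hCc : IsCompact C := (isCompact_closedBall _ _).image_of_continuousOn
    (e₀.continuousOn_symm.mono fun y hy => (hrV hy).1)
  set χ : X → ℝ := fun x => if x ∈ e₀.source then f (e₀ x) else 0 with hχ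
  have h0 : ∀ x ∉ C, χ x = 0 := by
    intro x hx
    by_cases hxs : x ∈ e₀.source
    · simp only [hχ, hxs, if_true]
      refine f.zero_of_le_dist ?_
      by_contra! hlt
      exact hx ⟨e₀ x, hlt.le, e₀.left_inv hxs⟩
    · simp [hχ, hxs]
  refine ⟨χ, fun e he y hy => ?_, ⟨C, hCc, ?_, h0⟩, ?_⟩
  · apply ContDiffAt.contDiffWithinAt
    have hct : ContinuousAt e.symm y := e.symm.continuousAt hy
    by_cases hys : e.symm y ∈ e₀.source
    · have h1 : ContDiffAt ℝ ∞ (fun w => f ((e₀ ∘ e.symm) w)) y :=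
        f.contDiff.contDiffAt.comp y
          (contDiffAt_transition_real he (chart_mem_atlas ℂ p) hy hys)
      refine h1.congr_of_eventuallyEq ?_
      filter_upwards [hct.eventually (e₀.open_source.mem_nhds hys)] with w hw
      have hw : e.symm w ∈ e₀.source := hw
      simp [hχ, hw]
    · have hyC : e.symm y ∉ C := by
        rintro ⟨z, hz, hzy⟩
        exact hys (hzy ▸ e₀.map_target (hrV hz).1)
      refine (contDiffAt_const (c := (0 : ℝ))).congr_of_eventuallyEq ?_
      filter_upwards [hct.eventually (hCc.isClosed.isOpen_compl.mem_nhds hyC)] with w hw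
      exact h0 _ hw
  · rintro _ ⟨z, hz, rfl⟩
    exact (hrV hz).2
  · have h1 : ∀ᶠ x in 𝓝 p, f (e₀ x) = 1 :=
      (e₀.continuousAt hps).eventually f.eventuallyEq_one
    filter_upwards [h1, e₀.open_source.mem_nhds hps] with x hx hxs
    simp [hχ, hxs, hx]

theorem IsCutoff.contDiffAt {χ : X → ℝ} {p : X} {U : Set X} (h : IsCutoff χ p U)
    {e : OpenPartialHomeomorph X ℂ} (he : e ∈ atlas ℂ X) {y : ℂ} (hy : y ∈ e.target) :
    ContDiffAt ℝ ∞ (χ ∘ e.symm) y :=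
  (h.smooth e he).contDiffAt (e.open_target.mem_nhds hy)

/-! ### Integrals along curves -/

/-- The integrand of `OneForm.curveIntegral`. -/
noncomputable def OneForm.integrand {D : Set X} (η : OneForm X D) (γ : ℝ → X) (t : ℝ) : ℂ :=
  η.form (chartAt ℂ (γ t)) (chartAt ℂ (γ t) (γ t)) (deriv (chartAt ℂ (γ t) ∘ γ) t)

theorem OneForm.curveIntegral_eq {D : Set X} (η : OneForm X D) (γ : ℝ → X) :
    η.curveIntegral γ = ∫ t in (0 : ℝ)..1, η.integrand γ t := by
  simp [curveIntegral, integrand, form]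

theorem OneForm.integrand_congr {D : Set X} (η : OneForm X D) {γ γ' : ℝ → X} {t : ℝ}
    (h : γ =ᶠ[𝓝 t] γ') : η.integrand γ t = η.integrand γ' t := by
  rw [integrand, integrand, h.eq_of_nhds]
  congr 1
  exact (h.fun_comp (chartAt ℂ (γ' t))).deriv_eq

theorem OneForm.integrand_one_sub {D : Set X} (η : OneForm X D) (γ : ℝ → X) (t : ℝ) :
    η.integrand (fun s => γ (1 - s)) t = -η.integrand γ (1 - t) := by
  rw [integrand, integrand, ← map_neg, ← deriv_comp_const_sub]
  rfl

/-- The integrand contains two-sided derivatives, so at the endpoints it depends on values outside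
`[0, 1]`. The endpoints have measure zero, and agreement on the open interval is enough. Loops and
sides are compared only on `[0, 1]`. -/
theorem OneForm.curveIntegral_congr {D : Set X} (η : OneForm X D) {γ γ' : ℝ → X}
    (h : EqOn γ γ' (Ioo 0 1)) : η.curveIntegral γ = η.curveIntegral γ' := by
  rw [curveIntegral_eq, curveIntegral_eq, intervalIntegral.integral_of_le zero_le_one,
    intervalIntegral.integral_of_le zero_le_one, integral_Ioc_eq_integral_Ioo,
    integral_Ioc_eq_integral_Ioo]
  refine setIntegral_congr_fun measurableSet_Ioo fun t ht => η.integrand_congr ?_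
  exact h.eventuallyEq_of_mem (Ioo_mem_nhds ht.1 ht.2)

/-! ### Pull-back to the cut surface and the primitive of a closed form -/

namespace CanonicalDissection

variable {g : ℕ} (K : CanonicalDissection X g)

theorem continuousOn_proj : ContinuousOn K.proj (closedBall 0 1) := K.smooth_proj.continuousOn

theorem uniqueDiffOn_disc : UniqueDiffOn ℝ (closedBall (0 : ℂ) 1) :=
  uniqueDiffOn_convex (convex_closedBall _ _) (by
    rw [interior_closedBall _ one_ne_zero]; exact nonempty_ball.2 one_pos)

theorem mem_closure_interior_disc {z : ℂ} (hz : z ∈ closedBall (0 : ℂ) 1) :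
    z ∈ closure (interior (closedBall (0 : ℂ) 1)) := by
  rwa [interior_closedBall _ one_ne_zero, closure_ball _ one_ne_zero]

theorem contDiffWithinAt_chart [IsManifold 𝓘(ℂ, ℂ) ω X] {e : OpenPartialHomeomorph X ℂ}
    (he : e ∈ atlas ℂ X) {z : ℂ} (hz : z ∈ closedBall (0 : ℂ) 1) (hze : K.proj z ∈ e.source) :
    ContDiffWithinAt ℝ ∞ (e ∘ K.proj) (closedBall 0 1) z := by
  have h := (contMDiffWithinAt_iff.1 (K.smooth_proj z hz)).2
  simp only [mfld_simps] at h
  set e₀ := chartAt ℂ (K.proj z) with he₀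
  have hs : K.proj z ∈ e₀.source := mem_chart_source ℂ _
  have ht : ContDiffAt ℝ ∞ (e ∘ e₀.symm) ((e₀ ∘ K.proj) z) :=
    contDiffAt_transition_real (chart_mem_atlas ℂ _) he (e₀.map_source hs)
      (by rw [Function.comp_apply, e₀.left_inv hs]; exact hze)
  refine (ht.comp_contDiffWithinAt z h).congr_of_eventuallyEq ?_ ?_
  · filter_upwards [(K.continuousOn_proj z hz).eventually (e₀.open_source.mem_nhds hs)] with w hw
    simp [e₀.left_inv hw]
  · simp [e₀.left_inv hs]

/-- The pullback of a `1`-form to the cut surface. -/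
noncomputable def pull {D : Set X} (η : OneForm X D) (z : ℂ) : ℂ →L[ℝ] ℂ :=
  (η.form (chartAt ℂ (K.proj z)) (chartAt ℂ (K.proj z) (K.proj z))).comp
    (fderivWithin ℝ (chartAt ℂ (K.proj z) ∘ K.proj) (closedBall 0 1) z)

theorem pull_eq [IsManifold 𝓘(ℂ, ℂ) ω X] {D : Set X} (η : OneForm X D)
    {e : OpenPartialHomeomorph X ℂ} (he : e ∈ atlas ℂ X) {z : ℂ} (hz : z ∈ closedBall (0 : ℂ) 1)
    (hze : K.proj z ∈ e.source) (hzD : K.proj z ∉ D) :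
    K.pull η z = (η.form e (e (K.proj z))).comp
      (fderivWithin ℝ (e ∘ K.proj) (closedBall 0 1) z) := by
  rw [pull]
  set e₀ := chartAt ℂ (K.proj z) with he₀
  have hs : K.proj z ∈ e₀.source := mem_chart_source ℂ _
  rw [η.form_compat (chart_mem_atlas ℂ _) he hs hze hzD, ContinuousLinearMap.comp_assoc]
  congr 1
  have h0 := (K.contDiffWithinAt_chart (chart_mem_atlas ℂ _) hz hs).differentiableWithinAt
    (by simp)
  have ht : DifferentiableAt ℝ (e ∘ e₀.symm) ((e₀ ∘ K.proj) z) :=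
    (contDiffAt_transition_real (chart_mem_atlas ℂ _) he (e₀.map_source hs)
      (by rw [e₀.left_inv hs]; exact hze)).differentiableAt (by simp)
  have h1 := (ht.hasFDerivAt.comp_hasFDerivWithinAt z h0.hasFDerivWithinAt).congr_of_eventuallyEq
    (f₁ := e ∘ K.proj) (by
      filter_upwards [(K.continuousOn_proj z hz).eventually (e₀.open_source.mem_nhds hs)] with w hw
      simp [e₀.left_inv hw]) (by simp [e₀.left_inv hs])
  exact (h1.fderivWithin (uniqueDiffOn_disc z hz)).symm

theorem pull_eventuallyEq [IsManifold 𝓘(ℂ, ℂ) ω X] {D : Set X} (hD : _root_.IsClosed D) (η : OneForm X D)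
    {e : OpenPartialHomeomorph X ℂ} (he : e ∈ atlas ℂ X) {z : ℂ} (hz : z ∈ closedBall (0 : ℂ) 1)
    (hze : K.proj z ∈ e.source) (hzD : K.proj z ∉ D) :
    K.pull η =ᶠ[𝓝[closedBall 0 1] z] fun w => (η.form e (e (K.proj w))).comp
      (fderivWithin ℝ (e ∘ K.proj) (closedBall 0 1) w) := by
  filter_upwards [(K.continuousOn_proj z hz).eventually (e.open_source.mem_nhds hze),
    (K.continuousOn_proj z hz).eventually (hD.isOpen_compl.mem_nhds hzD),
    self_mem_nhdsWithin] with w h1 h2 h3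
  exact K.pull_eq η he h3 h1 h2

/-- The pull-back is differentiable up to the boundary circle, where `extd` is not available. The
antisymmetric part of its derivative replaces it; when `extd` of the form vanishes, the derivative
is symmetric. -/
theorem exists_hasFDerivWithinAt_pull [IsManifold 𝓘(ℂ, ℂ) ω X] {D : Set X} (hD : _root_.IsClosed D)
    (η : OneForm X D) {e : OpenPartialHomeomorph X ℂ} (he : e ∈ atlas ℂ X) {z : ℂ}
    (hz : z ∈ closedBall (0 : ℂ) 1) (hze : K.proj z ∈ e.source) (hzD : K.proj z ∉ D) :
    ∃ B : ℂ →L[ℝ] ℂ →L[ℝ] ℂ, HasFDerivWithinAt (K.pull η) B (closedBall 0 1) z ∧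
      ∀ v w, B v w - B w v = ((v.re * w.im - v.im * w.re : ℝ) : ℂ) *
        (((fderivWithin ℝ (e ∘ K.proj) (closedBall 0 1) z).det : ℝ) *
          extd (η.form e) (e (K.proj z))) := by
  obtain ⟨B, h1, h2⟩ := exists_hasFDerivWithinAt_pullback uniqueDiffOn_disc hz
    (mem_closure_interior_disc hz)
    ((K.contDiffWithinAt_chart he hz hze).of_le (m := 2) (by norm_cast))
    (η.differentiableAt_form hD he (e.map_source hze) (by rwa [Function.comp_apply, e.left_inv hze]))
  exact ⟨B, h1.congr_of_eventuallyEq (K.pull_eventuallyEq hD η he hz hze hzD)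
    (K.pull_eq η he hz hze hzD), h2⟩

theorem continuousWithinAt_pull [IsManifold 𝓘(ℂ, ℂ) ω X] {D : Set X} (hD : _root_.IsClosed D)
    (η : OneForm X D) {z : ℂ} (hz : z ∈ closedBall (0 : ℂ) 1) (hzD : K.proj z ∉ D) :
    ContinuousWithinAt (K.pull η) (closedBall 0 1) z := by
  obtain ⟨B, h, -⟩ := K.exists_hasFDerivWithinAt_pull hD η (chart_mem_atlas ℂ (K.proj z)) hz
    (mem_chart_source ℂ _) hzD
  exact h.continuousWithinAt

/-- By the chain rule within the closed disc: `proj` is not controlled outside, so the curve has to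
stay in the disc near `t`. Curves on the boundary circle are allowed. -/
theorem integrand_comp [IsManifold 𝓘(ℂ, ℂ) ω X] {D : Set X} (η : OneForm X D) {γ : ℝ → ℂ} {t : ℝ}
    {v : ℂ} (hγ : HasDerivAt γ v t) (hs : ∀ᶠ τ in 𝓝 t, γ τ ∈ closedBall (0 : ℂ) 1) :
    η.integrand (K.proj ∘ γ) t = K.pull η (γ t) v := by
  have hz := hs.self_of_nhds
  have h0 := ((K.contDiffWithinAt_chart (chart_mem_atlas ℂ _) hz
    (mem_chart_source ℂ (K.proj (γ t)))).differentiableWithinAt (by simp)).hasFDerivWithinAt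
  have h1 := h0.comp_hasDerivWithinAt t (hγ.hasDerivWithinAt (s := γ ⁻¹' closedBall 0 1))
    (mapsTo_preimage _ _)
  have h2 := h1.hasDerivAt hs
  rw [OneForm.integrand, pull, ContinuousLinearMap.comp_apply, ← h2.deriv]
  rfl

/-- Closed forms have a primitive on the cut surface. -/
theorem exists_primitive [IsManifold 𝓘(ℂ, ℂ) ω X] (α : OneForm X (∅ : Set X)) (hα : α.IsClosed)
    {q₀ : ℂ} : ∃ u : ℂ → ℂ, u q₀ = 0 ∧ ∀ z ∈ closedBall (0 : ℂ) 1,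
      HasFDerivWithinAt u (K.pull α z) (closedBall 0 1) z := by
  have h := fun z (hz : z ∈ closedBall (0 : ℂ) 1) => K.exists_hasFDerivWithinAt_pull
    isClosed_empty α (chart_mem_atlas ℂ (K.proj z)) hz (mem_chart_source ℂ _) (notMem_empty _)
  have hconv := convex_closedBall (0 : ℂ) 1
  -- Poincaré lemma on a convex set: symmetry of the derivative of the form is closedness of `π^*α`.
  obtain ⟨f, hf⟩ := hconv.exists_forall_hasFDerivWithinAt_of_fderivWithin_symmetric
    (fun z hz => (h z hz).choose_spec.1.differentiableWithinAt) (by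
      intro z hz x _ y _
      obtain ⟨B, h1, h2⟩ := h z hz
      rw [h1.fderivWithin (uniqueDiffOn_disc z hz), ← sub_eq_zero, h2,
        α.extd_form_of_isClosed hα (chart_mem_atlas ℂ _)
          ((chartAt ℂ (K.proj z)).map_source (mem_chart_source ℂ _))]
      simp)
  exact ⟨fun z => f z - f q₀, sub_self _, fun z hz => (hf z hz).sub_const _⟩

theorem curveIntegral_eq_sub [IsManifold 𝓘(ℂ, ℂ) ω X] {α : OneForm X (∅ : Set X)} {u : ℂ → ℂ}
    (hu : ∀ z ∈ closedBall (0 : ℂ) 1, HasFDerivWithinAt u (K.pull α z) (closedBall 0 1) z)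
    {γ : ℝ → ℂ} (hγ : ContDiffOn ℝ 1 γ (Icc 0 1)) (hm : MapsTo γ (Icc 0 1) (closedBall 0 1)) :
    α.curveIntegral (K.proj ∘ γ) = u (γ 1) - u (γ 0) := by
  have huI : UniqueDiffOn ℝ (Icc (0 : ℝ) 1) := uniqueDiffOn_Icc zero_lt_one
  have hd : ContinuousOn (derivWithin γ (Icc 0 1)) (Icc 0 1) :=
    hγ.continuousOn_derivWithin huI le_rfl
  have hp : ContinuousOn (K.pull α) (closedBall 0 1) := fun z hz =>
    K.continuousWithinAt_pull isClosed_empty α hz (notMem_empty _)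
  have hc : ContinuousOn (fun t => K.pull α (γ t) (derivWithin γ (Icc 0 1) t)) (Icc 0 1) :=
    (hp.comp hγ.continuousOn hm).clm_apply hd
  have huc : ContinuousOn u (closedBall 0 1) := fun z hz => (hu z hz).continuousWithinAt
  have hγd : ∀ t ∈ Ioo (0 : ℝ) 1, HasDerivAt γ (derivWithin γ (Icc 0 1) t) t := fun t ht =>
    ((hγ.differentiableOn (by norm_num) t (Ioo_subset_Icc_self ht)).hasDerivWithinAt).hasDerivAt
      (Icc_mem_nhds ht.1 ht.2)
  have hev : ∀ t ∈ Ioo (0 : ℝ) 1, ∀ᶠ τ in 𝓝 t, γ τ ∈ closedBall (0 : ℂ) 1 := fun t ht =>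
    mem_of_superset (Icc_mem_nhds ht.1 ht.2) hm
  rw [← intervalIntegral.integral_eq_sub_of_hasDerivAt_of_le zero_le_one
    (f := fun t => u (γ t)) (huc.comp hγ.continuousOn hm) (fun t ht => ?_)
    (hc.intervalIntegrable_of_Icc zero_le_one), OneForm.curveIntegral_eq]
  · rw [intervalIntegral.integral_of_le zero_le_one,
      intervalIntegral.integral_of_le zero_le_one, integral_Ioc_eq_integral_Ioo,
      integral_Ioc_eq_integral_Ioo]
    exact setIntegral_congr_fun measurableSet_Ioo fun t ht =>
      K.integrand_comp α (hγd t ht) (hev t ht)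
  · have h1 := (hu (γ t) (hm (Ioo_subset_Icc_self ht))).comp_hasDerivWithinAt t
      ((hγd t ht).hasDerivWithinAt (s := Icc 0 1)) hm
    exact h1.hasDerivAt (Icc_mem_nhds ht.1 ht.2)

/-! ### The interior of the cut surface -/

theorem lift_proj {z : ℂ} (hz : z ∈ ball (0 : ℂ) 1) : K.lift (K.proj z) = z :=
  K.injOn_interior.leftInvOn_invFunOn hz

theorem isOpen_ball_inter {U : Set X} (hU : IsOpen U) : IsOpen (ball (0 : ℂ) 1 ∩ K.proj ⁻¹' U) :=
  (K.continuousOn_proj.mono ball_subset_closedBall).isOpen_inter_preimage isOpen_ball hU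

theorem contDiffOn_chart [IsManifold 𝓘(ℂ, ℂ) ω X] {e : OpenPartialHomeomorph X ℂ}
    (he : e ∈ atlas ℂ X) :
    ContDiffOn ℝ ∞ (e ∘ K.proj) (ball (0 : ℂ) 1 ∩ K.proj ⁻¹' e.source) := fun _ hz =>
  (K.contDiffWithinAt_chart he (ball_subset_closedBall hz.1) hz.2).mono
    (inter_subset_left.trans ball_subset_closedBall)

theorem fderivWithin_chart {e : OpenPartialHomeomorph X ℂ} {z : ℂ} (hz : z ∈ ball (0 : ℂ) 1) :
    fderivWithin ℝ (e ∘ K.proj) (closedBall 0 1) z = fderiv ℝ (e ∘ K.proj) z :=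
  fderivWithin_of_mem_nhds (mem_of_superset (isOpen_ball.mem_nhds hz) ball_subset_closedBall)

/-- The primitive descends to a primitive on the complement of the cut locus. -/
theorem hasFDerivAt_lift [IsManifold 𝓘(ℂ, ℂ) ω X] {α : OneForm X (∅ : Set X)} {u : ℂ → ℂ}
    (hu : ∀ z ∈ closedBall (0 : ℂ) 1, HasFDerivWithinAt u (K.pull α z) (closedBall 0 1) z)
    {e : OpenPartialHomeomorph X ℂ} (he : e ∈ atlas ℂ X) {z : ℂ} (hz : z ∈ ball (0 : ℂ) 1)
    (hze : K.proj z ∈ e.source) :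
    HasFDerivAt (fun y => u (K.lift (e.symm y))) (α.form e (e (K.proj z))) (e (K.proj z)) := by
  have hO := K.isOpen_ball_inter e.open_source
  have hzO : z ∈ ball (0 : ℂ) 1 ∩ K.proj ⁻¹' e.source := ⟨hz, hze⟩
  have hF : ContDiffAt ℝ ∞ (e ∘ K.proj) z := (K.contDiffOn_chart he).contDiffAt (hO.mem_nhds hzO)
  have hdet := K.orientation z hz e he hze
  set L := (fderiv ℝ (e ∘ K.proj) z).toContinuousLinearEquivOfDetNeZero hdet.ne' with hL
  have hs : HasStrictFDerivAt (e ∘ K.proj) (L : ℂ →L[ℝ] ℂ) z := by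
    have := hF.hasStrictFDerivAt (by simp)
    simpa [hL] using this
  -- The inverse function theorem differentiates any local left inverse, so continuity of `lift`, a
  -- mere choice of preimages, need not be known beforehand.
  have hinv : HasStrictFDerivAt (fun y => K.lift (e.symm y)) (L.symm : ℂ →L[ℝ] ℂ)
      ((e ∘ K.proj) z) := by
    refine hs.to_local_left_inverse ?_
    filter_upwards [hO.mem_nhds hzO] with w hw
    rw [Function.comp_apply, e.left_inv hw.2, K.lift_proj hw.1]
  have hlz : K.lift (e.symm ((e ∘ K.proj) z)) = z := by
    rw [Function.comp_apply, e.left_inv hze, K.lift_proj hz]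
  have hu' : HasFDerivAt u (K.pull α z) z := (hu z (ball_subset_closedBall hz)).hasFDerivAt
    (mem_of_superset (isOpen_ball.mem_nhds hz) ball_subset_closedBall)
  have h1 := HasFDerivAt.comp ((e ∘ K.proj) z) (g := u) (f := fun y => K.lift (e.symm y))
    (by rw [hlz]; exact hu') hinv.hasFDerivAt
  refine h1.congr_fderiv ?_
  rw [K.pull_eq α he (ball_subset_closedBall hz) hze (notMem_empty _), K.fderivWithin_chart hz,
    ContinuousLinearMap.comp_assoc]
  have : (fderiv ℝ (e ∘ K.proj) z).comp (L.symm : ℂ →L[ℝ] ℂ) = ContinuousLinearMap.id ℝ ℂ := by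
    have h2 : (fderiv ℝ (e ∘ K.proj) z) = (L : ℂ →L[ℝ] ℂ) := by simp [hL]
    rw [h2]
    simp
  rw [this, ContinuousLinearMap.comp_id]

end CanonicalDissection

/-! ### Integrals of logarithmic forms and their transport to the disc -/

theorem integrableAtFilter_congr_punctured {f h : ℂ → ℂ} {c : ℂ}
    (hf : IntegrableAtFilter f (𝓝 c)) (hfh : f =ᶠ[𝓝[≠] c] h) : IntegrableAtFilter h (𝓝 c) := by
  obtain ⟨s, hs, hi⟩ := hf
  rw [EventuallyEq, eventually_nhdsWithin_iff] at hfh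
  obtain ⟨t, hts, hto, htc⟩ := _root_.eventually_nhds_iff.1 hfh
  refine ⟨s ∩ t, inter_mem hs (hto.mem_nhds htc), ?_⟩
  refine (hi.mono_set inter_subset_left).congr ?_
  have h1 : ∀ᵐ z ∂(volume.restrict (s ∩ t)), z ∈ t :=
    ae_mono (Measure.restrict_mono_set _ inter_subset_right) (ae_restrict_mem hto.measurableSet)
  have h2 : ∀ᵐ z ∂(volume.restrict (s ∩ t)), z ≠ c :=
    ae_restrict_of_ae (Measure.ae_ne volume c)
  filter_upwards [h1, h2] with z hz hzc
  exact hts z hz hzc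

/-- A logarithmic form has at worst the singularity `1 / z`, which is integrable in real dimension
two. -/
theorem TwoForm.locallyIntegrableOn_coeff {D : Finset X} [T2Space X] {η : TwoForm X (D : Set X)}
    (hη : η.IsLog) {e : OpenPartialHomeomorph X ℂ} (he : e ∈ atlas ℂ X) :
    LocallyIntegrableOn (η.coeff e) e.target := by
  intro y hy
  refine IntegrableAtFilter.filter_mono nhdsWithin_le_nhds ?_
  by_cases hyD : e.symm y ∈ (D : Set X)
  · obtain ⟨f, hf, hfe⟩ := hη e he (e.symm y) (e.map_target hy) hyD
    rw [e.right_inv hy] at hf hfe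
    exact integrableAtFilter_congr_punctured (integrableAtFilter_div_sub hf)
      (hfe.mono fun _ h => h.symm)
  · have hO := isOpen_target_inter e D.finite_toSet.isClosed.isOpen_compl
    have h1 := (η.smooth e he).continuousOn.locallyIntegrableOn hO.measurableSet (μ := volume) y
      ⟨hy, hyD⟩
    rwa [hO.nhdsWithin_eq ⟨hy, hyD⟩] at h1

namespace CanonicalDissection

variable {g : ℕ} (K : CanonicalDissection X g)

theorem isCompact_cutLocus : IsCompact K.cutLocus :=
  (isCompact_sphere _ _).image_of_continuousOn
    (K.continuousOn_proj.mono sphere_subset_closedBall)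

theorem notMem_cutLocus {x : X} : x ∉ K.cutLocus ↔ x ∈ K.proj '' ball 0 1 := by
  constructor
  · intro hx
    obtain ⟨z, hz, rfl⟩ := K.surj_proj.symm ▸ mem_univ x
    rcases (mem_closedBall.1 hz).lt_or_eq with h | h
    · exact ⟨z, h, rfl⟩
    · exact absurd ⟨z, h, rfl⟩ hx
  · rintro ⟨z, hz, rfl⟩ ⟨w, hw, hwz⟩
    exact K.interior_boundary z hz w hw hwz.symm

/-- The part of the open disc lying over a coordinate domain. -/
def cutDomain (e : OpenPartialHomeomorph X ℂ) : Set ℂ := ball (0 : ℂ) 1 ∩ K.proj ⁻¹' e.source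

theorem image_cutDomain (e : OpenPartialHomeomorph X ℂ) :
    (e ∘ K.proj) '' K.cutDomain e = e.target ∩ e.symm ⁻¹' K.cutLocusᶜ := by
  ext y
  constructor
  · rintro ⟨z, ⟨hz, hze⟩, rfl⟩
    refine ⟨e.map_source hze, ?_⟩
    rw [mem_preimage, Function.comp_apply, e.left_inv hze]
    exact K.notMem_cutLocus.2 ⟨z, hz, rfl⟩
  · rintro ⟨hy, hyc⟩
    obtain ⟨z, hz, hzy⟩ := K.notMem_cutLocus.1 hyc
    refine ⟨z, ⟨hz, ?_⟩, ?_⟩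
    · rw [mem_preimage, hzy]; exact e.map_target hy
    · rw [Function.comp_apply, hzy, e.right_inv hy]

theorem injOn_cutDomain (e : OpenPartialHomeomorph X ℂ) : InjOn (e ∘ K.proj) (K.cutDomain e) := by
  intro z hz w hw h
  exact K.injOn_interior hz.1 hw.1 (e.injOn hz.2 hw.2 h)

theorem isOpen_cutDomain (e : OpenPartialHomeomorph X ℂ) : IsOpen (K.cutDomain e) :=
  K.isOpen_ball_inter e.open_source

theorem hasFDerivWithinAt_cutDomain [IsManifold 𝓘(ℂ, ℂ) ω X] {e : OpenPartialHomeomorph X ℂ}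
    (he : e ∈ atlas ℂ X) {z : ℂ} (hz : z ∈ K.cutDomain e) :
    HasFDerivWithinAt (e ∘ K.proj) (fderiv ℝ (e ∘ K.proj) z) (K.cutDomain e) z :=
  (((K.contDiffOn_chart he).contDiffAt ((K.isOpen_cutDomain e).mem_nhds hz)).differentiableAt
    (by simp)).hasFDerivAt.hasFDerivWithinAt

/-- The orientation hypothesis makes the Jacobian positive, so the change of variables needs no
absolute value. -/
theorem integral_image_cutDomain [IsManifold 𝓘(ℂ, ℂ) ω X] {e : OpenPartialHomeomorph X ℂ}
    (he : e ∈ atlas ℂ X) (h : ℂ → ℂ) :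
    ∫ y in (e ∘ K.proj) '' K.cutDomain e, h y =
      ∫ z in K.cutDomain e, ((fderiv ℝ (e ∘ K.proj) z).det : ℂ) * h (e (K.proj z)) := by
  rw [integral_image_eq_integral_abs_det_fderiv_smul volume (K.isOpen_cutDomain e).measurableSet
    (fun z hz => K.hasFDerivWithinAt_cutDomain he hz) (K.injOn_cutDomain e)]
  refine setIntegral_congr_fun (K.isOpen_cutDomain e).measurableSet fun z hz => ?_
  simp only [abs_of_pos (K.orientation z hz.1 e he hz.2), Complex.real_smul]
  rfl

theorem integrableOn_image_cutDomain [IsManifold 𝓘(ℂ, ℂ) ω X] {e : OpenPartialHomeomorph X ℂ}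
    (he : e ∈ atlas ℂ X) {h : ℂ → ℂ} (hh : IntegrableOn h ((e ∘ K.proj) '' K.cutDomain e)) :
    IntegrableOn (fun z => ((fderiv ℝ (e ∘ K.proj) z).det : ℂ) * h (e (K.proj z))) (K.cutDomain e) := by
  rw [integrableOn_image_iff_integrableOn_abs_det_fderiv_smul volume
    (K.isOpen_cutDomain e).measurableSet (fun z hz => K.hasFDerivWithinAt_cutDomain he hz)
    (K.injOn_cutDomain e)] at hh
  refine hh.congr_fun (fun z hz => ?_) (K.isOpen_cutDomain e).measurableSet
  simp only [abs_of_pos (K.orientation z hz.1 e he hz.2), Complex.real_smul]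
  rfl

/-- What is missing is the cut locus, the image of the unit circle. A circle is a null set, and
differentiable maps of the plane preserve null sets. -/
theorem target_ae_eq_image_cutDomain [IsManifold 𝓘(ℂ, ℂ) ω X] {e : OpenPartialHomeomorph X ℂ}
    (he : e ∈ atlas ℂ X) : (e.target : Set ℂ) =ᵐ[volume] (e ∘ K.proj) '' K.cutDomain e := by
  rw [K.image_cutDomain]
  have h1 : volume ((e ∘ K.proj) '' (sphere (0 : ℂ) 1 ∩ K.proj ⁻¹' e.source)) = 0 := by
    refine addHaar_image_eq_zero_of_differentiableOn_of_addHaar_eq_zero volume (fun z hz => ?_) ?_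
    · exact ((K.contDiffWithinAt_chart he (sphere_subset_closedBall hz.1) hz.2).differentiableWithinAt
        (by simp)).mono (inter_subset_left.trans sphere_subset_closedBall)
    · exact measure_mono_null inter_subset_left (Measure.addHaar_sphere volume 0 1)
  have h2 : volume (e.target \ (e.target ∩ e.symm ⁻¹' K.cutLocusᶜ)) = 0 := by
    refine measure_mono_null (fun y hy => ?_) h1
    have h3 : e.symm y ∈ K.cutLocus := by
      by_contra h
      exact hy.2 ⟨hy.1, h⟩
    obtain ⟨z, hz, hzy⟩ := h3
    refine ⟨z, ⟨hz, ?_⟩, ?_⟩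
    · rw [mem_preimage, hzy]; exact e.map_target hy.1
    · rw [Function.comp_apply, hzy, e.right_inv hy.1]
  exact (ae_eq_set.2 ⟨h2, by rw [Set.sdiff_eq_empty.2 inter_subset_left]; simp⟩)

/-! ### The form `u φ + β` and its exterior derivative -/

/-- The `1`-form `u φ + β` on the cut surface. -/
noncomputable def cutForm {D : Set X} (u : ℂ → ℂ) (φ β : OneForm X D) (z : ℂ) : ℂ →L[ℝ] ℂ :=
  u z • K.pull φ z + K.pull β z

/-- The `1`-form `u φ + β` in a coordinate, for a `(1,0)`-form `φ` and a `(0,1)`-form `β`. -/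
noncomputable def chartForm {D : Set X} (u : ℂ → ℂ) (φ β : OneForm X D)
    (e : OpenPartialHomeomorph X ℂ) (y : ℂ) : ℂ →L[ℝ] ℂ :=
  formL (u (K.lift (e.symm y)) * φ.dz e y) (β.dzbar e y)

section Forms

variable [IsManifold 𝓘(ℂ, ℂ) ω X] {D : Finset X} [T2Space X]
  {φ : OneForm X (D : Set X)} {α : OneForm X (∅ : Set X)} {u : ℂ → ℂ}
  {η : TwoForm X (D : Set X)} {β : OneForm X (D : Set X)}

theorem continuousOn_cutForm
    (hu : ∀ z ∈ closedBall (0 : ℂ) 1, HasFDerivWithinAt u (K.pull α z) (closedBall 0 1) z)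
    {z : ℂ} (hz : z ∈ closedBall (0 : ℂ) 1) (hzD : K.proj z ∉ (D : Set X)) :
    ContinuousWithinAt (K.cutForm u φ β) (closedBall 0 1) z :=
  ((hu z hz).continuousWithinAt.smul
    (K.continuousWithinAt_pull D.finite_toSet.isClosed φ hz hzD)).add
    (K.continuousWithinAt_pull D.finite_toSet.isClosed β hz hzD)

/-- The derivative of the descended primitive is the coordinate expression of `α`, which is
continuous. Class `C¹` is all that is needed for `extd` to be continuous off the pole. -/
theorem contDiffAt_chartForm
    (hu : ∀ z ∈ closedBall (0 : ℂ) 1, HasFDerivWithinAt u (K.pull α z) (closedBall 0 1) z)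
    {e : OpenPartialHomeomorph X ℂ} (he : e ∈ atlas ℂ X) {y : ℂ} (hy : y ∈ e.target)
    (hyc : e.symm y ∉ K.cutLocus) (hyD : e.symm y ∉ (D : Set X)) :
    ContDiffAt ℝ 1 (K.chartForm u φ β e) y := by
  have hcl := D.finite_toSet.isClosed
  have hV : ContDiffAt ℝ 1 (fun y => u (K.lift (e.symm y))) y := by
    rw [contDiffAt_one_iff]
    have hO := isOpen_target_inter e K.isCompact_cutLocus.isClosed.isOpen_compl
    refine ⟨α.form e, _, hO.mem_nhds ⟨hy, hyc⟩, fun w hw => ?_, fun w hw => ?_⟩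
    · exact (α.differentiableAt_form isClosed_empty he hw.1 (by simp)).continuousAt.continuousWithinAt
    · rw [← K.image_cutDomain] at hw
      obtain ⟨z, hz, rfl⟩ := hw
      exact K.hasFDerivAt_lift hu he hz.1 hz.2
  have h1 := hV.mul ((φ.contDiffAt_dz hcl he hy hyD).of_le (m := 1) (by norm_cast))
  have h2 := (β.contDiffAt_dzbar hcl he hy hyD).of_le (m := 1) (by norm_cast)
  unfold chartForm formL
  fun_prop

/-- The heart of the argument: `d(u φ) = α ∧ φ` because `φ` is holomorphic, and `dβ = ∂β`, so the
sum is `-(φ ∧ α) + ∂β = -η`. The factor `2 * I` is that of `-dz ∧ dz̄ = 2i dx ∧ dy`. -/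
theorem extd_chartForm
    (hu : ∀ z ∈ closedBall (0 : ℂ) 1, HasFDerivWithinAt u (K.pull α z) (closedBall 0 1) z)
    (hφ : φ.IsMeromorphic) (hdec : (φ.wedge α).IsLogDecomposition η β)
    {e : OpenPartialHomeomorph X ℂ} (he : e ∈ atlas ℂ X) {y : ℂ} (hy : y ∈ e.target)
    (hyc : e.symm y ∉ K.cutLocus) (hyD : e.symm y ∉ (D : Set X)) :
    extd (K.chartForm u φ β e) y = 2 * I * η.coeff e y := by
  have hcl := D.finite_toSet.isClosed
  have hV : HasFDerivAt (fun y => u (K.lift (e.symm y))) (α.form e y) y := by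
    have hO : y ∈ e.target ∩ e.symm ⁻¹' K.cutLocusᶜ := ⟨hy, hyc⟩
    rw [← K.image_cutDomain] at hO
    obtain ⟨z, hz, rfl⟩ := hO
    exact K.hasFDerivAt_lift hu he hz.1 hz.2
  have hh : DifferentiableAt ℂ (φ.dz e) y := ((hφ e he).2.1).differentiableAt
    ((isOpen_target_inter e hcl.isOpen_compl).mem_nhds ⟨hy, hyD⟩)
  have hVd : wirtingerDbar (fun y => u (K.lift (e.symm y))) y = α.dzbar e y := by
    rw [wirtingerDbar, hV.fderiv, OneForm.form, formL_apply, formL_apply]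
    simp
    ring_nf
    simp
    ring
  have h1 := hdec.2.2 e he y hy hyD
  have h2 := (hφ e he).1 y hy hyD
  have h3 : (φ.wedge α).coeff e y = φ.dz e y * α.dzbar e y - φ.dzbar e y * α.dz e y := rfl
  rw [h3, h2] at h1
  have := extd_formL (a := fun y => u (K.lift (e.symm y)) * φ.dz e y) (b := β.dzbar e) (z := y)
    (hV.differentiableAt.mul (hh.restrictScalars ℝ))
    ((β.contDiffAt_dzbar hcl he hy hyD).differentiableAt (by simp))
  rw [wirtingerDbar_mul_holomorphic hV.differentiableAt hh, hVd] at this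
  refine this.trans ?_
  linear_combination (2 * I) * h1

-- `chartForm` keeps only the `dz` part of `φ` and the `dz̄` part of `β`; the other coefficients
-- vanish because of the types of the forms.
omit [T2Space X] in
theorem cutForm_eq (hφ : φ.IsMeromorphic) (hβ : β.IsZeroOneWithPoles)
    {e : OpenPartialHomeomorph X ℂ} (he : e ∈ atlas ℂ X) {z : ℂ} (hz : z ∈ K.cutDomain e)
    (hzD : K.proj z ∉ (D : Set X)) :
    K.cutForm u φ β z =
      (K.chartForm u φ β e (e (K.proj z))).comp (fderiv ℝ (e ∘ K.proj) z) := by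
  have hz' := ball_subset_closedBall hz.1
  rw [cutForm, K.pull_eq φ he hz' hz.2 hzD, K.pull_eq β he hz' hz.2 hzD, K.fderivWithin_chart hz.1]
  have hy := e.map_source hz.2
  have hl : e.symm (e (K.proj z)) = K.proj z := e.left_inv hz.2
  ext1 v
  simp only [chartForm, OneForm.form, add_apply, smul_apply, ContinuousLinearMap.comp_apply,
    formL_apply, hl, K.lift_proj hz.1]
  rw [(hφ e he).1 _ hy (by rwa [hl]), (hβ e he).1 _ hy (by rwa [hl]), smul_eq_mul]
  ring

omit [IsManifold 𝓘(ℂ, ℂ) ω X] in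
theorem isOpen_cutDomain_inter (e : OpenPartialHomeomorph X ℂ) :
    IsOpen (K.cutDomain e ∩ K.proj ⁻¹' (D : Set X)ᶜ) := by
  have := K.isOpen_ball_inter (e.open_source.inter D.finite_toSet.isClosed.isOpen_compl)
  rwa [preimage_inter, ← inter_assoc] at this

theorem extd_cutForm
    (hu : ∀ z ∈ closedBall (0 : ℂ) 1, HasFDerivWithinAt u (K.pull α z) (closedBall 0 1) z)
    (hφ : φ.IsMeromorphic) (hdec : (φ.wedge α).IsLogDecomposition η β)
    {e : OpenPartialHomeomorph X ℂ} (he : e ∈ atlas ℂ X) {z : ℂ} (hz : z ∈ K.cutDomain e)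
    (hzD : K.proj z ∉ (D : Set X)) :
    DifferentiableAt ℝ (K.cutForm u φ β) z ∧ extd (K.cutForm u φ β) z =
      ((fderiv ℝ (e ∘ K.proj) z).det : ℝ) * (2 * I * η.coeff e (e (K.proj z))) := by
  have hy := e.map_source hz.2
  have hl : e.symm (e (K.proj z)) = K.proj z := e.left_inv hz.2
  have hc : K.proj z ∉ K.cutLocus := K.notMem_cutLocus.2 ⟨z, hz.1, rfl⟩
  rw [← K.extd_chartForm hu hφ hdec he hy (by rwa [hl]) (by rwa [hl])]
  refine extd_pullback (K.isOpen_cutDomain e) hz ((K.contDiffOn_chart he).of_le (by norm_cast))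
    ((K.contDiffAt_chartForm hu he hy (by rwa [hl]) (by rwa [hl])).differentiableAt (by simp)) ?_
  filter_upwards [(K.isOpen_cutDomain_inter e).mem_nhds ⟨hz, hzD⟩] with w hw
  exact K.cutForm_eq hφ hdec.2.1 he hw.1 hw.2

omit [IsManifold 𝓘(ℂ, ℂ) ω X] [T2Space X] in
theorem ae_proj_notMem (D : Finset X) : ∀ᵐ z ∂volume.restrict (ball (0 : ℂ) 1),
    K.proj z ∉ (D : Set X) := by
  rw [ae_restrict_iff' measurableSet_ball]
  have hfin : (ball (0 : ℂ) 1 ∩ K.proj ⁻¹' (D : Set X)).Finite :=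
    Finite.of_finite_image (f := K.proj) (D.finite_toSet.subset (by
      rintro _ ⟨z, hz, rfl⟩; exact hz.2)) (K.injOn_interior.mono inter_subset_left)
  filter_upwards [hfin.countable.ae_notMem volume] with z hz hzb hzD
  exact hz ⟨hzb, hzD⟩

omit [IsManifold 𝓘(ℂ, ℂ) ω X] in
theorem integrableOn_partition [CompactSpace X] (hlog : η.IsLog)
    {ρ : PartitionOfUnity X X univ} (hρ : ρ.IsSubordinate (fun x => (chartAt ℂ x).source)) (x : X) :
    IntegrableOn (fun z : ℂ => (ρ x ((chartAt ℂ x).symm z) : ℂ) *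
        (η.coeff (chartAt ℂ x) z * (-2 * Complex.I))) (chartAt ℂ x).target := by
  set e := chartAt ℂ x with he
  set C := e '' tsupport (ρ x) with hC
  have hts : tsupport (ρ x) ⊆ e.source := hρ x
  have hCc : IsCompact C :=
    (isClosed_tsupport (ρ x)).isCompact.image_of_continuousOn (e.continuousOn.mono hts)
  have hCt : C ⊆ e.target := by
    rintro _ ⟨y, hy, rfl⟩
    exact e.map_source (hts hy)
  have h1 : IntegrableOn (η.coeff e) C :=
    (TwoForm.locallyIntegrableOn_coeff hlog (chart_mem_atlas ℂ x)).integrableOn_compact_subset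
      hCt hCc
  have hcont : ContinuousOn (fun z => ((ρ x (e.symm z) : ℝ) : ℂ)) C :=
    Complex.continuous_ofReal.comp_continuousOn
      ((ρ x).continuous.comp_continuousOn (e.continuousOn_symm.mono hCt))
  have h2 : IntegrableOn (fun z => ((ρ x (e.symm z) : ℝ) : ℂ) * (η.coeff e z * (-2 * I))) C :=
    IntegrableOn.continuousOn_mul hcont (h1.mul_const _) hCc
  refine h2.of_forall_sdiff_eq_zero e.open_target.measurableSet fun z hz => ?_
  have : ρ x (e.symm z) = 0 := by
    refine image_eq_zero_of_notMem_tsupport fun h => hz.2 ⟨_, h, e.right_inv hz.1⟩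
  simp [this]

/-- Each term of the partition-of-unity integral is moved to the disc by `proj`, where it becomes
the integral of `-ρ dΘ`. The functions of the partition then add up to one. -/
theorem hasIntegral_neg_integral_extd [CompactSpace X]
    (hu : ∀ z ∈ closedBall (0 : ℂ) 1, HasFDerivWithinAt u (K.pull α z) (closedBall 0 1) z)
    (hφ : φ.IsMeromorphic) (hdec : (φ.wedge α).IsLogDecomposition η β) :
    IntegrableOn (extd (K.cutForm u φ β)) (ball 0 1) ∧
      η.HasIntegral (-∫ z in ball 0 1, extd (K.cutForm u φ β) z) := by
  have main : ∀ ρ : PartitionOfUnity X X univ, ρ.IsSubordinate (fun x => (chartAt ℂ x).source) →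
      IntegrableOn (extd (K.cutForm u φ β)) (ball 0 1) ∧
      ∑ᶠ x, ∫ z in (chartAt ℂ x).target, (ρ x ((chartAt ℂ x).symm z) : ℂ) *
        (η.coeff (chartAt ℂ x) z * (-2 * Complex.I)) =
        (-∫ z in ball 0 1, extd (K.cutForm u φ β) z) := by
    intro ρ hρ
    set G : X → ℂ → ℂ := fun x z => (ρ x (K.proj z) : ℂ) * (-extd (K.cutForm u φ β) z) with hG
    set H : X → ℂ → ℂ := fun x z => (ρ x ((chartAt ℂ x).symm z) : ℂ) *
        (η.coeff (chartAt ℂ x) z * (-2 * Complex.I)) with hH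
    have hGH : ∀ x, IntegrableOn (G x) (ball 0 1) ∧
        ∫ z in (chartAt ℂ x).target, H x z = ∫ z in ball 0 1, G x z := by
      intro x
      set e := chartAt ℂ x with he
      have hea : e ∈ atlas ℂ X := chart_mem_atlas ℂ x
      have hi : IntegrableOn (H x) e.target := integrableOn_partition hdec.1 hρ x
      have hi' : IntegrableOn (H x) ((e ∘ K.proj) '' K.cutDomain e) := by
        rwa [IntegrableOn, Measure.restrict_congr_set (K.target_ae_eq_image_cutDomain hea).symm]
      have hi2 := K.integrableOn_image_cutDomain hea hi'
      -- The Jacobian is absorbed: by `extd_cutForm`, the determinant times `2i η` is `dΘ`.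
      have hae : (fun z => ((fderiv ℝ (e ∘ K.proj) z).det : ℂ) * H x (e (K.proj z)))
          =ᵐ[volume.restrict (K.cutDomain e)] G x := by
        have a1 : ∀ᵐ z ∂volume.restrict (K.cutDomain e), K.proj z ∉ (D : Set X) :=
          ae_mono (Measure.restrict_mono_set _ inter_subset_left) (K.ae_proj_notMem D)
        filter_upwards [a1, ae_restrict_mem (K.isOpen_cutDomain e).measurableSet] with z hzD hz
        simp only [hG, hH, (K.extd_cutForm hu hφ hdec hea hz hzD).2]
        rw [e.left_inv hz.2]
        ring
      have hzero : ∀ z ∈ ball (0 : ℂ) 1 \ K.cutDomain e, G x z = 0 := by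
        intro z hz
        have : ρ x (K.proj z) = 0 := image_eq_zero_of_notMem_tsupport fun h =>
          hz.2 ⟨hz.1, hρ x h⟩
        simp [hG, this]
      refine ⟨IntegrableOn.of_forall_sdiff_eq_zero (hi2.congr hae) measurableSet_ball hzero, ?_⟩
      rw [setIntegral_congr_set (K.target_ae_eq_image_cutDomain hea), K.integral_image_cutDomain hea,
        integral_congr_ae hae]
      exact (setIntegral_eq_of_subset_of_forall_sdiff_eq_zero measurableSet_ball
        inter_subset_left hzero).symm
    have hfin : {x | (Function.support (ρ x)).Nonempty}.Finite :=
      ρ.locallyFinite.finite_nonempty_of_compact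
    set T := hfin.toFinset with hT
    have hρT : ∀ x ∉ T, ρ x = 0 := by
      intro x hx
      rw [hT, Finite.mem_toFinset, mem_ofPred_eq, not_nonempty_iff_eq_empty,
        Function.support_eq_empty_iff] at hx
      exact DFunLike.coe_injective hx
    have hsum : ∀ z, ∑ x ∈ T, G x z = -extd (K.cutForm u φ β) z := by
      intro z
      have h1 := ρ.sum_eq_one (mem_univ (K.proj z))
      rw [finsum_eq_sum_of_support_subset (s := T) _ (fun x hx => by
        by_contra h
        have h2 := hρT x h
        simp [h2] at hx)] at h1
      simp only [hG]
      rw [← Finset.sum_mul, ← Complex.ofReal_sum, h1]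
      simp
    have hint : IntegrableOn (fun z => ∑ x ∈ T, G x z) (ball 0 1) :=
      integrable_finsetSum T fun x _ => (hGH x).1
    simp only [hsum] at hint
    refine ⟨by simpa using hint.neg, ?_⟩
    rw [finsum_eq_sum_of_support_subset (s := T) _ (fun x hx => by
      by_contra h
      have h2 := hρT x h
      simp [h2] at hx), ← integral_neg]
    simp only [← hsum]
    rw [integral_finsetSum T fun x _ => (hGH x).1]
    exact Finset.sum_congr rfl fun x _ => (hGH x).2
  -- Integrability of `dΘ` does not mention a partition but is proved by means of one, so one must
  -- exist.
  obtain ⟨ρ, hρ⟩ := PartitionOfUnity.exists_isSubordinate (isClosed_univ (X := X))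
    (fun x : X => (chartAt ℂ x).source) (fun x => (chartAt ℂ x).open_source)
    (fun x _ => mem_iUnion.2 ⟨x, mem_chart_source ℂ x⟩)
  exact ⟨(main ρ hρ).1, fun ρ hρ => ⟨fun x => integrableOn_partition hdec.1 hρ x, (main ρ hρ).2⟩⟩

end Forms

end CanonicalDissection

/-! ### Stokes' theorem near the poles and on the whole cut surface -/

theorem real_zero_smul (L : ℂ →L[ℝ] ℂ) : (0 : ℝ) • L = 0 := by
  ext1 v
  simp

theorem circ_congr {σ τ : ℂ → ℂ →L[ℝ] ℂ} {c : ℂ} {r : ℝ} (hr : 0 ≤ r)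
    (h : ∀ z ∈ sphere c r, σ z = τ z) : circ σ c r = circ τ c r := by
  rw [circ, circ]
  congr 1
  ext θ
  rw [h _ (circleMap_mem_sphere c hr θ)]

theorem eventually_sphere {c : ℂ} {P : ℂ → Prop} (h : ∀ᶠ z in 𝓝[≠] c, P z) :
    ∀ᶠ ε : ℝ in 𝓝[>] 0, ∀ z ∈ sphere c ε, P z := by
  rw [eventually_nhdsWithin_iff] at h
  obtain ⟨r, hr, hb⟩ := Metric.eventually_nhds_iff.1 h
  filter_upwards [Ioo_mem_nhdsGT hr] with ε hε z hz
  rw [mem_sphere] at hz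
  refine hb (by rw [hz]; exact hε.2) ?_
  rintro rfl
  rw [dist_self] at hz
  exact hε.1.ne hz

/-- Stokes' theorem for a compactly supported form with an isolated singularity and integrable
exterior derivative. -/
theorem tendsto_circ_of_compactSupport {ψ : ℂ → ℂ →L[ℝ] ℂ} {c : ℂ} {C : Set ℂ} (hC : IsCompact C)
    (h0 : ∀ y ∉ C, ψ y = 0) (hd : ∀ y ≠ c, DifferentiableAt ℝ ψ y) (hi : Integrable (extd ψ)) :
    Tendsto (circ ψ c) (𝓝[>] 0) (𝓝 (-∫ y, extd ψ y)) := by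
  obtain ⟨R, hR, hCR⟩ : ∃ R > 0, C ⊆ ball c R := by
    obtain ⟨R, hR⟩ := hC.isBounded.subset_ball c
    exact ⟨max R 1, by positivity, hR.trans (ball_subset_ball (le_max_left _ _))⟩
  have hz : ∀ y, y ∉ C → extd ψ y = 0 := by
    intro y hy
    have : ψ =ᶠ[𝓝 y] fun _ => 0 := by
      filter_upwards [hC.isClosed.isOpen_compl.mem_nhds hy] with w hw using h0 w hw
    rw [extd_congr this]
    simp [extd]
  have h1 : ∀ᶠ ε : ℝ in 𝓝[>] 0,
      -(∫ y, extd ψ y) + ∫ y in closedBall c ε, extd ψ y = circ ψ c ε := by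
    filter_upwards [Ioo_mem_nhdsGT hR] with ε hε
    have hst := integral_extd_annulus (σ := ψ) (c := c) hε.1.le hε.2.le
      (fun y hy => (hd y (by
        rintro rfl; exact hy.2 (mem_ball_self hε.1))).continuousAt.continuousWithinAt)
      (fun y hy => hd y (by rintro rfl; exact hy.2 (mem_closedBall_self hε.1.le)))
      hi.integrableOn
    have hR0 : circ ψ c R = 0 := by
      rw [circ_congr (τ := fun _ => 0) hR.le fun y hy => h0 y fun h => ?_]
      · simp [circ]
      · have := hCR h
        rw [mem_ball] at this
        exact this.ne hy
    have hs : ∫ y in ball c R, extd ψ y = ∫ y, extd ψ y :=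
      setIntegral_eq_integral_of_forall_compl_eq_zero fun y hy => hz y fun h => hy (hCR h)
    rw [setIntegral_sdiff measurableSet_closedBall hi.integrableOn
      (closedBall_subset_ball hε.2), hs, hR0] at hst
    linear_combination -hst
  -- Absolute continuity of the integral: the area of the small discs tends to zero. No bound on `ψ`
  -- near `c` is needed.
  have h2 : Tendsto (fun ε : ℝ => ∫ y in closedBall c ε, extd ψ y) (𝓝[>] 0) (𝓝 0) := by
    refine hi.tendsto_setIntegral_nhds_zero ?_
    have h3 : Tendsto (fun ε : ℝ => ENNReal.ofReal ε ^ 2 * NNReal.pi) (𝓝[>] 0) (𝓝 0) := by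
      have : Tendsto (fun ε : ℝ => ENNReal.ofReal (ε ^ 2 * Real.pi)) (𝓝 0) (𝓝 (ENNReal.ofReal (0 ^ 2 * Real.pi))) :=
        (ENNReal.continuous_ofReal.comp (by fun_prop)).tendsto 0
      rw [zero_pow two_ne_zero, zero_mul, ENNReal.ofReal_zero] at this
      refine (this.mono_left nhdsWithin_le_nhds).congr' ?_
      filter_upwards [self_mem_nhdsWithin] with ε hε
      rw [ENNReal.ofReal_mul (by positivity), ENNReal.ofReal_pow (le_of_lt hε)]
      congr 1
      exact ENNReal.ofReal_eq_coe_nnreal Real.pi_pos.le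
    refine h3.congr fun ε => ?_
    simp [Complex.volume_closedBall]
  have h4 := (tendsto_const_nhds (x := -∫ y, extd ψ y)).add h2
  rw [add_zero] at h4
  exact h4.congr' h1

namespace CanonicalDissection

variable {g : ℕ} (K : CanonicalDissection X g)

variable [IsManifold 𝓘(ℂ, ℂ) ω X] {D : Finset X} [T2Space X]
  {φ : OneForm X (D : Set X)} {α : OneForm X (∅ : Set X)} {u : ℂ → ℂ}
  {η : TwoForm X (D : Set X)} {β : OneForm X (D : Set X)}

/-- The region of a coordinate domain which meets neither the cut locus nor the poles other than
`p`. -/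
def admissible (D : Finset X) (p : X) (e : OpenPartialHomeomorph X ℂ) : Set X :=
  e.source ∩ K.cutLocusᶜ ∩ ((D : Set X) \ {p})ᶜ

omit [IsManifold 𝓘(ℂ, ℂ) ω X] in
theorem isOpen_admissible (p : X) (e : OpenPartialHomeomorph X ℂ) :
    IsOpen (K.admissible D p e) :=
  (e.open_source.inter K.isCompact_cutLocus.isClosed.isOpen_compl).inter
    (D.finite_toSet.subset sdiff_subset).isClosed.isOpen_compl

omit [IsManifold 𝓘(ℂ, ℂ) ω X] [T2Space X] in
theorem mem_admissible {p : X} {e : OpenPartialHomeomorph X ℂ} (hp : p ∈ e.source)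
    (hpc : p ∉ K.cutLocus) : p ∈ K.admissible D p e := ⟨⟨hp, hpc⟩, fun h => h.2 rfl⟩

omit [T2Space X] in
theorem differentiableAt_cutoff_proj {χ : X → ℝ} {p : X} {U : Set X} (hχ : IsCutoff χ p U) {z : ℂ}
    (hz : z ∈ ball (0 : ℂ) 1) : DifferentiableAt ℝ (χ ∘ K.proj) z := by
  set e := chartAt ℂ (K.proj z) with he
  have hzc : z ∈ K.cutDomain e := ⟨hz, mem_chart_source ℂ _⟩
  have h1 := ((K.contDiffOn_chart (chart_mem_atlas ℂ (K.proj z))).contDiffAt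
    ((K.isOpen_cutDomain e).mem_nhds hzc)).differentiableAt (by simp)
  have h2 := (hχ.contDiffAt (chart_mem_atlas ℂ (K.proj z)) (e.map_source hzc.2)).differentiableAt
    (by simp)
  refine (DifferentiableAt.comp z (g := χ ∘ e.symm) h2 h1).congr_of_eventuallyEq ?_
  filter_upwards [(K.isOpen_cutDomain e).mem_nhds hzc] with w hw
  simp only [Function.comp_apply]
  rw [e.left_inv hw.2]

/-- Localization of Stokes' theorem near a pole. -/
theorem tendsto_circ_chartForm
    (hu : ∀ z ∈ closedBall (0 : ℂ) 1, HasFDerivWithinAt u (K.pull α z) (closedBall 0 1) z)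
    (hφ : φ.IsMeromorphic) (hdec : (φ.wedge α).IsLogDecomposition η β) {p : X} (hpD : p ∈ D)
    {e : OpenPartialHomeomorph X ℂ} (he : e ∈ atlas ℂ X) (hpe : p ∈ e.source) {χ : X → ℝ}
    (hχ : IsCutoff χ p (K.admissible D p e)) :
    IntegrableOn (extd fun z => χ (K.proj z) • K.cutForm u φ β z) (ball 0 1) ∧
      Tendsto (circ (K.chartForm u φ β e) (e p)) (𝓝[>] 0)
        (𝓝 (-∫ z in ball 0 1, extd (fun z => χ (K.proj z) • K.cutForm u φ β z) z)) := by
  classical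
  obtain ⟨C, hCc, hCU, hχ0⟩ := hχ.exists_compact
  set c := e p with hc
  set C' := e '' C with hC'
  have hCs : C ⊆ e.source := fun x hx => (hCU hx).1.1
  have hCc' : IsCompact C' := hCc.image_of_continuousOn (e.continuousOn.mono hCs)
  -- The localized form, extended by zero to a compactly supported form on the plane, singular at
  -- most at `c`.
  set ψ : ℂ → ℂ →L[ℝ] ℂ := fun y =>
    if y ∈ e.target then χ (e.symm y) • K.chartForm u φ β e y else 0 with hψ
  have hψ0 : ∀ y ∉ C', ψ y = 0 := by
    intro y hy
    by_cases hyt : y ∈ e.target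
    · have : χ (e.symm y) = 0 := hχ0 _ fun h => hy ⟨_, h, e.right_inv hyt⟩
      simp only [hψ, hyt, if_true, this]
      exact real_zero_smul _
    · simp [hψ, hyt]
  have hψ0' : ∀ y ∉ C', ψ =ᶠ[𝓝 y] fun _ => 0 := fun y hy => by
    filter_upwards [hCc'.isClosed.isOpen_compl.mem_nhds hy] with w hw using hψ0 w hw
  have hex : ∀ y ∉ C', extd ψ y = 0 := fun y hy => by
    rw [extd_congr (hψ0' y hy)]; simp [extd]
  have hψe : ∀ y ∈ e.target, ψ =ᶠ[𝓝 y] fun w => (χ ∘ e.symm) w • K.chartForm u φ β e w := by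
    intro y hy
    filter_upwards [e.open_target.mem_nhds hy] with w hw
    simp [hψ, hw]
  have hsm : ∀ y ≠ c, ContDiffAt ℝ 1 ψ y := by
    intro y hyc
    by_cases hy : y ∈ C'
    · obtain ⟨x, hx, rfl⟩ := hy
      have hxs := hCs hx
      have hl := e.left_inv hxs
      have hxD : e.symm (e x) ∉ (D : Set X) := fun h => (hCU hx).2 ⟨by rwa [hl] at h, fun h' =>
        hyc (by rw [hc, ← mem_singleton_iff.1 h'])⟩
      refine ContDiffAt.congr_of_eventuallyEq ?_ (hψe _ (e.map_source hxs))
      exact ((hχ.contDiffAt he (e.map_source hxs)).of_le (by norm_cast)).smul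
        (K.contDiffAt_chartForm hu he (e.map_source hxs) (by rw [hl]; exact (hCU hx).1.2) hxD)
    · exact contDiffAt_const.congr_of_eventuallyEq (hψ0' y hy)
  have hp0 : e.symm c = p := e.left_inv hpe
  have hct : c ∈ e.target := e.map_source hpe
  have hχ1 : ∀ᶠ y in 𝓝 c, χ (e.symm y) = 1 :=
    (e.symm.continuousAt hct).eventually (by simpa [hp0] using hχ.eventually_eq)
  have hψc : ∀ᶠ y in 𝓝 c, ψ y = K.chartForm u φ β e y := by
    filter_upwards [hχ1, e.open_target.mem_nhds hct] with y h1 h2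
    simp [hψ, h1, h2]
  have hpc : p ∉ K.cutLocus := by
    have : p ∈ C := by
      by_contra h
      have h1 := hχ.eventually_eq.self_of_nhds
      rw [hχ0 p h] at h1
      exact zero_ne_one h1
    exact (hCU this).1.2
  have hnear : ∀ᶠ y in 𝓝[≠] c, y ∈ e.target ∧ e.symm y ∉ K.cutLocus ∧ e.symm y ∉ (D : Set X) := by
    have h1 := (isOpen_target_inter e (K.isOpen_admissible (D := D) p e)).mem_nhds
      (show c ∈ _ from ⟨hct, by rw [mem_preimage, hp0]; exact K.mem_admissible hpe hpc⟩)
    filter_upwards [mem_nhdsWithin_of_mem_nhds h1, self_mem_nhdsWithin] with y hy hyc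
    refine ⟨hy.1, hy.2.1.2, fun h => hy.2.2 ⟨h, fun h' => hyc ?_⟩⟩
    rw [mem_singleton_iff] at h' ⊢
    rw [← e.right_inv hy.1, h']
  -- Near `c` the cutoff is one, so `extd ψ` is a multiple of the coefficient of `η` and inherits
  -- its integrability, although `ψ` may have a pole of high order.
  have hψη : (fun y => 2 * I * η.coeff e y) =ᶠ[𝓝[≠] c] extd ψ := by
    have h1 := (eventually_eventually_nhds.2 hψc).filter_mono (nhdsWithin_le_nhds (s := {c}ᶜ))
    filter_upwards [h1, hnear] with y h1 h2
    rw [extd_congr h1, K.extd_chartForm hu hφ hdec he h2.1 h2.2.1 h2.2.2]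
  have hloc : LocallyIntegrable (extd ψ) := by
    intro y
    by_cases hyc : y = c
    · subst hyc
      refine integrableAtFilter_congr_punctured ?_ hψη
      have h1 := TwoForm.locallyIntegrableOn_coeff hdec.1 he _ hct
      rw [e.open_target.nhdsWithin_eq hct] at h1
      obtain ⟨s, hs, hi⟩ := h1
      exact ⟨s, hs, hi.const_mul _⟩
    · have h2 : ContinuousOn (extd ψ) {c}ᶜ := by
        have h3 : ContinuousOn (fderiv ℝ ψ) {c}ᶜ :=
          ContDiffOn.continuousOn_fderiv_of_isOpen (n := 1)
            (fun w hw => (hsm w hw).contDiffWithinAt) isOpen_compl_singleton le_rfl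
        unfold extd
        fun_prop
      have h4 := h2.locallyIntegrableOn (μ := volume) (measurableSet_singleton c).compl y hyc
      rwa [isOpen_compl_singleton.nhdsWithin_eq hyc] at h4
  have hint : Integrable (extd ψ) :=
    (hloc.integrableOn_isCompact hCc').integrable_of_forall_notMem_eq_zero hex
  -- pull back to the disc
  set Ξ : ℂ → ℂ →L[ℝ] ℂ := fun z => χ (K.proj z) • K.cutForm u φ β z with hΞ
  -- `Ξ` is the pull-back of `ψ` by `e ∘ proj`, so the two exterior derivatives differ by the
  -- Jacobian and have the same integral.
  have hae : (fun z => ((fderiv ℝ (e ∘ K.proj) z).det : ℂ) * extd ψ (e (K.proj z)))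
      =ᵐ[volume.restrict (K.cutDomain e)] extd Ξ := by
    have a1 : ∀ᵐ z ∂volume.restrict (K.cutDomain e), K.proj z ∉ (D : Set X) :=
      ae_mono (Measure.restrict_mono_set _ inter_subset_left) (K.ae_proj_notMem D)
    filter_upwards [a1, ae_restrict_mem (K.isOpen_cutDomain e).measurableSet] with z hzD hz
    refine (extd_pullback (K.isOpen_cutDomain e) hz ((K.contDiffOn_chart he).of_le (by norm_cast))
      (hsm _ fun h => hzD ?_).differentiableAt_one ?_).2.symm
    · have h1 : K.proj z = p := e.injOn hz.2 hpe h
      rw [h1]; exact hpD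
    · filter_upwards [(K.isOpen_cutDomain_inter e).mem_nhds ⟨hz, hzD⟩] with w hw
      rw [hΞ]
      simp only
      rw [K.cutForm_eq hφ hdec.2.1 he hw.1 hw.2]
      have h2 : e (K.proj w) ∈ e.target := e.map_source hw.1.2
      simp only [hψ, Function.comp_apply, h2, if_true, e.left_inv hw.1.2]
      rfl
  have hzero : ∀ z ∈ ball (0 : ℂ) 1 \ K.cutDomain e, extd Ξ z = 0 := by
    intro z hz
    have h1 : Ξ =ᶠ[𝓝 z] fun _ => 0 := by
      filter_upwards [(K.isOpen_ball_inter hCc.isClosed.isOpen_compl).mem_nhds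
        ⟨hz.1, fun h => hz.2 ⟨hz.1, hCs h⟩⟩] with w hw
      simp only [hΞ]
      rw [hχ0 _ hw.2]
      exact real_zero_smul _
    rw [extd_congr h1]
    simp [extd]
  have hI := (K.integrableOn_image_cutDomain he hint.integrableOn).congr hae
  refine ⟨IntegrableOn.of_forall_sdiff_eq_zero hI measurableSet_ball hzero, ?_⟩
  have hE : ∫ z in ball 0 1, extd Ξ z = ∫ y, extd ψ y := by
    rw [setIntegral_eq_of_subset_of_forall_sdiff_eq_zero measurableSet_ball
        (show K.cutDomain e ⊆ _ from inter_subset_left) hzero, ← integral_congr_ae hae, ← K.integral_image_cutDomain he]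
    refine setIntegral_eq_integral_of_forall_compl_eq_zero fun y hy => hex y fun h => hy ?_
    obtain ⟨x, hx, rfl⟩ := h
    rw [K.image_cutDomain]
    refine ⟨e.map_source (hCs hx), ?_⟩
    rw [mem_preimage, e.left_inv (hCs hx)]
    exact (hCU hx).1.2
  rw [hE]
  refine (tendsto_circ_of_compactSupport hCc' hψ0
    (fun y hy => (hsm y hy).differentiableAt_one) hint).congr' ?_
  filter_upwards [eventually_sphere (hψc.filter_mono nhdsWithin_le_nhds), self_mem_nhdsWithin]
    with ε hε h0
  exact circ_congr (le_of_lt h0) hε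

/-- The residue of `u φ` at a pole, in a given coordinate. -/
theorem tendsto_circleIntegral_mul
    (hu : ∀ z ∈ closedBall (0 : ℂ) 1, HasFDerivWithinAt u (K.pull α z) (closedBall 0 1) z)
    (hφ : φ.IsMeromorphic) (hdec : (φ.wedge α).IsLogDecomposition η β) {p : X} (hpD : p ∈ D)
    (hpc : p ∉ K.cutLocus)
    {e : OpenPartialHomeomorph X ℂ} (he : e ∈ atlas ℂ X) (hpe : p ∈ e.source) {χ : X → ℝ}
    (hχ : IsCutoff χ p (K.admissible D p e)) :
    Tendsto (fun ε : ℝ => ∮ y in C(e p, ε), φ.dz e y * u (K.lift (e.symm y))) (𝓝[>] 0)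
      (𝓝 (-∫ z in ball 0 1, extd (fun z => χ (K.proj z) • K.cutForm u φ β z) z)) := by
  have h1 := (K.tendsto_circ_chartForm hu hφ hdec hpD he hpe hχ).2
  -- The circle integrals of the `β` part of `chartForm` tend to zero, so those of the part `u φ`
  -- have the same limit as those of the whole.
  obtain ⟨n, f, hf, hfe⟩ := (hdec.2.1 e he).2 p hpe hpD
  have h2 := tendsto_circ_dbar hf n
  have h3 := h1.sub h2
  rw [sub_zero] at h3
  refine h3.congr' ?_
  have hp0 : e.symm (e p) = p := e.left_inv hpe
  have hct : e p ∈ e.target := e.map_source hpe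
  have hnear : ∀ᶠ y in 𝓝[≠] (e p), ContinuousAt (K.chartForm u φ β e) y ∧
      ContinuousAt (β.dzbar e) y := by
    have h1 := (isOpen_target_inter e (K.isOpen_admissible (D := D) p e)).mem_nhds
      (show e p ∈ _ from ⟨hct, by rw [mem_preimage, hp0]; exact K.mem_admissible hpe hpc⟩)
    filter_upwards [mem_nhdsWithin_of_mem_nhds h1, self_mem_nhdsWithin] with y hy hyc
    have hyD : e.symm y ∉ (D : Set X) := by
      refine fun h => hy.2.2 ⟨h, fun h' => hyc ?_⟩
      rw [mem_singleton_iff] at h' ⊢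
      rw [← e.right_inv hy.1, h']
    exact ⟨(K.contDiffAt_chartForm hu he hy.1 hy.2.1.2 hyD).continuousAt,
      (β.contDiffAt_dzbar D.finite_toSet.isClosed he hy.1 hyD).continuousAt⟩
  filter_upwards [eventually_sphere hfe, eventually_sphere hnear, self_mem_nhdsWithin]
    with ε hε hcont h0
  have h0' : (0 : ℝ) ≤ ε := le_of_lt h0
  have hcm : ∀ θ, circleMap (e p) ε θ ∈ sphere (e p) ε := circleMap_mem_sphere _ h0'
  have hd : Continuous (deriv (circleMap (e p) ε)) := by
    have : deriv (circleMap (e p) ε) = fun θ => circleMap 0 ε θ * I := by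
      ext θ; exact deriv_circleMap _ _ _
    rw [this]; fun_prop
  have c1 : ContinuousOn (fun z => formL 0 (f z / (z - e p) ^ n)) (sphere (e p) ε) := by
    refine continuousOn_formL continuousOn_const ?_
    refine ContinuousOn.congr (f := β.dzbar e) (fun y hy => (hcont y hy).2.continuousWithinAt)
      fun y hy => (hε y hy).symm
  have c0 : ContinuousOn (K.chartForm u φ β e) (sphere (e p) ε) :=
    fun y hy => (hcont y hy).1.continuousWithinAt
  have i0 : Continuous fun θ => K.chartForm u φ β e (circleMap (e p) ε θ)
      (deriv (circleMap (e p) ε) θ) :=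
    (c0.comp_continuous (continuous_circleMap _ _) hcm).clm_apply hd
  have i1 : Continuous fun θ => formL 0 (f (circleMap (e p) ε θ) /
      (circleMap (e p) ε θ - e p) ^ n) (deriv (circleMap (e p) ε) θ) :=
    (c1.comp_continuous (continuous_circleMap _ _) hcm).clm_apply hd
  rw [circ, circ, ← intervalIntegral.integral_sub (i0.intervalIntegrable _ _)
    (i1.intervalIntegrable _ _), circleIntegral]
  congr 1
  ext θ
  rw [chartForm, hε _ (hcm θ), formL_apply, formL_apply, smul_eq_mul]
  ring

/-- The residue of `u φ` at a pole exists and does not depend on the coordinate. -/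
theorem exists_hasResidueMul
    (hu : ∀ z ∈ closedBall (0 : ℂ) 1, HasFDerivWithinAt u (K.pull α z) (closedBall 0 1) z)
    (hφ : φ.IsMeromorphic) (hdec : (φ.wedge α).IsLogDecomposition η β) {p : X} (hpD : p ∈ D)
    (hpc : p ∉ K.cutLocus) : ∃ r, φ.HasResidueMul (fun x => u (K.lift x)) p r := by
  have hmem := mem_chart_source ℂ p
  obtain ⟨χ₀, hχ₀⟩ := exists_isCutoff (K.isOpen_admissible (D := D) p (chartAt ℂ p))
    (K.mem_admissible hmem hpc)
  have h0 := K.tendsto_circleIntegral_mul hu hφ hdec hpD hpc (chart_mem_atlas ℂ p) hmem hχ₀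
  refine ⟨(2 * Real.pi * I)⁻¹ *
    (-∫ z in ball 0 1, extd (fun z => χ₀ (K.proj z) • K.cutForm u φ β z) z), fun e he hpe => ?_⟩
  -- With a cutoff supported in both coordinate domains, the two limits are the same integral over
  -- the disc, which mentions no coordinate.
  obtain ⟨χ, hχ⟩ := exists_isCutoff ((K.isOpen_admissible (D := D) p (chartAt ℂ p)).inter
    (K.isOpen_admissible (D := D) p e)) ⟨K.mem_admissible hmem hpc, K.mem_admissible hpe hpc⟩
  have h1 := K.tendsto_circleIntegral_mul hu hφ hdec hpD hpc (chart_mem_atlas ℂ p) hmem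
    (hχ.mono inter_subset_left)
  have h2 := K.tendsto_circleIntegral_mul hu hφ hdec hpD hpc he hpe (hχ.mono inter_subset_right)
  rw [tendsto_nhds_unique h0 h1]
  exact h2.const_mul _

/-- Stokes' theorem on the cut surface. -/
theorem integral_extd_cutForm [CompactSpace X] (hD : ∀ p ∈ D, p ∉ K.cutLocus)
    (hu : ∀ z ∈ closedBall (0 : ℂ) 1, HasFDerivWithinAt u (K.pull α z) (closedBall 0 1) z)
    (hφ : φ.IsMeromorphic) (hdec : (φ.wedge α).IsLogDecomposition η β) {R : X → ℂ}
    (hR : ∀ p ∈ D, φ.HasResidueMul (fun x => u (K.lift x)) p (R p)) :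
    ∫ z in ball 0 1, extd (K.cutForm u φ β) z =
      circ (K.cutForm u φ β) 0 1 - 2 * Real.pi * I * ∑ p ∈ D, R p := by
  classical
  have hex : ∀ p : X, ∃ χ : X → ℝ, p ∈ D → IsCutoff χ p (K.admissible D p (chartAt ℂ p)) := by
    intro p
    by_cases hp : p ∈ D
    · obtain ⟨χ, hχ⟩ := exists_isCutoff (K.isOpen_admissible (D := D) p (chartAt ℂ p))
        (K.mem_admissible (mem_chart_source ℂ p) (hD p hp))
      exact ⟨χ, fun _ => hχ⟩
    · exact ⟨0, fun h => absurd h hp⟩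
  choose χ hχ using hex
  set Θ := K.cutForm u φ β with hΘ
  set Ξ : X → ℂ → ℂ →L[ℝ] ℂ := fun p z => χ p (K.proj z) • Θ z with hΞ
  have hRint : ∀ p ∈ D, ∫ z in ball 0 1, extd (Ξ p) z = -(2 * Real.pi * I * R p) := by
    intro p hp
    have h1 := K.tendsto_circleIntegral_mul hu hφ hdec hp (hD p hp) (chart_mem_atlas ℂ p)
      (mem_chart_source ℂ p) (hχ p hp)
    have h2 := hR p hp _ (chart_mem_atlas ℂ p) (mem_chart_source ℂ p)
    have h3 := tendsto_nhds_unique (h1.const_mul (2 * Real.pi * I)⁻¹) h2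
    have hpi : (2 * Real.pi * I : ℂ) ≠ 0 := by simp [Real.pi_ne_zero]
    rw [← h3]
    field_simp
    simp [Ξ, hΘ]
  have hint : ∀ p ∈ D, IntegrableOn (extd (Ξ p)) (ball 0 1) := fun p hp =>
    (K.tendsto_circ_chartForm hu hφ hdec hp (chart_mem_atlas ℂ p) (mem_chart_source ℂ p)
      (hχ p hp)).1
  have hintΘ := (K.hasIntegral_neg_integral_extd hu hφ hdec).1
  -- the regular part
  set Λ : ℂ → ℂ →L[ℝ] ℂ := fun z => Θ z - ∑ p ∈ D, Ξ p z with hΛ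
  have hΛ' : ∀ z, Λ z = (1 - ∑ p ∈ D, χ p (K.proj z)) • Θ z := by
    intro z
    simp only [hΛ, hΞ, ← Finset.sum_smul]
    exact ((sub_smul (1 : ℝ) _ _).trans (congrArg₂ _ (one_smul ℝ _) rfl)).symm
  have hdiff : ∀ z ∈ ball (0 : ℂ) 1, K.proj z ∉ (D : Set X) → DifferentiableAt ℝ Θ z ∧
      (∀ p ∈ D, DifferentiableAt ℝ (Ξ p) z) := by
    intro z hz hzD
    have h1 := (K.extd_cutForm hu hφ hdec (chart_mem_atlas ℂ (K.proj z))
      ⟨hz, mem_chart_source ℂ _⟩ hzD).1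
    exact ⟨h1, fun p hp => (K.differentiableAt_cutoff_proj (hχ p hp) hz).smul h1⟩
  -- The support of each cutoff avoids the other poles, so near a pole their sum is exactly one and
  -- the regular part vanishes identically.
  have hone : ∀ p ∈ D, ∀ᶠ x in 𝓝 p, 1 - ∑ q ∈ D, χ q x = 0 := by
    intro p hp
    have h1 : ∀ᶠ x in 𝓝 p, ∀ q ∈ D, χ q x = if q = p then 1 else 0 := by
      rw [Filter.eventually_all_finset]
      intro q hq
      by_cases hqp : q = p
      · subst hqp
        simpa using (hχ q hq).eventually_eq
      · obtain ⟨C, hC, hCU, h0⟩ := (hχ q hq).exists_compact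
        have hpC : p ∉ C := fun h => (hCU h).2 ⟨hp, fun h => hqp (mem_singleton_iff.1 h).symm⟩
        filter_upwards [hC.isClosed.isOpen_compl.mem_nhds hpC] with x hx
        rw [if_neg hqp, h0 x hx]
    filter_upwards [h1] with x hx
    rw [Finset.sum_congr rfl hx]
    simp [hp]
  have hΛ0 : ∀ z ∈ closedBall (0 : ℂ) 1, K.proj z ∈ (D : Set X) →
      Λ =ᶠ[𝓝[closedBall 0 1] z] fun _ => 0 := by
    intro z hz hzD
    filter_upwards [(K.continuousOn_proj z hz).eventually (hone _ hzD)] with w hw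
    rw [hΛ', hw]
    exact real_zero_smul _
  have hmemD : ∀ z ∈ ball (0 : ℂ) 1, closedBall (0 : ℂ) 1 ∈ 𝓝 z := fun z hz =>
    mem_of_superset (isOpen_ball.mem_nhds hz) ball_subset_closedBall
  have hΛd : ∀ z ∈ ball (0 : ℂ) 1, DifferentiableAt ℝ Λ z := by
    intro z hz
    by_cases hzD : K.proj z ∈ (D : Set X)
    · have h1 := hΛ0 z (ball_subset_closedBall hz) hzD
      rw [nhdsWithin_eq_nhds.2 (hmemD z hz)] at h1
      exact (differentiableAt_const _).congr_of_eventuallyEq h1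
    · obtain ⟨h1, h2⟩ := hdiff z hz hzD
      exact h1.sub (DifferentiableAt.fun_sum h2)
  have hχc : ∀ p ∈ D, ContinuousOn (fun z => χ p (K.proj z)) (closedBall 0 1) := by
    intro p hp z hz
    set e := chartAt ℂ (K.proj z) with he
    have hs : K.proj z ∈ e.source := mem_chart_source ℂ _
    have h1 := ((hχ p hp).contDiffAt (chart_mem_atlas ℂ (K.proj z)) (e.map_source hs)).continuousAt
    have h2 := (K.contDiffWithinAt_chart (chart_mem_atlas ℂ (K.proj z)) hz hs).continuousWithinAt
    refine (ContinuousAt.comp_continuousWithinAt (g := χ p ∘ e.symm) (f := e ∘ K.proj) h1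
      h2).congr_of_eventuallyEq ?_ (by simp [e.left_inv hs])
    filter_upwards [(K.continuousOn_proj z hz).eventually (e.open_source.mem_nhds hs)] with w hw
    simp [e.left_inv hw]
  have hΛc : ContinuousOn Λ (closedBall 0 1) := by
    intro z hz
    by_cases hzD : K.proj z ∈ (D : Set X)
    · have h1 := hΛ0 z hz hzD
      exact continuousWithinAt_const.congr_of_eventuallyEq h1 (h1.self_of_nhdsWithin hz)
    · have h1 : ContinuousWithinAt Θ (closedBall 0 1) z := K.continuousOn_cutForm hu hz hzD
      refine h1.sub (tendsto_finsetSum D fun p hp => ?_)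
      exact (hχc p hp z hz).smul h1
  have hΛe : extd Λ =ᵐ[volume.restrict (ball (0 : ℂ) 1)]
      fun z => extd Θ z - ∑ p ∈ D, extd (Ξ p) z := by
    filter_upwards [K.ae_proj_notMem D, ae_restrict_mem measurableSet_ball] with z hzD hz
    obtain ⟨h1, h2⟩ := hdiff z hz hzD
    rw [extd_sub h1 (DifferentiableAt.fun_sum h2), extd_sum D h2]
  have hsumi : IntegrableOn (fun z => ∑ p ∈ D, extd (Ξ p) z) (ball 0 1) :=
    integrable_finsetSum D hint
  have hΛi : IntegrableOn (extd Λ) (ball 0 1) := (hintΘ.sub hsumi).congr hΛe.symm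
  -- Inner radius zero: the annulus is the punctured disc and the inner circle contributes nothing.
  have hst := integral_extd_annulus (σ := Λ) (c := 0) le_rfl zero_le_one
    (hΛc.mono sdiff_subset) (fun z hz => hΛd z hz.1) (hΛi.mono_set sdiff_subset)
  have hc0 : circ Λ 0 0 = 0 := by simp [circ]
  -- The cutoffs vanish on the cut locus, hence on the boundary circle.
  have hc1 : circ Λ 0 1 = circ Θ 0 1 := by
    refine circ_congr zero_le_one fun z hz => ?_
    have : ∀ p ∈ D, χ p (K.proj z) = 0 := by
      intro p hp
      obtain ⟨C, hC, hCU, h0⟩ := (hχ p hp).exists_compact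
      exact h0 _ fun h => (hCU h).1.2 ⟨z, hz, rfl⟩
    rw [hΛ', Finset.sum_eq_zero this, sub_zero, one_smul]
  have hball : (ball (0 : ℂ) 1 \ closedBall 0 0 : Set ℂ) =ᵐ[volume] ball (0 : ℂ) 1 := by
    rw [closedBall_zero]
    exact sdiff_null_ae_eq_self (by simp)
  rw [setIntegral_congr_set hball, integral_congr_ae hΛe, integral_sub hintΘ hsumi,
    integral_finsetSum D hint, Finset.sum_congr rfl hRint, hc0, hc1, sub_zero] at hst
  rw [Finset.sum_neg_distrib, ← Finset.mul_sum] at hst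
  linear_combination hst

end CanonicalDissection

/-! ### Existence of logarithmic decompositions -/

theorem contDiffAt_conj {E : Type*} [NormedAddCommGroup E] [NormedSpace ℝ E] {f : E → ℂ} {z : E}
    {n : ℕ∞ω} (hf : ContDiffAt ℝ n f z) : ContDiffAt ℝ n (fun w => starRingEnd ℂ (f w)) z :=
  (conjCLE : ℂ →L[ℝ] ℂ).contDiff.contDiffAt.comp z hf

theorem contDiffAt_real_div {f h : ℂ → ℂ} {z : ℂ} {n : ℕ∞ω} (hf : ContDiffAt ℝ n f z)
    (hh : ContDiffAt ℝ n h z) (h0 : h z ≠ 0) : ContDiffAt ℝ n (fun w => f w / h w) z := by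
  simp only [div_eq_mul_inv]
  exact hf.mul (hh.inv h0)

/-- The conjugate of `w'` is antiholomorphic and is killed by `∂`, so only `b` is differentiated.
This says that `∂` of a `(0,1)`-form does not depend on the coordinate. -/
theorem wirtingerD_pullback {b w : ℂ → ℂ} {z : ℂ} (hb : DifferentiableAt ℝ b (w z))
    (hw : AnalyticAt ℂ w z) :
    wirtingerD (fun y => b (w y) * starRingEnd ℂ (deriv w y)) z =
      wirtingerD b (w z) * (deriv w z * starRingEnd ℂ (deriv w z)) := by
  have h1 : HasFDerivAt (fun y => b (w y)) ((fderiv ℝ b (w z)).comp (fderiv ℝ w z)) z :=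
    hb.hasFDerivAt.comp z (hw.differentiableAt.restrictScalars ℝ).hasFDerivAt
  have h2 : HasFDerivAt (fun y => starRingEnd ℂ (deriv w y))
      ((conjCLE : ℂ →L[ℝ] ℂ).comp (fderiv ℝ (deriv w) z)) z :=
    (conjCLE : ℂ →L[ℝ] ℂ).hasFDerivAt.comp z
      (hw.deriv.differentiableAt.restrictScalars ℝ).hasFDerivAt
  have h3 := (h1.fun_mul h2).fderiv
  conv_lhs => rw [wirtingerD]
  rw [h3]
  simp [fderiv_real_of_holomorphic hw.differentiableAt,
    fderiv_real_of_holomorphic hw.deriv.differentiableAt, fderiv_apply_eq_wirtinger b]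
  ring_nf
  simp
  ring

/-- The quotient of a holomorphic coordinate by another one is a nonvanishing function. -/
theorem exists_eq_mul_of_deriv_ne_zero {w : ℂ → ℂ} {a : ℂ} (hw : AnalyticAt ℂ w a)
    (h0 : deriv w a ≠ 0) :
    ∃ d : ℂ → ℂ, ContDiffAt ℝ ∞ d a ∧ d a ≠ 0 ∧ ∀ z, w z - w a = (z - a) * d z := by
  refine ⟨dslope w a, ?_, by rwa [dslope_same], fun z => ?_⟩
  · obtain ⟨s, hs, hws⟩ := hw.eventually_analyticAt.exists_mem
    obtain ⟨t, hts, hto, hat⟩ := _root_.mem_nhds_iff.1 hs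
    have h1 : DifferentiableOn ℂ w t := fun z hz =>
      (hws z (hts hz)).differentiableAt.differentiableWithinAt
    have h2 := (Complex.differentiableOn_dslope (hto.mem_nhds hat)).2 h1
    exact ((h2.analyticAt (hto.mem_nhds hat)).contDiffAt.restrict_scalars ℝ)
  · simpa using (sub_smul_dslope w a z).symm

theorem analyticAt_transition [IsManifold 𝓘(ℂ, ℂ) ω X] {e e' : OpenPartialHomeomorph X ℂ}
    (he : e ∈ atlas ℂ X) (he' : e' ∈ atlas ℂ X) {y : ℂ} (hy : y ∈ e.target)
    (hy' : e.symm y ∈ e'.source) : AnalyticAt ℂ (e' ∘ e.symm) y :=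
  (contDiffAt_transition he he' hy hy').analyticAt

theorem deriv_transition_comp [IsManifold 𝓘(ℂ, ℂ) ω X] {e e' e'' : OpenPartialHomeomorph X ℂ}
    (he : e ∈ atlas ℂ X) (he' : e' ∈ atlas ℂ X) (he'' : e'' ∈ atlas ℂ X) {x : X}
    (hx : x ∈ e.source) (hx' : x ∈ e'.source) (hx'' : x ∈ e''.source) :
    deriv (e'' ∘ e.symm) (e x) =
      deriv (e'' ∘ e'.symm) (e' x) * deriv (e' ∘ e.symm) (e x) := by
  have hl := e.left_inv hx
  have h1 : DifferentiableAt ℂ (e' ∘ e.symm) (e x) :=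
    differentiableAt_transition he he' (e.map_source hx) (by rwa [hl])
  have h2 : DifferentiableAt ℂ (e'' ∘ e'.symm) ((e' ∘ e.symm) (e x)) := by
    rw [Function.comp_apply, hl]
    exact differentiableAt_transition he' he'' (e'.map_source hx') (by rwa [e'.left_inv hx'])
  have h3 := deriv_comp (e x) h2 h1
  rw [Function.comp_apply, hl] at h3
  rw [← h3]
  refine EventuallyEq.deriv_eq ?_
  filter_upwards [(isOpen_target_inter e e'.open_source).mem_nhds
    ⟨e.map_source hx, by rwa [mem_preimage, hl]⟩] with y hy
  simp [e'.left_inv hy.2]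

theorem deriv_transition_ne_zero [IsManifold 𝓘(ℂ, ℂ) ω X] {e e' : OpenPartialHomeomorph X ℂ}
    (he : e ∈ atlas ℂ X) (he' : e' ∈ atlas ℂ X) {x : X}
    (hx : x ∈ e.source) (hx' : x ∈ e'.source) : deriv (e' ∘ e.symm) (e x) ≠ 0 := by
  intro h
  have h1 := deriv_transition_comp he he' he hx hx' hx
  rw [h, mul_zero] at h1
  have h2 : (e ∘ e.symm) =ᶠ[𝓝 (e x)] id := by
    filter_upwards [e.open_target.mem_nhds (e.map_source hx)] with y hy
    simp [e.right_inv hy]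
  rw [h2.deriv_eq, deriv_id] at h1
  exact one_ne_zero h1

/-- The coefficient, in the coordinate `e`, of the `(0,1)`-form which is `χ B dz̄` in the coordinate
`e₀`. -/
noncomputable def transported (e₀ : OpenPartialHomeomorph X ℂ) (χ : X → ℝ) (B : ℂ → ℂ)
    (e : OpenPartialHomeomorph X ℂ) (z : ℂ) : ℂ :=
  open Classical in
  if e.symm z ∈ e₀.source then
    (χ (e.symm z) : ℂ) * B (e₀ (e.symm z)) * starRingEnd ℂ (deriv (e₀ ∘ e.symm) z)
  else 0

section Transported

variable [IsManifold 𝓘(ℂ, ℂ) ω X] {e₀ e e' : OpenPartialHomeomorph X ℂ} {χ : X → ℝ} {B : ℂ → ℂ}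

theorem transported_compat (he₀ : e₀ ∈ atlas ℂ X) (he : e ∈ atlas ℂ X) (he' : e' ∈ atlas ℂ X)
    {x : X} (hx : x ∈ e.source) (hx' : x ∈ e'.source) :
    transported e₀ χ B e (e x) =
      transported e₀ χ B e' (e' x) * starRingEnd ℂ (deriv (e' ∘ e.symm) (e x)) := by
  by_cases h : x ∈ e₀.source
  · simp only [transported, e.left_inv hx, e'.left_inv hx', h, if_true]
    rw [deriv_transition_comp he he' he₀ hx hx' h, map_mul]
    ring
  · simp [transported, e.left_inv hx, e'.left_inv hx', h]

omit [ChartedSpace ℂ X] [IsManifold 𝓘(ℂ, ℂ) ω X] in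
theorem transported_eventually_zero {C : Set X} (hC : _root_.IsClosed C) (h0 : ∀ x ∉ C, χ x = 0)
    {z : ℂ} (hz : z ∈ e.target) (hzC : e.symm z ∉ C) :
    transported e₀ χ B e =ᶠ[𝓝 z] fun _ => 0 := by
  filter_upwards [(e.symm.continuousAt hz).eventually (hC.isOpen_compl.mem_nhds hzC)] with w hw
  have : χ (e.symm w) = 0 := h0 _ hw
  simp [transported, this]

theorem contDiffAt_transported (he₀ : e₀ ∈ atlas ℂ X) (he : e ∈ atlas ℂ X) {p : X} {U : Set X}
    (hχ : IsCutoff χ p U) {z : ℂ} (hz : z ∈ e.target) (hze : e.symm z ∈ e₀.source)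
    (hB : ContDiffAt ℝ ∞ B (e₀ (e.symm z))) : ContDiffAt ℝ ∞ (transported e₀ χ B e) z := by
  have hw := analyticAt_transition he he₀ hz hze
  have h1 : ContDiffAt ℝ ∞ (fun y => (χ (e.symm y) : ℂ)) z :=
    Complex.ofRealCLM.contDiff.contDiffAt.comp z (hχ.contDiffAt he hz)
  have h2 : ContDiffAt ℝ ∞ (fun y => B ((e₀ ∘ e.symm) y)) z :=
    ContDiffAt.comp z (g := B) hB (contDiffAt_transition_real he he₀ hz hze)
  have h3 : ContDiffAt ℝ ∞ (fun y => starRingEnd ℂ (deriv (e₀ ∘ e.symm) y)) z :=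
    contDiffAt_conj (hw.deriv.contDiffAt.restrict_scalars ℝ)
  refine ((h1.mul h2).mul h3).congr_of_eventuallyEq ?_
  filter_upwards [(e.symm.continuousAt hz).eventually (e₀.open_source.mem_nhds hze)] with y hy
  have hy : e.symm y ∈ e₀.source := hy
  simp [transported, hy]

omit [ChartedSpace ℂ X] [IsManifold 𝓘(ℂ, ℂ) ω X] in
theorem transported_eventuallyEq {z : ℂ} (hχ : ∀ᶠ x in 𝓝 (e.symm z), χ x = 1) (hz : z ∈ e.target)
    (hze : e.symm z ∈ e₀.source) : transported e₀ χ B e =ᶠ[𝓝 z]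
      fun y => B ((e₀ ∘ e.symm) y) * starRingEnd ℂ (deriv (e₀ ∘ e.symm) y) := by
  filter_upwards [(e.symm.continuousAt hz).eventually (e₀.open_source.mem_nhds hze),
    (e.symm.continuousAt hz).eventually hχ] with y hy h1
  have hy : e.symm y ∈ e₀.source := hy
  simp [transported, hy, h1]

end Transported

/-- A local solution of `Ω = ∂(F z⁻ⁿ dz̄) + (G / z) dz ∧ dz̄` near a pole. -/
theorem exists_local_decomposition {D : Finset X} [T2Space X] {φ : OneForm X (D : Set X)}
    (hφ : φ.IsMeromorphic) (α : OneForm X (∅ : Set X)) {e : OpenPartialHomeomorph X ℂ}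
    (he : e ∈ atlas ℂ X) {p : X} (hp : p ∈ e.source) (hpD : p ∈ D) :
    ∃ (n : ℕ) (F G : ℂ → ℂ) (s : Set ℂ), IsOpen s ∧ e p ∈ s ∧ s ⊆ e.target ∧
      (∀ z ∈ s, ContDiffAt ℝ ∞ F z) ∧ (∀ z ∈ s, ContDiffAt ℝ ∞ G z) ∧
      (∀ z ∈ s, z ≠ e p → e.symm z ∉ (D : Set X)) ∧
      ∀ z ∈ s, z ≠ e p → (φ.wedge α).coeff e z =
        wirtingerD (fun w => F w / (w - e p) ^ n) z + G z / (z - e p) := by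
  obtain ⟨n, hn⟩ := (hφ e he).2.2 p hp hpD
  obtain ⟨t, ht, hta⟩ := hn.eventually_analyticAt.exists_mem
  obtain ⟨t', htt, hto, htp⟩ := _root_.mem_nhds_iff.1 ht
  set s := t' ∩ (e.target ∩ e.symm ⁻¹' ((D : Set X) \ {p})ᶜ) with hs
  have hso : IsOpen s := hto.inter (isOpen_target_inter e
    (D.finite_toSet.subset sdiff_subset).isClosed.isOpen_compl)
  have hsp : e p ∈ s := ⟨htp, e.map_source hp, by simp [e.left_inv hp]⟩
  have hsD : ∀ z ∈ s, z ≠ e p → e.symm z ∉ (D : Set X) := by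
    intro z hz hzp h
    refine hz.2.2 ⟨h, fun h' => hzp ?_⟩
    rw [← mem_singleton_iff.1 h', e.right_inv hz.2.1]
  -- Meromorphy makes `(z - e p)^n φ` analytic on `s`, including at the pole, so the numerator of `φ
  -- ∧ α` is smooth there.
  obtain ⟨F, G, hF, hG, h⟩ := exists_pole_reduction s (e p) n
    (fun z => ((z - e p) ^ n • φ.dz e z) * α.dzbar e z) (fun z hz =>
      ((hta z (htt hz.1)).contDiffAt.restrict_scalars ℝ).mul
        (α.contDiffAt_dzbar isClosed_empty he hz.2.1 (notMem_empty _)))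
  refine ⟨n, F, G, s, hso, hsp, fun z hz => hz.2.1, hF, hG, hsD, fun z hz hzp => ?_⟩
  rw [← h z hz hzp]
  have h3 : (φ.wedge α).coeff e z = φ.dz e z * α.dzbar e z - φ.dzbar e z * α.dz e z := rfl
  have hz0 : z - e p ≠ 0 := sub_ne_zero.2 hzp
  rw [h3, (hφ e he).1 z hz.2.1 (hsD z hz hzp), smul_eq_mul]
  field_simp
  ring

/-- The local solutions at the poles, multiplied by cutoffs, add up to a global `β`, and `η` is
defined as `φ ∧ α - ∂β`. It is logarithmic since near each pole a single cutoff is active and equal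
to one. The definitions of both spaces quantify over all coordinates, so the form of the singularity
is then carried from the preferred chart to any other. -/
theorem exists_logDecomposition [IsManifold 𝓘(ℂ, ℂ) ω X] {D : Finset X} [T2Space X]
    {φ : OneForm X (D : Set X)} (hφ : φ.IsMeromorphic) (α : OneForm X (∅ : Set X)) :
    ∃ (η : TwoForm X (D : Set X)) (β : OneForm X (D : Set X)),
      (φ.wedge α).IsLogDecomposition η β := by
  classical
  have hDc : _root_.IsClosed (D : Set X) := D.finite_toSet.isClosed
  have hloc := fun (p : X) (hp : p ∈ D) =>
    exists_local_decomposition hφ α (chart_mem_atlas ℂ p) (mem_chart_source ℂ p) hp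
  have hloc' : ∀ p : X, ∃ (n : ℕ) (F G : ℂ → ℂ) (s : Set ℂ), p ∈ D →
      IsOpen s ∧ chartAt ℂ p p ∈ s ∧ s ⊆ (chartAt ℂ p).target ∧
      (∀ z ∈ s, ContDiffAt ℝ ∞ F z) ∧ (∀ z ∈ s, ContDiffAt ℝ ∞ G z) ∧
      (∀ z ∈ s, z ≠ chartAt ℂ p p → (chartAt ℂ p).symm z ∉ (D : Set X)) ∧
      ∀ z ∈ s, z ≠ chartAt ℂ p p → (φ.wedge α).coeff (chartAt ℂ p) z =
        wirtingerD (fun w => F w / (w - chartAt ℂ p p) ^ n) z + G z / (z - chartAt ℂ p p) := by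
    intro p
    by_cases hp : p ∈ D
    · obtain ⟨n, F, G, s, h⟩ := hloc p hp
      exact ⟨n, F, G, s, fun _ => h⟩
    · exact ⟨0, 0, 0, ∅, fun h => absurd h hp⟩
  choose n F G s hs using hloc'
  set U : X → Set X := fun p => (chartAt ℂ p).source ∩ chartAt ℂ p ⁻¹' s p with hU
  have hcut : ∀ p : X, ∃ χ : X → ℝ, p ∈ D → IsCutoff χ p (U p) := by
    intro p
    by_cases hp : p ∈ D
    · obtain ⟨χ, hχ⟩ := exists_isCutoff
        ((chartAt ℂ p).isOpen_inter_preimage (hs p hp).1)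
        (show p ∈ U p from ⟨mem_chart_source ℂ p, (hs p hp).2.1⟩)
      exact ⟨χ, fun _ => hχ⟩
    · exact ⟨0, fun h => absurd h hp⟩
  choose χ hχ using hcut
  set B : X → ℂ → ℂ := fun p w => F p w / (w - chartAt ℂ p p) ^ n p with hB
  have hBs : ∀ p ∈ D, ∀ y ∈ s p, y ≠ chartAt ℂ p p → ContDiffAt ℝ ∞ (B p) y := by
    intro p hp y hy hyp
    have : ContDiffAt ℝ ∞ (fun w : ℂ => (w - chartAt ℂ p p) ^ n p) y := by fun_prop
    exact contDiffAt_real_div ((hs p hp).2.2.2.1 y hy) this (pow_ne_zero _ (sub_ne_zero.2 hyp))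
  set b : X → OpenPartialHomeomorph X ℂ → ℂ → ℂ := fun p =>
    transported (chartAt ℂ p) (χ p) (B p) with hb
  have hbs : ∀ p ∈ D, ∀ e ∈ atlas ℂ X, ∀ z ∈ e.target, e.symm z ∉ (D : Set X) →
      ContDiffAt ℝ ∞ (b p e) z := by
    intro p hp e he z hz hzD
    obtain ⟨C, hC, hCU, h0⟩ := (hχ p hp).exists_compact
    by_cases hzC : e.symm z ∈ C
    · refine contDiffAt_transported (chart_mem_atlas ℂ p) he (hχ p hp) hz (hCU hzC).1
        (hBs p hp _ (hCU hzC).2 fun h => hzD ?_)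
      rw [(chartAt ℂ p).injOn (hCU hzC).1 (mem_chart_source ℂ p) h]
      exact hp
    · exact contDiffAt_const.congr_of_eventuallyEq
        (transported_eventually_zero hC.isClosed h0 hz hzC)
  let β : OneForm X (D : Set X) :=
    { dz := fun _ _ => 0
      dzbar := fun e z => ∑ p ∈ D, b p e z
      smooth_dz := fun e he => contDiffOn_const
      smooth_dzbar := fun e he z hz =>
        (ContDiffAt.sum fun p hp => hbs p hp e he z hz.1 hz.2).contDiffWithinAt
      compat_dz := fun e _ e' _ x _ _ => by simp
      compat_dzbar := fun e he e' he' x hx _ => by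
        rw [Finset.sum_mul]
        exact Finset.sum_congr rfl fun p _ =>
          transported_compat (chart_mem_atlas ℂ p) he he' hx.1 hx.2 }
  have hβs : ∀ e ∈ atlas ℂ X, ∀ z ∈ e.target, e.symm z ∉ (D : Set X) →
      ContDiffAt ℝ ∞ (β.dzbar e) z := fun e he z hz hzD => β.contDiffAt_dzbar hDc he hz hzD
  have hΩs : ∀ e ∈ atlas ℂ X, ∀ z ∈ e.target, e.symm z ∉ (D : Set X) →
      ContDiffAt ℝ ∞ ((φ.wedge α).coeff e) z := fun e he z hz hzD =>
    ((φ.wedge α).smooth e he).contDiffAt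
      ((isOpen_target_inter e hDc.isOpen_compl).mem_nhds ⟨hz, hzD⟩)
  let η : TwoForm X (D : Set X) :=
    { coeff := fun e z => (φ.wedge α).coeff e z - wirtingerD (β.dzbar e) z
      smooth := fun e he z hz => ((hΩs e he z hz.1 hz.2).sub
        (contDiffAt_wirtingerD (hβs e he z hz.1 hz.2))).contDiffWithinAt
      compat := fun e he e' he' x hx hxD => by
        have hl := e.left_inv hx.1
        have hw := analyticAt_transition he he' (e.map_source hx.1) (by rw [hl]; exact hx.2)
        have h1 : β.dzbar e =ᶠ[𝓝 (e x)] fun y => β.dzbar e' ((e' ∘ e.symm) y) *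
            starRingEnd ℂ (deriv (e' ∘ e.symm) y) := by
          filter_upwards [(isOpen_target_inter e (e'.open_source.inter hDc.isOpen_compl)).mem_nhds
            ⟨e.map_source hx.1, by rw [mem_preimage, hl]; exact ⟨hx.2, hxD⟩⟩] with y hy
          have := β.compat_dzbar e he e' he' (e.symm y) ⟨e.map_target hy.1, hy.2.1⟩ hy.2.2
          rw [e.right_inv hy.1] at this
          exact this
        have h2 := wirtingerD_pullback (b := β.dzbar e') (w := e' ∘ e.symm) (z := e x) (by
          rw [Function.comp_apply, hl]
          exact (hβs e' he' _ (e'.map_source hx.2) (by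
            rwa [e'.left_inv hx.2])).differentiableAt (by simp)) hw
        rw [wirtingerD_congr h1, h2, (φ.wedge α).compat e he e' he' x hx hxD, Function.comp_apply,
          hl]
        ring }
  -- near a pole only one term contributes
  have hnear : ∀ e ∈ atlas ℂ X, ∀ q ∈ e.source, q ∈ D → β.dzbar e =ᶠ[𝓝 (e q)]
      fun y => B q ((chartAt ℂ q ∘ e.symm) y) *
        starRingEnd ℂ (deriv (chartAt ℂ q ∘ e.symm) y) := by
    intro e he q hq hqD
    have hl := e.left_inv hq
    have hqt := e.map_source hq
    have h1 : ∀ᶠ y in 𝓝 (e q), ∀ p ∈ D, p ≠ q → b p e y = 0 := by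
      rw [Filter.eventually_all_finset]
      intro p hp
      by_cases hpq : p = q
      · exact Eventually.of_forall fun y h => absurd hpq h
      · obtain ⟨C, hC, hCU, h0⟩ := (hχ p hp).exists_compact
        have hqC : q ∉ C := by
          intro h
          have h2 := (hs p hp).2.2.2.2.2.1 _ (hCU h).2 (fun h3 => hpq
            ((chartAt ℂ p).injOn (hCU h).1 (mem_chart_source ℂ p) h3).symm)
          rw [(chartAt ℂ p).left_inv (hCU h).1] at h2
          exact h2 hqD
        filter_upwards [transported_eventually_zero (e₀ := chartAt ℂ p) (B := B p) hC.isClosed h0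
          hqt (by rwa [hl])] with y hy _
        exact hy
    have h2 := transported_eventuallyEq (e₀ := chartAt ℂ q) (e := e) (χ := χ q) (B := B q)
      (z := e q) (by rw [hl]; exact (hχ q hqD).eventually_eq) hqt
      (by rw [hl]; exact mem_chart_source ℂ q)
    filter_upwards [h1, h2] with y h1 h2
    rw [← h2]
    exact Finset.sum_eq_single_of_mem q hqD fun p hp hpq => h1 p hp hpq
  -- the change of coordinates to the preferred chart at a pole
  have hchange : ∀ e ∈ atlas ℂ X, ∀ q ∈ e.source, q ∈ D → ∃ d : ℂ → ℂ, ContDiffAt ℝ ∞ d (e q) ∧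
      d (e q) ≠ 0 ∧ ∀ z, (chartAt ℂ q ∘ e.symm) z - chartAt ℂ q q = (z - e q) * d z := by
    intro e he q hq hqD
    have hl := e.left_inv hq
    have hw := analyticAt_transition he (chart_mem_atlas ℂ q) (e.map_source hq)
      (by rw [hl]; exact mem_chart_source ℂ q)
    obtain ⟨d, h1, h2, h3⟩ := exists_eq_mul_of_deriv_ne_zero hw
      (deriv_transition_ne_zero he (chart_mem_atlas ℂ q) hq (mem_chart_source ℂ q))
    refine ⟨d, h1, h2, fun z => ?_⟩
    rw [← h3, Function.comp_apply (x := e q), hl]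
  refine ⟨η, β, ?_, ?_, fun e he z hz hzD => (sub_add_cancel _ _).symm⟩
  · intro e he q hq hqD
    obtain ⟨d, hd, hd0, hde⟩ := hchange e he q hq hqD
    have hl := e.left_inv hq
    have hqs : e.symm (e q) ∈ (chartAt ℂ q).source := by rw [hl]; exact mem_chart_source ℂ q
    have hwa := analyticAt_transition he (chart_mem_atlas ℂ q) (e.map_source hq) hqs
    set w := chartAt ℂ q ∘ e.symm with hw
    have hwq : w (e q) = chartAt ℂ q q := by rw [hw, Function.comp_apply, hl]
    have hdw : ContDiffAt ℝ ∞ (deriv w) (e q) := hwa.deriv.contDiffAt.restrict_scalars ℝ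
    -- With `w z - w (e q) = (z - e q) d z`, the form `G / (w - w (e q)) dw ∧ dw̄` acquires the
    -- factor `|w'|²` and the unit `d` in the denominator.
    refine ⟨fun z => G q (w z) * (deriv w z * starRingEnd ℂ (deriv w z)) / d z, ?_, ?_⟩
    · refine contDiffAt_real_div (ContDiffAt.mul ?_ (hdw.mul (contDiffAt_conj hdw))) hd hd0
      refine ContDiffAt.comp (e q) (g := G q) ?_
        (contDiffAt_transition_real he (chart_mem_atlas ℂ q) (e.map_source hq) hqs)
      rw [hwq]
      exact (hs q hqD).2.2.2.2.1 _ (hs q hqD).2.1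
    · have h1 : ∀ᶠ z in 𝓝 (e q), w z ∈ s q := by
        have := hwa.continuousAt
        refine this.eventually ((hs q hqD).1.mem_nhds ?_)
        rw [hwq]; exact (hs q hqD).2.1
      have h2 : ∀ᶠ z in 𝓝 (e q), z ∈ e.target ∧ e.symm z ∈ (chartAt ℂ q).source :=
        (isOpen_target_inter e (chartAt ℂ q).open_source).mem_nhds ⟨e.map_source hq, hqs⟩
      have h3 := eventually_eventually_nhds.2 (hnear e he q hq hqD)
      have h4 : ∀ᶠ z in 𝓝 (e q), d z ≠ 0 := hd.continuousAt.eventually_ne hd0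
      filter_upwards [h1.filter_mono nhdsWithin_le_nhds, h2.filter_mono nhdsWithin_le_nhds,
        h3.filter_mono nhdsWithin_le_nhds, h4.filter_mono nhdsWithin_le_nhds,
        self_mem_nhdsWithin] with z h1 h2 h3 h4 hz
      have hz0 : z - e q ≠ 0 := sub_ne_zero.2 hz
      have hwz : w z ≠ chartAt ℂ q q := by
        rw [← sub_ne_zero, hde]
        exact mul_ne_zero hz0 h4
      have hwan := analyticAt_transition he (chart_mem_atlas ℂ q) h2.1 h2.2
      have hzD : e.symm z ∉ (D : Set X) := by
        have := (hs q hqD).2.2.2.2.2.1 _ h1 hwz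
        rwa [hw, Function.comp_apply, (chartAt ℂ q).left_inv h2.2] at this
      have h5 := (φ.wedge α).compat e he _ (chart_mem_atlas ℂ q) (e.symm z)
        ⟨e.map_target h2.1, h2.2⟩ hzD
      rw [e.right_inv h2.1] at h5
      have h6 := (hs q hqD).2.2.2.2.2.2 _ h1 hwz
      have h7 : η.coeff e z = (φ.wedge α).coeff e z - wirtingerD (β.dzbar e) z := rfl
      have h8 : (φ.wedge α).coeff e z = (φ.wedge α).coeff (chartAt ℂ q) (w z) *
        (deriv w z * starRingEnd ℂ (deriv w z)) := h5
      rw [h7, wirtingerD_congr h3, wirtingerD_pullback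
        ((hBs q hqD _ h1 hwz).differentiableAt (by simp)) hwan, h8, h6]
      rw [hde z]
      simp only [hB]
      field_simp
      ring
  · intro e he
    refine ⟨fun z _ _ => rfl, fun q hq hqD => ?_⟩
    obtain ⟨d, hd, hd0, hde⟩ := hchange e he q hq hqD
    have hl := e.left_inv hq
    have hqs : e.symm (e q) ∈ (chartAt ℂ q).source := by rw [hl]; exact mem_chart_source ℂ q
    have hwa := analyticAt_transition he (chart_mem_atlas ℂ q) (e.map_source hq) hqs
    set w := chartAt ℂ q ∘ e.symm with hw
    have hwq : w (e q) = chartAt ℂ q q := by rw [hw, Function.comp_apply, hl]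
    have hdw : ContDiffAt ℝ ∞ (deriv w) (e q) := hwa.deriv.contDiffAt.restrict_scalars ℝ
    -- The same substitution, with `dw̄` giving the conjugate of `w'` and the pole of order `n q`
    -- giving `d ^ n q`.
    refine ⟨n q, fun z => F q (w z) * starRingEnd ℂ (deriv w z) / d z ^ n q, ?_, ?_⟩
    · refine contDiffAt_real_div (ContDiffAt.mul ?_ (contDiffAt_conj hdw)) (hd.pow _)
        (pow_ne_zero _ hd0)
      refine ContDiffAt.comp (e q) (g := F q) ?_
        (contDiffAt_transition_real he (chart_mem_atlas ℂ q) (e.map_source hq) hqs)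
      rw [hwq]
      exact (hs q hqD).2.2.2.1 _ (hs q hqD).2.1
    · filter_upwards [(hnear e he q hq hqD).filter_mono nhdsWithin_le_nhds] with z hz
      rw [hz]
      simp only [hB]
      rw [hde z, mul_pow]
      ring

/-! ### The sides of the polygon and the bilinear relation -/

theorem boundaryArc_eq_circleMap {g : ℕ} (k : ℕ) :
    boundaryArc g k =
      fun t => circleMap 0 1 (2 * Real.pi / (4 * g) * t + 2 * Real.pi / (4 * g) * k) := by
  ext t
  rw [boundaryArc, circleMap, ofReal_one, one_mul, zero_add]
  congr 1
  push_cast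
  ring

theorem hasDerivAt_boundaryArc (g k : ℕ) (t : ℝ) :
    HasDerivAt (boundaryArc g k) ((2 * Real.pi / (4 * g) : ℝ) •
      deriv (circleMap 0 1) (2 * Real.pi / (4 * g) * t + 2 * Real.pi / (4 * g) * k)) t := by
  rw [boundaryArc_eq_circleMap]
  have h1 : HasDerivAt (fun t : ℝ => 2 * Real.pi / (4 * g) * t + 2 * Real.pi / (4 * g) * k)
      (2 * Real.pi / (4 * g)) t := by
    simpa using ((hasDerivAt_id t).const_mul (2 * Real.pi / (4 * g : ℝ))).add_const
      (2 * Real.pi / (4 * g) * k : ℝ)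
  exact HasDerivAt.scomp t (differentiable_circleMap 0 1 _).hasDerivAt h1

theorem continuous_deriv_boundaryArc (g k : ℕ) : Continuous (deriv (boundaryArc g k)) := by
  have h : deriv (boundaryArc g k) = fun t => (2 * Real.pi / (4 * g) : ℝ) •
      deriv (circleMap 0 1) (2 * Real.pi / (4 * g) * t + 2 * Real.pi / (4 * g) * k) :=
    funext fun t => (hasDerivAt_boundaryArc g k t).deriv
  rw [h]
  simp only [deriv_circleMap]
  fun_prop

theorem continuous_boundaryArc (g k : ℕ) : Continuous (boundaryArc g k) :=
  continuous_iff_continuousAt.2 fun t => (hasDerivAt_boundaryArc g k t).continuousAt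

theorem boundaryArc_mem_sphere (g k : ℕ) (t : ℝ) : boundaryArc g k t ∈ sphere (0 : ℂ) 1 := by
  rw [boundaryArc_eq_circleMap]
  exact circleMap_mem_sphere _ zero_le_one _

theorem boundaryArc_one (g k : ℕ) : boundaryArc g k 1 = boundaryArc g (k + 1) 0 := by
  simp [boundaryArc]

theorem circ_eq_sum_boundaryArc {σ : ℂ → ℂ →L[ℝ] ℂ} (hσ : ContinuousOn σ (sphere 0 1)) {g : ℕ}
    (hg : g ≠ 0) : circ σ 0 1 = ∑ k ∈ Finset.range (4 * g),
      ∫ t in (0 : ℝ)..1, σ (boundaryArc g k t) (deriv (boundaryArc g k) t) := by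
  set h : ℝ := 2 * Real.pi / (4 * g) with hh
  set F : ℝ → ℂ := fun θ => σ (circleMap 0 1 θ) (deriv (circleMap 0 1) θ) with hF
  have hFc : Continuous F := by
    refine (hσ.comp_continuous (continuous_circleMap 0 1) fun θ =>
      circleMap_mem_sphere _ zero_le_one _).clm_apply ?_
    simp only [funext (deriv_circleMap 0 1)]
    fun_prop
  have h1 := intervalIntegral.sum_integral_adjacent_intervals (a := fun k : ℕ => h * k)
    (n := 4 * g) (f := F) (μ := volume) fun k _ => hFc.intervalIntegrable _ _
  have h2 : h * ((4 * g : ℕ) : ℝ) = 2 * Real.pi := by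
    rw [hh]
    push_cast
    field_simp
  rw [circ]
  simp only [h2, Nat.cast_zero, mul_zero] at h1
  rw [← h1]
  refine Finset.sum_congr rfl fun k _ => ?_
  have h3 : ∀ t, σ (boundaryArc g k t) (deriv (boundaryArc g k) t) = h • F (h * t + h * k) := by
    intro t
    rw [(hasDerivAt_boundaryArc g k t).deriv, map_smul, boundaryArc_eq_circleMap]
  simp only [h3]
  rw [intervalIntegral.integral_smul, intervalIntegral.smul_integral_comp_mul_add]
  congr 1 <;> push_cast <;> ring

namespace CanonicalDissection

variable {g : ℕ} (K : CanonicalDissection X g)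

/-- The pull-back of a form to the `k`-th side of the cut surface. -/
noncomputable def sideForm {D : Set X} (η : OneForm X D) (k : ℕ) (t : ℝ) : ℂ :=
  K.pull η (boundaryArc g k t) (deriv (boundaryArc g k) t)

variable [IsManifold 𝓘(ℂ, ℂ) ω X]

theorem boundaryArc_mem (k : ℕ) (t : ℝ) : boundaryArc g k t ∈ closedBall (0 : ℂ) 1 :=
  sphere_subset_closedBall (boundaryArc_mem_sphere g k t)

theorem integrand_boundaryArc {D : Set X} (η : OneForm X D) (k : ℕ) (t : ℝ) :
    η.integrand (K.proj ∘ boundaryArc g k) t = K.sideForm η k t := by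
  have h := hasDerivAt_boundaryArc g k t
  rw [K.integrand_comp η h (Eventually.of_forall fun τ => boundaryArc_mem k τ), sideForm, h.deriv]

theorem curveIntegral_side {D : Set X} (η : OneForm X D) {k : ℕ} {γ : ℝ → X}
    (h : ∀ t ∈ Icc (0 : ℝ) 1, K.proj (boundaryArc g k t) = γ t) :
    η.curveIntegral γ = ∫ t in (0 : ℝ)..1, K.sideForm η k t := by
  rw [← η.curveIntegral_congr (γ := K.proj ∘ boundaryArc g k)
    fun t ht => h t (Ioo_subset_Icc_self ht), OneForm.curveIntegral_eq]
  simp only [K.integrand_boundaryArc]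

theorem continuous_sideForm {D : Set X} (hD : _root_.IsClosed D) (hDK : ∀ p ∈ D, p ∉ K.cutLocus)
    (η : OneForm X D) (k : ℕ) : Continuous (K.sideForm η k) := by
  refine (ContinuousOn.comp_continuous (s := sphere 0 1) (g := K.pull η) (fun z hz => ?_)
    (continuous_boundaryArc g k) (boundaryArc_mem_sphere g k)).clm_apply
    (continuous_deriv_boundaryArc g k)
  exact (K.continuousWithinAt_pull hD η (sphere_subset_closedBall hz)
    fun h => hDK _ h ⟨z, hz, rfl⟩).mono sphere_subset_closedBall

/-- On two sides glued with opposite directions, a form has opposite pull-backs. -/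
theorem sideForm_eq_neg {D : Set X} (η : OneForm X D) {k l : ℕ}
    (h : ∀ t ∈ Icc (0 : ℝ) 1, K.proj (boundaryArc g l t) = K.proj (boundaryArc g k (1 - t)))
    {t : ℝ} (ht : t ∈ Ioo (0 : ℝ) 1) : K.sideForm η l t = -K.sideForm η k (1 - t) := by
  rw [← integrand_boundaryArc, ← integrand_boundaryArc, ← η.integrand_one_sub]
  refine η.integrand_congr ?_
  filter_upwards [Ioo_mem_nhds ht.1 ht.2] with τ hτ
  exact h τ (Ioo_subset_Icc_self hτ)

variable {α : OneForm X (∅ : Set X)} {u : ℂ → ℂ}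

omit [IsManifold 𝓘(ℂ, ℂ) ω X] in
theorem hasDerivAt_side
    (hu : ∀ z ∈ closedBall (0 : ℂ) 1, HasFDerivWithinAt u (K.pull α z) (closedBall 0 1) z)
    (k : ℕ) (t : ℝ) : HasDerivAt (fun t => u (boundaryArc g k t)) (K.sideForm α k t) t := by
  have h := hasDerivAt_boundaryArc g k t
  have h1 := (hu _ (boundaryArc_mem k t)).comp_hasDerivWithinAt t (s := univ)
    h.hasDerivWithinAt (fun τ _ => boundaryArc_mem k τ)
  rw [sideForm, h.deriv]
  exact h1.hasDerivAt univ_mem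

theorem integral_sideForm
    (hu : ∀ z ∈ closedBall (0 : ℂ) 1, HasFDerivWithinAt u (K.pull α z) (closedBall 0 1) z)
    (k : ℕ) : ∫ t in (0 : ℝ)..1, K.sideForm α k t =
      u (boundaryArc g k 1) - u (boundaryArc g k 0) :=
  intervalIntegral.integral_eq_sub_of_hasDerivAt (fun t _ => K.hasDerivAt_side hu k t)
    ((K.continuous_sideForm isClosed_empty (by simp) α k).intervalIntegrable _ _)

/-- The primitives on two glued sides differ by a constant. -/
theorem primitive_side_sub
    (hu : ∀ z ∈ closedBall (0 : ℂ) 1, HasFDerivWithinAt u (K.pull α z) (closedBall 0 1) z)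
    {k l : ℕ}
    (h : ∀ t ∈ Icc (0 : ℝ) 1, K.proj (boundaryArc g l t) = K.proj (boundaryArc g k (1 - t)))
    {t : ℝ} (ht : t ∈ Icc (0 : ℝ) 1) : u (boundaryArc g k (1 - t)) - u (boundaryArc g l t) =
      u (boundaryArc g k 1) - u (boundaryArc g l 0) := by
  set F : ℝ → ℂ := fun t => u (boundaryArc g k (1 - t)) - u (boundaryArc g l t) with hF
  have hd : ∀ τ, HasDerivAt F (-K.sideForm α k (1 - τ) - K.sideForm α l τ) τ := by
    intro τ
    have h1 := HasDerivAt.scomp τ (h := fun τ : ℝ => 1 - τ) (K.hasDerivAt_side hu k (1 - τ))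
      ((hasDerivAt_id τ).const_sub 1)
    have h2 := h1.sub (K.hasDerivAt_side hu l τ)
    rw [neg_one_smul] at h2
    exact h2
  have h2 := intervalIntegral.integral_eq_sub_of_hasDerivAt_of_le ht.1 (f := F) (f' := fun _ => 0)
    (fun τ _ => (hd τ).continuousAt.continuousWithinAt) (fun τ hτ => by
      have h3 := hd τ
      rwa [K.sideForm_eq_neg α h ⟨hτ.1, hτ.2.trans_le ht.2⟩, sub_neg_eq_add,
        neg_add_cancel] at h3) (by simp)
  rw [intervalIntegral.integral_zero, eq_comm, sub_eq_zero] at h2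
  simpa [hF] using h2

variable {D : Finset X} [T2Space X] {φ β : OneForm X (D : Set X)}

/-- Reversing the second side turns the pull-backs of `φ` and `β` into their opposites on the first.
So `β` cancels, and `u φ` leaves the difference of the two values of `u`, a constant by
`primitive_side_sub`. -/
theorem integral_cutForm_side_add (hD : ∀ p ∈ D, p ∉ K.cutLocus)
    (hu : ∀ z ∈ closedBall (0 : ℂ) 1, HasFDerivWithinAt u (K.pull α z) (closedBall 0 1) z)
    {k l : ℕ}
    (h : ∀ t ∈ Icc (0 : ℝ) 1, K.proj (boundaryArc g l t) = K.proj (boundaryArc g k (1 - t))) :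
    (∫ t in (0 : ℝ)..1, K.cutForm u φ β (boundaryArc g k t) (deriv (boundaryArc g k) t)) +
      (∫ t in (0 : ℝ)..1, K.cutForm u φ β (boundaryArc g l t) (deriv (boundaryArc g l) t)) =
      (u (boundaryArc g k 1) - u (boundaryArc g l 0)) * ∫ t in (0 : ℝ)..1, K.sideForm φ k t := by
  have hDc : _root_.IsClosed (D : Set X) := D.finite_toSet.isClosed
  have hφ := K.continuous_sideForm hDc hD φ
  have hβ := K.continuous_sideForm hDc hD β
  have hU : ∀ k, Continuous fun t => u (boundaryArc g k t) := fun k =>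
    continuous_iff_continuousAt.2 fun t => (K.hasDerivAt_side hu k t).continuousAt
  have h1 : ∀ k t, K.cutForm u φ β (boundaryArc g k t) (deriv (boundaryArc g k) t) =
      u (boundaryArc g k t) * K.sideForm φ k t + K.sideForm β k t := fun k t => rfl
  simp only [h1]
  have h2 : ∫ t in (0 : ℝ)..1, (u (boundaryArc g l t) * K.sideForm φ l t + K.sideForm β l t) =
      ∫ t in (0 : ℝ)..1, -(u (boundaryArc g l (1 - t)) * K.sideForm φ k t + K.sideForm β k t) := by
    have h3 := intervalIntegral.integral_comp_sub_left (a := 0) (b := 1) (fun t =>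
      -(u (boundaryArc g l (1 - t)) * K.sideForm φ k t + K.sideForm β k t)) 1
    rw [sub_self, sub_zero] at h3
    rw [← h3, intervalIntegral.integral_of_le zero_le_one,
      intervalIntegral.integral_of_le zero_le_one, integral_Ioc_eq_integral_Ioo,
      integral_Ioc_eq_integral_Ioo]
    refine setIntegral_congr_fun measurableSet_Ioo fun t ht => ?_
    simp only [K.sideForm_eq_neg φ h ht, K.sideForm_eq_neg β h ht, sub_sub_cancel]
    ring
  have hU' : Continuous fun t => u (boundaryArc g l (1 - t)) :=
    (hU l).comp (continuous_const.sub continuous_id)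
  have h3 : Continuous fun t => u (boundaryArc g k t) * K.sideForm φ k t + K.sideForm β k t :=
    ((hU k).mul (hφ k)).add (hβ k)
  have h4 : Continuous fun t =>
      -(u (boundaryArc g l (1 - t)) * K.sideForm φ k t + K.sideForm β k t) :=
    ((hU'.mul (hφ k)).add (hβ k)).neg
  rw [h2, ← intervalIntegral.integral_add (h3.intervalIntegrable _ _) (h4.intervalIntegrable _ _),
    ← intervalIntegral.integral_const_mul]
  refine intervalIntegral.integral_congr fun t ht => ?_
  rw [uIcc_of_le zero_le_one] at ht
  have h5 := K.primitive_side_sub hu h (t := 1 - t) ⟨by linarith [ht.2], by linarith [ht.1]⟩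
  rw [sub_sub_cancel] at h5
  rw [← h5]
  ring

/-- The grouping puts each side next to the one it is glued to in the word `A B A⁻¹ B⁻¹`. -/
theorem _root_.Finset.sum_range_four_mul {M : Type*} [AddCommMonoid M] (f : ℕ → M) (n : ℕ) :
    ∑ k ∈ Finset.range (4 * n), f k =
      ∑ i ∈ Finset.range n, (f (4 * i) + f (4 * i + 2) + (f (4 * i + 1) + f (4 * i + 3))) := by
  induction n with
  | zero => simp
  | succ n ih =>
    rw [Finset.sum_range_succ, ← ih, show 4 * (n + 1) = 4 * n + 1 + 1 + 1 + 1 by ring,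
      Finset.sum_range_succ, Finset.sum_range_succ, Finset.sum_range_succ, Finset.sum_range_succ]
    simp only [add_assoc]
    abel_nf

/-- The bilinear relation: the contribution of the boundary of the cut surface. -/
theorem circ_cutForm (hD : ∀ p ∈ D, p ∉ K.cutLocus)
    (hu : ∀ z ∈ closedBall (0 : ℂ) 1, HasFDerivWithinAt u (K.pull α z) (closedBall 0 1) z) :
    circ (K.cutForm u φ β) 0 1 = -∑ i : Fin g,
      (φ.curveIntegral (K.δ (Sum.inl i)) * α.curveIntegral (K.δ (Sum.inr i)) -
        α.curveIntegral (K.δ (Sum.inl i)) * φ.curveIntegral (K.δ (Sum.inr i))) := by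
  rcases Nat.eq_zero_or_pos g with hg | hg
  -- In genus zero `boundaryArc` divides by zero and is useless. The boundary circle is collapsed to
  -- a point, so every pull-back vanishes along it.
  · have h1 : ∀ {D : Set X} (η : OneForm X D) (θ : ℝ),
        K.pull η (circleMap 0 1 θ) (deriv (circleMap 0 1) θ) = 0 := by
      intro D η θ
      rw [← K.integrand_comp η (differentiable_circleMap 0 1 θ).hasDerivAt
        (Eventually.of_forall fun τ => sphere_subset_closedBall
          (circleMap_mem_sphere _ zero_le_one _))]
      have h2 : K.proj ∘ circleMap 0 1 = fun _ => K.basePoint := funext fun τ =>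
        K.genus_zero hg _ (circleMap_mem_sphere _ zero_le_one _)
      rw [h2, OneForm.integrand]
      have h3 : (chartAt ℂ K.basePoint ∘ fun _ : ℝ => K.basePoint) =
        fun _ => chartAt ℂ K.basePoint K.basePoint := rfl
      simp [h3]
    have h2 : circ (K.cutForm u φ β) 0 1 = 0 := by
      have h3 : ∀ θ, K.cutForm u φ β (circleMap 0 1 θ) (deriv (circleMap 0 1) θ) = 0 := by
        intro θ
        rw [cutForm, _root_.add_apply, _root_.smul_apply, h1, h1, smul_zero, zero_add]
      simp only [circ, h3, intervalIntegral.integral_zero]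
    subst hg
    simp [h2]
  · have hc : ContinuousOn (K.cutForm u φ β) (sphere 0 1) := fun z hz =>
      (K.continuousOn_cutForm hu (sphere_subset_closedBall hz)
        fun h => hD _ h ⟨z, hz, rfl⟩).mono sphere_subset_closedBall
    rw [circ_eq_sum_boundaryArc hc hg.ne', Finset.sum_range_four_mul, Finset.sum_range,
      ← Finset.sum_neg_distrib]
    refine Finset.sum_congr rfl fun i _ => ?_
    have hA : ∀ t ∈ Icc (0 : ℝ) 1, K.proj (boundaryArc g (4 * i + 2) t) =
        K.proj (boundaryArc g (4 * i) (1 - t)) := fun t ht => by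
      rw [K.side_A_inv i t ht, K.side_A i (1 - t) ⟨by linarith [ht.2], by linarith [ht.1]⟩]
    have hB : ∀ t ∈ Icc (0 : ℝ) 1, K.proj (boundaryArc g (4 * i + 3) t) =
        K.proj (boundaryArc g (4 * i + 1) (1 - t)) := fun t ht => by
      rw [K.side_B_inv i t ht, K.side_B i (1 - t) ⟨by linarith [ht.2], by linarith [ht.1]⟩]
    rw [K.integral_cutForm_side_add hD hu hA, K.integral_cutForm_side_add hD hu hB,
      K.curveIntegral_side φ (K.side_A i), K.curveIntegral_side φ (K.side_B i),
      K.curveIntegral_side α (K.side_A i), K.curveIntegral_side α (K.side_B i),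
      K.integral_sideForm hu, K.integral_sideForm hu]
    -- Between the two `A` sides lies `B`, so that jump of `u` is minus the `B`-period of `α`.
    -- Between the two `B` sides lies `A⁻¹`; `h1` says that the increment of `u` there is the
    -- opposite of the `A`-period.
    have h1 := K.primitive_side_sub hu hA (right_mem_Icc.2 zero_le_one)
    rw [sub_self] at h1
    simp only [boundaryArc_one] at h1 ⊢
    linear_combination (∫ t in (0 : ℝ)..1, K.sideForm φ (4 * i + 1) t) * h1

end CanonicalDissection

end RiemannSurface

/-! ### Conclusion -/

open RiemannSurface in
theorem proposition2p13 {X : Type*} [TopologicalSpace X] [T2Space X] [CompactSpace X]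
    [ConnectedSpace X] [ChartedSpace ℂ X] [IsManifold 𝓘(ℂ, ℂ) ω X]
    (g : ℕ) (K : CanonicalDissection X g)
    (D : Finset X) (hD : ∀ p ∈ D, p ∉ K.cutLocus)
    (φ : OneForm X (D : Set X)) (hφ : φ.IsMeromorphic)
    (α : OneForm X (∅ : Set X)) (hα : α.IsClosed)
    (q₀ : ℂ) (hq₀ : q₀ ∈ Metric.closedBall (0 : ℂ) 1) (hq₀' : K.proj q₀ = K.basePoint) :
    ∃ u : ℂ → ℂ, K.IsPathIntegral α q₀ u ∧
      ∃ R : X → ℂ, (∀ p ∈ D, φ.HasResidueMul (fun x => u (K.lift x)) p (R p)) ∧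
        (φ.wedge α).HasRegularizedIntegral
          (∑ i : Fin g,
            (φ.curveIntegral (K.δ (Sum.inl i)) * α.curveIntegral (K.δ (Sum.inr i)) -
              α.curveIntegral (K.δ (Sum.inl i)) * φ.curveIntegral (K.δ (Sum.inr i))) +
            2 * Real.pi * Complex.I * ∑ p ∈ D, R p) := by
  classical
  obtain ⟨u, hu0, hu⟩ := K.exists_primitive α hα (q₀ := q₀)
  -- One decomposition is enough to show that the residues exist. Their values do not refer to it,
  -- so the same `R` serves below for every decomposition.
  obtain ⟨η₀, β₀, hdec₀⟩ := exists_logDecomposition hφ α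
  have hres : ∀ p, ∃ r, p ∈ D → φ.HasResidueMul (fun x => u (K.lift x)) p r := by
    intro p
    by_cases hp : p ∈ D
    · obtain ⟨r, hr⟩ := K.exists_hasResidueMul hu hφ hdec₀ hp (hD p hp)
      exact ⟨r, fun _ => hr⟩
    · exact ⟨0, fun h => absurd h hp⟩
  choose R hR using hres
  refine ⟨u, fun z _ γ hγ hm h0 h1 => ?_, R, hR, ⟨η₀, β₀, hdec₀⟩, fun η β hdec => ?_⟩
  · rw [K.curveIntegral_eq_sub hu hγ hm, h0, h1, hu0, sub_zero]
  · have h := (K.hasIntegral_neg_integral_extd hu hφ hdec).2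
    rwa [K.integral_extd_cutForm hD hu hφ hdec hR, K.circ_cutForm hD hu, neg_sub, sub_neg_eq_add,
      add_comm] at h
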